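/- Let $d,N\in\mathbb N$, $\underline x\in\mathbb R^d$, and let $U\subset\mathbb R\times\mathbb R^d\times\mathbb R^N$ be an open neighbourhood of $(0,\underline x,0)$. Let $A_1,\dots,A_d$ (with values in the real $N\times N$ matrices) and $F$ (with values in $\mathbb R^N$) be real analytic on $U$, with $F(t,x,0)=0$ whenever $(t,x,0)\in U$. Assume that for some $\underline\xi\in\mathbb R^d$ the matrix $\sum_j\underline\xi_jA_j(0,\underline x,0)$ has a nonreal eigenvalue. Consider the Cauchy problem $$\partial_tu=\sum_{j=1}^dA_j(t,x,u)\,\partial_{x_j}u+F(t,x,u),\qquad u_{|t=0}=h .\tag{1}$$ Write $B_r=\{x:|x-\underline x|<r\}$ and $\Omega_{r,\delta}=\{(t,x): t\ge 0,\ |x-\underline x|^2+\delta t<r^2\}$. A solution of (1) on $\Omega_{r,\delta}$ is a function $u\in C^1(\overline{\Omega_{r,\delta}};\mathbb R^N)$ such that $(t,x,u(t,x))\in U$ and the equation holds at every point of $\Omega_{r,\delta}$, and $u(0,\cdot)=h$ almost everywhere on $B_r$. Let $m\ge 0$ be an integer. (i) For every $\alpha\in\,]0,1]$, $r_0>0$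 and $\delta>0$ there are $\varepsilon_0>0$ and, for $0<\varepsilon<\varepsilon_0$, radii $r_\varepsilon\in\,]0,r_0]$, data $h_\varepsilon\in H^m(B_{r_0})$ with $\|h_\varepsilon\|_{H^m(B_{r_0})}\neq0$, and solutions $u_\varepsilon$ of (1) on $\Omega_{r_\varepsilon,\delta}$ with datum $h_\varepsilon$, such that, as $\varepsilon\to0$, $$r_\varepsilon\to0,\qquad \|h_\varepsilon\|_{H^m(B_{r_0})}\to0,\qquad \frac{\|u_\varepsilon\|_{L^2(\Omega_{r_\varepsilon,\delta})}}{\|h_\varepsilon\|^{\alpha}_{H^m(B_{r_0})}}\to+\infty .$$ (ii) Consequently (1) is not Hölder well posed on $H^m$ near the zero datum. That is, there are no constants $r_0>r_1>0$, $\delta>0$, $c>0$, $C$ and $\alpha\in\,]0,1]$ such that: for every $h\in H^m(B_{r_0})$ with $\|h\|_{H^m(B_{r_0})}\le c$ and every $r\in\,]0,r_1]$, problem (1) has a unique solution on $\Omega_{r,\delta}$, and this solution and its first derivatives are bounded by $C$ on $\overline{\Omega_{r,\delta}}$; and, for any two such data $h_1,h_2$ and every $r\in\,]0,r_1[$, the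 corresponding solutions satisfy $\|u_1-u_2\|_{L^\infty(\Omega_{r,\delta})}\le C\|h_1-h_2\|^\alpha_{H^m(B_{r_0})}$. -/

import Mathlib

open MeasureTheory Filter Topology
open scoped ContDiff

namespace HadamardInstability

/-- The space of positions, with its Euclidean norm. -/
abbrev Pos (d : ℕ) : Type := EuclideanSpace ℝ (Fin d)

/-- The space of values of the unknown. -/
abbrev Val (N : ℕ) : Type := EuclideanSpace ℝ (Fin N)

/-! ### Sobolev spaces of integer order on an open set -/

/-- The classical partial derivative of a scalar function in the `j`-th coordinate direction. -/
noncomputable def pderiv {d : ℕ} (j : Fin d) (φ : Pos d → ℝ) : Pos d → ℝ :=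
  fun x => fderiv ℝ φ x (EuclideanSpace.single j 1)

/-- The classical iterated partial derivative with multi-index `β`: `β j` derivatives in the
`j`-th coordinate direction, for every `j`. It is applied to smooth functions only, so the order
of the derivatives is immaterial. -/
noncomputable def multiDeriv {d : ℕ} (β : Fin d → ℕ) (φ : Pos d → ℝ) : Pos d → ℝ :=
  (List.finRange d).foldr (fun j f => (pderiv j)^[β j] f) φ

/-- `g` is a weak derivative of `h` with multi-index `β` on `B`, with `g` square integrable on `B`.
-/
def IsWeakDeriv {d N : ℕ} (B : Set (Pos d)) (β : Fin d → ℕ) (h g : Pos d → Val N) : Prop :=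
  MemLp g 2 (volume.restrict B) ∧
    ∀ φ : Pos d → ℝ, ContDiff ℝ ∞ φ → HasCompactSupport φ → tsupport φ ⊆ B →
      ∫ x in B, multiDeriv β φ x • h x = (-1 : ℝ) ^ (∑ j, β j) • ∫ x in B, φ x • g x

/-- `h` belongs to `H^m(B)`: it is square integrable on `B`, and so are its weak derivatives of
order at most `m`. -/
def MemSobolev {d N : ℕ} (m : ℕ) (B : Set (Pos d)) (h : Pos d → Val N) : Prop :=
  MemLp h 2 (volume.restrict B) ∧
    ∀ β : Fin d → ℕ, ∑ j, β j ≤ m → ∃ g, IsWeakDeriv B β h g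

open Classical in
/-- The square integrable weak derivative of multi-index `β` on the open set `B`, when there is one
(it is then unique almost everywhere on `B`), and zero otherwise. -/
noncomputable def weakDeriv {d N : ℕ} (B : Set (Pos d)) (β : Fin d → ℕ) (h : Pos d → Val N) :
    Pos d → Val N :=
  if H : ∃ g, IsWeakDeriv B β h g then H.choose else 0

/-- The `L^2` norm on a set. -/
noncomputable def l2Norm {X : Type*} [MeasureSpace X] {N : ℕ} (S : Set X) (u : X → Val N) : ℝ :=
  (eLpNorm u 2 (volume.restrict S)).toReal

/-- The norm of `H^m(B)`: the square root of the sum of `‖∂^β h‖²_{L²(B)}` over all the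
multi-indices `β` of length at most `m`. -/
noncomputable def sobolevNorm {d N : ℕ} (m : ℕ) (B : Set (Pos d)) (h : Pos d → Val N) : ℝ :=
  Real.sqrt (∑ k ∈ Finset.range (m + 1), ∑ β ∈ Finset.piAntidiag (Finset.univ : Finset (Fin d)) k,
    l2Norm B (weakDeriv B β h) ^ 2)

/-! ### The Cauchy problem on lens shaped domains -/

/-- The lens `{(t, x) : t ≥ 0, |x - x₀|² + δ t < r²}`. -/
def lens {d : ℕ} (x₀ : Pos d) (r δ : ℝ) : Set (ℝ × Pos d) :=
  {p | 0 ≤ p.1 ∧ ‖p.2 - x₀‖ ^ 2 + δ * p.1 < r ^ 2}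

/-- `u` is a classical solution of `∂ₜ u = ∑ⱼ Aⱼ(t,x,u) ∂_{xⱼ} u + F(t,x,u)`, `u(0,·) = h`, on the
lens with parameters `x₀, r, δ`: it is of class `C¹` on the closed lens, `(t, x, u(t,x))` stays in
the domain `U` of the coefficients, the equation holds at every point of the lens (with one-sided
time derivatives at `t = 0`), and the trace of `u` at `t = 0` is `h` on the ball of radius `r`
(almost everywhere, since `h` is an element of a space of classes of functions). -/
structure IsSolution {d N : ℕ} (A : Fin d → ℝ × Pos d × Val N → Matrix (Fin N) (Fin N) ℝ)
    (F : ℝ × Pos d × Val N → Val N) (U : Set (ℝ × Pos d × Val N))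
    (x₀ : Pos d) (r δ : ℝ) (h : Pos d → Val N) (u : ℝ × Pos d → Val N) : Prop where
  contDiffOn : ContDiffOn ℝ 1 u (closure (lens x₀ r δ))
  mem_domain : ∀ p ∈ lens x₀ r δ, (p.1, p.2, u p) ∈ U
  equation : ∀ p ∈ lens x₀ r δ, ∀ i : Fin N,
    fderivWithin ℝ u (closure (lens x₀ r δ)) p (1, 0) i =
      (∑ j : Fin d, ∑ k : Fin N, A j (p.1, p.2, u p) i k *
        fderivWithin ℝ u (closure (lens x₀ r δ)) p (0, EuclideanSpace.single j 1) k) +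
      F (p.1, p.2, u p) i
  initial : ∀ᵐ x ∂(volume.restrict (Metric.ball x₀ r)), u (0, x) = h x

/-- Hölder well-posedness on `H^m`, near the zero datum, of the Cauchy problem at `(0, x₀)`: for
all small data there is a unique `C¹` solution on the closed lenses of small radius, it is bounded
in `C¹`, and it depends on the datum in a Hölder continuous way. -/
def HolderWellPosed {d N : ℕ} (A : Fin d → ℝ × Pos d × Val N → Matrix (Fin N) (Fin N) ℝ)
    (F : ℝ × Pos d × Val N → Val N) (U : Set (ℝ × Pos d × Val N))
    (x₀ : Pos d) (m : ℕ) : Prop :=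
  ∃ r₀ r₁ δ c C α : ℝ, 0 < r₁ ∧ r₁ < r₀ ∧ 0 < δ ∧ 0 < c ∧ 0 < α ∧ α ≤ 1 ∧
    (∀ h : Pos d → Val N, MemSobolev m (Metric.ball x₀ r₀) h →
      sobolevNorm m (Metric.ball x₀ r₀) h ≤ c → ∀ r : ℝ, 0 < r → r ≤ r₁ →
        (∃ u, IsSolution A F U x₀ r δ h u ∧ ∀ p ∈ closure (lens x₀ r δ),
          ‖u p‖ ≤ C ∧ ‖fderivWithin ℝ u (closure (lens x₀ r δ)) p‖ ≤ C) ∧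
        (∀ u v, IsSolution A F U x₀ r δ h u → IsSolution A F U x₀ r δ h v →
          Set.EqOn u v (closure (lens x₀ r δ)))) ∧
    (∀ h₁ h₂ : Pos d → Val N,
      MemSobolev m (Metric.ball x₀ r₀) h₁ → sobolevNorm m (Metric.ball x₀ r₀) h₁ ≤ c →
      MemSobolev m (Metric.ball x₀ r₀) h₂ → sobolevNorm m (Metric.ball x₀ r₀) h₂ ≤ c →
      ∀ r : ℝ, 0 < r → r < r₁ → ∀ u₁ u₂ : ℝ × Pos d → Val N,
        IsSolution A F U x₀ r δ h₁ u₁ → IsSolution A F U x₀ r δ h₂ u₂ →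
        ∀ p ∈ lens x₀ r δ,
          ‖u₁ p - u₂ p‖ ≤ C * sobolevNorm m (Metric.ball x₀ r₀) (h₁ - h₂) ^ α)

end HadamardInstability

/-! The mechanism is Hadamard's. Freeze the coefficients at `(0, x₀, 0)` and drop the source. The
matrix in the direction `ξ` is real, so it has an eigenvalue `λ` with `Im λ = -γ < 0`, and a plane
wave of frequency `E` is amplified by `exp (γ E t)`. With `E = exp L`, times of order `L / E`
suffice for an amplification by a fixed power of `E`, while the lenses that contain such times have
radius of order `√(L / E)` and shrink to the base point. The real task is to produce exact solutions
of the nonlinear system that follow these waves for about `L` units of the fast time `E t`. No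
energy estimate is available for this; analyticity replaces it.

The solutions are sought as series `∑ g_i(τ) X^i` with `τ = t / T`. The variables `X` are the
rescaled positions `exp τ · (x_j - x₀_j) / ρ` and the two exponentials `exp (Γ (τ - 1) ± iθ)`, where
`θ = (S / T) ξ · (x - x₀)`. The coefficients lie in `C([0,1], ℂ)` and are absolutely summable, so
that the series form a commutative Banach algebra, `Alg`. Since the variables grow with `τ`, the
equation for `g_i` contains a damping `zdeg i + Γ wdeg i`; it beats the growth `c S |freq i|` of the
frozen propagator because `Γ > c S`. Integrating in time therefore gains `1 / weight i`
(`Scale.norm_exp_gen_le`, `norm_volterraFun_le`), which pays for one derivative in `X` or in the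
phase. With the unknown `G_i = weight i · g_i` the system becomes a contraction in one fixed Banach
space (`Scale.norm_rhs_sub_le`, `Symbol.exists_solution`): this is a Cauchy–Kovalevskaya argument
that keeps track of the oscillation.

Analytic functions act on `Alg` through their power series (`calculus`), and this action commutes
with contractive algebra morphisms (`map_calculus`). Evaluation at a point then yields the
differential system (`Scale.field_equation`); conjugation and uniqueness yield real solutions
(`Scale.conjAlg_eq`); truncation shows that every monomial of the right hand side contains an
exponential (`Scale.coeff_rhs_eq_zero`). The source enters the fixed point equation minus its value
at `u = 0`, which is legitimate because `F(t, x, 0) = 0`.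

It remains to choose scales. With amplitude `exp (-M L)` the datum has `H^m` norm at most a constant
times `exp (-(M - m) L)`. Near the fast time `b₀ L` the solution is at least a constant times `exp
((γ b₀ - M) L)` on a space-time box of side comparable to `exp (-L)`, whose volume contributes `exp
(-(d + 1) L / 2)` to the `L²` norm. The wave must stay small up to the fast time `b₁ L > b₀ L`,
which requires `γ' b₁ < M`, and the relative error, of order `exp ((γ' - γ) b₀ L) · L² exp (-L /
2)`, must tend to zero, which requires `γ'` close to `γ`. This closeness is possible because `λ` is
taken with the largest `|Im|`, so that the rate `c` of the propagator can be any number above `γ`.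
`exists_growth_parameters` meets all the constraints with a margin `exp (2 L)`. Failure of Hölder
well-posedness follows by comparison with the zero solution. -/

namespace HadamardInstability

/-! ### The algebra of absolutely summable power series -/

section Wiener

variable (σ R : Type*) [NormedCommRing R] [NormedAlgebra ℝ R]

/-- The power series over `R` with absolutely summable coefficients. -/
def summableSeries : Subalgebra ℝ (MvPowerSeries σ R) where
  carrier := {f | Summable fun i => ‖MvPowerSeries.coeff i f‖}
  mul_mem' {f g} hf hg := by
    classical
    have := summable_sum_mul_antidiagonal_of_summable_mul
      (Summable.mul_of_nonneg hf hg (fun _ => norm_nonneg _) fun _ => norm_nonneg _)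
    refine this.of_nonneg_of_le (fun _ => norm_nonneg _) fun i => ?_
    rw [MvPowerSeries.coeff_mul]
    exact (norm_sum_le _ _).trans (Finset.sum_le_sum fun _ _ => norm_mul_le _ _)
  add_mem' {f g} hf hg := by
    refine (hf.add hg).of_nonneg_of_le (fun _ => norm_nonneg _) fun i => ?_
    rw [map_add]
    exact norm_add_le _ _
  algebraMap_mem' r := by
    classical
    refine summable_of_ne_finset_zero (s := {0}) fun i hi => ?_
    rw [MvPowerSeries.algebraMap_apply, MvPowerSeries.coeff_C, if_neg (by simpa using hi),
      norm_zero]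

/-- The Banach algebra of power series with absolutely summable coefficients. -/
def Wiener : Type _ := summableSeries σ R

namespace Wiener

noncomputable instance : CommRing (Wiener σ R) :=
  inferInstanceAs (CommRing (summableSeries σ R))

noncomputable instance : Algebra ℝ (Wiener σ R) :=
  inferInstanceAs (Algebra ℝ (summableSeries σ R))

variable {σ R}

/-- The coefficients of an absolutely summable power series. -/
def coeff (i : σ →₀ ℕ) : Wiener σ R →ₗ[ℝ] R where
  toFun f := MvPowerSeries.coeff i f.1
  map_add' _ _ := rfl
  map_smul' _ _ := rfl

theorem summable_norm_coeff (f : Wiener σ R) : Summable fun i => ‖coeff i f‖ := f.2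

theorem ext {f g : Wiener σ R} (h : ∀ i, coeff i f = coeff i g) : f = g :=
  Subtype.ext (MvPowerSeries.ext h)

/-- The absolutely summable power series with given coefficients. -/
def mk (c : (σ →₀ ℕ) → R) (hc : Summable fun i => ‖c i‖) : Wiener σ R := ⟨c, hc⟩

@[simp] theorem coeff_mk (c : (σ →₀ ℕ) → R) (hc : Summable fun i => ‖c i‖) (i : σ →₀ ℕ) :
    coeff i (mk c hc) = c i := rfl

theorem coeff_mul [DecidableEq σ] (f g : Wiener σ R) (i : σ →₀ ℕ) :
    coeff i (f * g) = ∑ p ∈ Finset.HasAntidiagonal.antidiagonal i, coeff p.1 f * coeff p.2 g :=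
  MvPowerSeries.coeff_mul i f.1 g.1

theorem coeff_one [DecidableEq σ] (i : σ →₀ ℕ) :
    coeff i (1 : Wiener σ R) = if i = 0 then 1 else 0 := MvPowerSeries.coeff_one i

/-- The sum of the norms of the coefficients, as a group norm. -/
noncomputable def groupNorm : AddGroupNorm (Wiener σ R) where
  toFun f := ∑' i, ‖coeff i f‖
  map_zero' := by simp
  add_le' f g := by
    rw [← (summable_norm_coeff f).tsum_add (summable_norm_coeff g)]
    refine (summable_norm_coeff (f + g)).tsum_le_tsum (fun i => ?_)
      ((summable_norm_coeff f).add (summable_norm_coeff g))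
    rw [map_add]
    exact norm_add_le _ _
  neg' f := by simp
  eq_zero_of_map_eq_zero' f hf := by
    have h := (hasSum_zero_iff_of_nonneg fun i => norm_nonneg (coeff i f)).1
      (hf ▸ (summable_norm_coeff f).hasSum)
    exact ext fun i => by simpa using congrFun h i

noncomputable instance : NormedAddCommGroup (Wiener σ R) :=
  groupNorm.toNormedAddCommGroup

theorem norm_def (f : Wiener σ R) : ‖f‖ = ∑' i, ‖coeff i f‖ := rfl

theorem hasSum_norm (f : Wiener σ R) : HasSum (fun i => ‖coeff i f‖) ‖f‖ :=
  (summable_norm_coeff f).hasSum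

theorem tsum_mul_tsum [DecidableEq σ] {A : Type*} [NormedCommRing A] {a b : (σ →₀ ℕ) → A}
    (ha : Summable a) (hb : Summable b)
    (h : Summable fun p : (σ →₀ ℕ) × (σ →₀ ℕ) => a p.1 * b p.2) :
    (∑' i, a i) * (∑' i, b i) =
      ∑' i, ∑ p ∈ Finset.HasAntidiagonal.antidiagonal i, a p.1 * b p.2 :=
  Summable.tsum_mul_tsum_eq_tsum_sum_antidiagonal ha hb h

theorem norm_mul_le_norm_mul_norm [DecidableEq σ] (f g : Wiener σ R) :
    ‖f * g‖ ≤ ‖f‖ * ‖g‖ := by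
  have hfg : Summable fun p : (σ →₀ ℕ) × (σ →₀ ℕ) => ‖coeff p.1 f‖ * ‖coeff p.2 g‖ :=
    Summable.mul_of_nonneg (f := fun i => ‖coeff i f‖) (g := fun i => ‖coeff i g‖)
      (summable_norm_coeff f) (summable_norm_coeff g) (fun _ => norm_nonneg _)
      fun _ => norm_nonneg _
  have key := tsum_mul_tsum (a := fun i => ‖coeff i f‖) (b := fun i => ‖coeff i g‖)
    (summable_norm_coeff f) (summable_norm_coeff g) hfg
  rw [norm_def f, norm_def g, key]
  refine (summable_norm_coeff (f * g)).tsum_le_tsum (fun i => ?_)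
    (summable_sum_mul_antidiagonal_of_summable_mul (f := fun i => ‖coeff i f‖)
      (g := fun i => ‖coeff i g‖) hfg)
  rw [coeff_mul]
  exact (norm_sum_le _ _).trans (Finset.sum_le_sum fun _ _ => norm_mul_le _ _)

noncomputable instance : NormedCommRing (Wiener σ R) :=
  { (inferInstance : NormedAddCommGroup (Wiener σ R)),
    (inferInstance : CommRing (Wiener σ R)) with
    norm_mul_le := by classical exact norm_mul_le_norm_mul_norm }

noncomputable instance : NormedAlgebra ℝ (Wiener σ R) :=
  { (inferInstance : Algebra ℝ (Wiener σ R)) with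
    norm_smul_le := fun r f => by
      simp only [norm_def, map_smul, norm_smul, tsum_mul_left, le_refl] }

instance [NormOneClass R] : NormOneClass (Wiener σ R) where
  norm_one := by
    classical
    rw [norm_def, tsum_eq_single 0 fun i hi => by rw [coeff_one, if_neg hi, norm_zero], coeff_one,
      if_pos rfl, norm_one]

/-- The coefficients identify the algebra isometrically with `ℓ¹`. Completeness is needed for the
contraction principle and for summing power series in the algebra. -/
instance [CompleteSpace R] : CompleteSpace (Wiener σ R) := by
  let e : Wiener σ R ≃ lp (fun _ : σ →₀ ℕ => R) 1 :=
    { toFun := fun f => ⟨fun i => coeff i f, by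
        have := summable_norm_coeff f
        exact memℓp_gen (by simpa using this)⟩
      invFun := fun c => mk (fun i => c i) (by
        have := (lp.memℓp c).summable (by norm_num)
        simpa using this)
      left_inv := fun f => rfl
      right_inv := fun c => rfl }
  have he : Isometry e := Isometry.of_dist_eq fun f g => by
    rw [dist_eq_norm, dist_eq_norm, lp.norm_eq_tsum_rpow (by norm_num), norm_def]
    simp only [ENNReal.toReal_one, Real.rpow_one, div_one]
    exact tsum_congr fun i => by rw [map_sub]; rfl
  exact (IsometryEquiv.mk e he).completeSpace

/-! #### Evaluation -/

/-- The monomial `∏ x_l ^ i_l`. -/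
noncomputable def monom [Fintype σ] (x : σ → ℂ) (i : σ →₀ ℕ) : ℂ := ∏ l, x l ^ i l

section Monom

variable [Fintype σ]

theorem monom_zero (x : σ → ℂ) : monom x 0 = 1 := by simp [monom]

theorem monom_add (x : σ → ℂ) (i j : σ →₀ ℕ) : monom x (i + j) = monom x i * monom x j := by
  simp [monom, pow_add, Finset.prod_mul_distrib]

theorem norm_monom_le_one {x : σ → ℂ} (hx : ∀ l, ‖x l‖ ≤ 1) (i : σ →₀ ℕ) : ‖monom x i‖ ≤ 1 := by
  rw [monom, norm_prod]
  exact Finset.prod_le_one (fun _ _ => norm_nonneg _)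
    fun l _ => by rw [norm_pow]; exact pow_le_one₀ (norm_nonneg _) (hx l)

theorem norm_monom_le_pow {x : σ → ℂ} {q : ℝ} (hx : ∀ l, ‖x l‖ ≤ q) (i : σ →₀ ℕ) :
    ‖monom x i‖ ≤ q ^ (∑ l, i l) := by
  rw [monom, norm_prod, ← Finset.prod_pow_eq_pow_sum]
  exact Finset.prod_le_prod (fun _ _ => norm_nonneg _)
    fun l _ => by rw [norm_pow]; exact pow_le_pow_left₀ (norm_nonneg _) (hx l) _

theorem summable_eval (ψ : R →ₐ[ℝ] ℂ) (hψ : ∀ a, ‖ψ a‖ ≤ ‖a‖) {x : σ → ℂ} (hx : ∀ l, ‖x l‖ ≤ 1)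
    (f : Wiener σ R) : Summable fun i => ‖ψ (coeff i f) * monom x i‖ := by
  refine (summable_norm_coeff f).of_nonneg_of_le (fun _ => norm_nonneg _) fun i => ?_
  rw [norm_mul]
  exact (mul_le_of_le_one_right (norm_nonneg _) (norm_monom_le_one hx i)).trans (hψ _)

/-- Evaluation of an absolutely summable power series in the closed polydisc. -/
noncomputable def eval (ψ : R →ₐ[ℝ] ℂ) (hψ : ∀ a, ‖ψ a‖ ≤ ‖a‖) (x : σ → ℂ)
    (hx : ∀ l, ‖x l‖ ≤ 1) : Wiener σ R →ₐ[ℝ] ℂ where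
  toFun f := ∑' i, ψ (coeff i f) * monom x i
  map_one' := by
    classical
    rw [tsum_eq_single 0 fun i hi => by rw [coeff_one, if_neg hi, map_zero, zero_mul], coeff_one,
      if_pos rfl, map_one, monom_zero, one_mul]
  map_mul' f g := by
    classical
    have hf := summable_eval ψ hψ hx f
    have hg := summable_eval ψ hψ hx g
    have key := tsum_mul_tsum (a := fun i => ψ (coeff i f) * monom x i)
      (b := fun i => ψ (coeff i g) * monom x i) hf.of_norm hg.of_norm
      (summable_mul_of_summable_norm (f := fun i => ψ (coeff i f) * monom x i)
        (g := fun i => ψ (coeff i g) * monom x i) hf hg)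
    rw [key]
    refine tsum_congr fun i => ?_
    rw [coeff_mul, map_sum, Finset.sum_mul]
    refine Finset.sum_congr rfl fun p hp => ?_
    rw [← Finset.HasAntidiagonal.mem_antidiagonal.1 hp, monom_add, map_mul]
    ring
  map_zero' := by simp
  map_add' f g := by
    rw [← (summable_eval ψ hψ hx f).of_norm.tsum_add (summable_eval ψ hψ hx g).of_norm]
    simp [add_mul]
  commutes' r := by
    classical
    have h (i : σ →₀ ℕ) : coeff i (algebraMap ℝ (Wiener σ R) r) = if i = 0 then algebraMap ℝ R r
        else 0 := by
      rw [Algebra.algebraMap_eq_smul_one, map_smul, coeff_one, Algebra.algebraMap_eq_smul_one]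
      split_ifs <;> simp
    rw [tsum_eq_single 0 fun i hi => by rw [h, if_neg hi, map_zero, zero_mul], h,
      if_pos rfl, monom_zero, mul_one]
    exact ψ.commutes r

theorem eval_apply (ψ : R →ₐ[ℝ] ℂ) (hψ : ∀ a, ‖ψ a‖ ≤ ‖a‖) (x : σ → ℂ)
    (hx : ∀ l, ‖x l‖ ≤ 1) (f : Wiener σ R) :
    eval ψ hψ x hx f = ∑' i, ψ (coeff i f) * monom x i := rfl

theorem norm_eval_le (ψ : R →ₐ[ℝ] ℂ) (hψ : ∀ a, ‖ψ a‖ ≤ ‖a‖) (x : σ → ℂ)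
    (hx : ∀ l, ‖x l‖ ≤ 1) (f : Wiener σ R) : ‖eval ψ hψ x hx f‖ ≤ ‖f‖ := by
  refine tsum_of_norm_bounded (hasSum_norm f) fun i => ?_
  rw [norm_mul]
  exact (mul_le_of_le_one_right (norm_nonneg _) (norm_monom_le_one hx i)).trans (hψ _)

end Monom

/-! #### Operators acting on the coefficients -/

/-- The operator acting on the `i`-th coefficient by `L i`. -/
noncomputable def diag (L : (σ →₀ ℕ) → R →L[ℝ] R) (C : ℝ) (hL : ∀ i, ‖L i‖ ≤ C) :
    Wiener σ R →L[ℝ] Wiener σ R :=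
  LinearMap.mkContinuous
    { toFun := fun f => mk (fun i => L i (coeff i f)) <| by
        refine ((summable_norm_coeff f).mul_left C).of_nonneg_of_le (fun _ => norm_nonneg _)
          fun i => ?_
        exact (L i).le_of_opNorm_le (hL i) _
      map_add' := fun f g => ext fun i => by simp
      map_smul' := fun r f => ext fun i => by simp } C <| fun f => by
    rw [norm_def, norm_def, ← tsum_mul_left]
    refine (summable_norm_coeff _).tsum_le_tsum (fun i => ?_) ((summable_norm_coeff f).mul_left C)
    exact (L i).le_of_opNorm_le (hL i) _

@[simp] theorem coeff_diag (L : (σ →₀ ℕ) → R →L[ℝ] R) (C : ℝ) (hL : ∀ i, ‖L i‖ ≤ C)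
    (f : Wiener σ R) (i : σ →₀ ℕ) : coeff i (diag L C hL f) = L i (coeff i f) := rfl

theorem norm_diag_apply_le (L : (σ →₀ ℕ) → R →L[ℝ] R) (C : ℝ) (hL : ∀ i, ‖L i‖ ≤ C)
    (f : Wiener σ R) : ‖diag L C hL f‖ ≤ C * ‖f‖ := by
  rw [norm_def, norm_def, ← tsum_mul_left]
  refine (summable_norm_coeff _).tsum_le_tsum (fun i => ?_) ((summable_norm_coeff f).mul_left C)
  exact (L i).le_of_opNorm_le (hL i) _

/-- Removal of the monomials that are not divisible by `X^j`, and division of the others by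
`X^j`. -/
noncomputable def shift (j : σ →₀ ℕ) : Wiener σ R →L[ℝ] Wiener σ R :=
  LinearMap.mkContinuous
    { toFun := fun f => mk (fun i => coeff (i + j) f)
        ((summable_norm_coeff f).comp_injective (add_left_injective j))
      map_add' := fun f g => ext fun i => by simp
      map_smul' := fun r f => ext fun i => by simp } 1 <| fun f => by
    rw [one_mul]
    exact tsum_comp_le_tsum_of_inj (summable_norm_coeff f) (fun _ => norm_nonneg _)
      (add_left_injective j)

@[simp] theorem coeff_shift (j : σ →₀ ℕ) (f : Wiener σ R) (i : σ →₀ ℕ) :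
    coeff i (shift j f) = coeff (i + j) f := rfl

theorem norm_shift_le (j : σ →₀ ℕ) (f : Wiener σ R) : ‖shift j f‖ ≤ ‖f‖ :=
  tsum_comp_le_tsum_of_inj (summable_norm_coeff f) (fun _ => norm_nonneg _)
    (add_left_injective j)

/-- The monomial `c X^j`. -/
noncomputable def single (j : σ →₀ ℕ) (c : R) : Wiener σ R :=
  ⟨MvPowerSeries.monomial j c, by
    classical
    refine summable_of_ne_finset_zero (s := {j}) fun i hi => ?_
    rw [MvPowerSeries.coeff_monomial, if_neg (by simpa using hi), norm_zero]⟩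

theorem coeff_single [DecidableEq σ] (j : σ →₀ ℕ) (c : R) (i : σ →₀ ℕ) :
    coeff i (single j c) = if i = j then c else 0 := MvPowerSeries.coeff_monomial ..

theorem norm_single (j : σ →₀ ℕ) (c : R) : ‖single j c‖ = ‖c‖ := by
  classical
  rw [norm_def, tsum_eq_single j fun i hi => by rw [coeff_single, if_neg hi, norm_zero],
    coeff_single, if_pos rfl]

theorem eval_single [Fintype σ] (ψ : R →ₐ[ℝ] ℂ) (hψ : ∀ a, ‖ψ a‖ ≤ ‖a‖) (x : σ → ℂ)
    (hx : ∀ l, ‖x l‖ ≤ 1) (j : σ →₀ ℕ) (c : R) :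
    eval ψ hψ x hx (single j c) = ψ c * monom x j := by
  classical
  rw [eval_apply, tsum_eq_single j fun i hi => by rw [coeff_single, if_neg hi, map_zero, zero_mul],
    coeff_single, if_pos rfl]

/-- Permutation of the variables, together with an automorphism of the coefficients. -/
noncomputable def twist (e : σ ≃ σ) (c : R →ₐ[ℝ] R) (hc : ∀ a, ‖c a‖ = ‖a‖) :
    Wiener σ R →ₐ[ℝ] Wiener σ R where
  toFun f := mk (fun i => c (coeff (Finsupp.domCongr e i) f)) <| by
    simp only [hc]
    exact (summable_norm_coeff f).comp_injective (Finsupp.domCongr e).injective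
  map_one' := ext fun i => by
    classical
    rw [coeff_mk, coeff_one, coeff_one]
    simp only [EmbeddingLike.map_eq_zero_iff]
    split_ifs <;> simp
  map_mul' f g := ext fun i => by
    classical
    rw [coeff_mk, coeff_mul, coeff_mul, map_sum]
    refine (Finset.sum_nbij' (fun p => (Finsupp.domCongr e p.1, Finsupp.domCongr e p.2))
      (fun p => ((Finsupp.domCongr e).symm p.1, (Finsupp.domCongr e).symm p.2))
      ?_ ?_ ?_ ?_ ?_).symm
    · intro p hp
      rw [Finset.HasAntidiagonal.mem_antidiagonal] at hp ⊢
      rw [← map_add, hp]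
    · intro p hp
      rw [Finset.HasAntidiagonal.mem_antidiagonal] at hp ⊢
      rw [← map_add, hp, AddEquiv.symm_apply_apply]
    · exact fun p _ => Prod.ext ((Finsupp.domCongr e).symm_apply_apply _)
        ((Finsupp.domCongr e).symm_apply_apply _)
    · exact fun p _ => Prod.ext ((Finsupp.domCongr e).apply_symm_apply _)
        ((Finsupp.domCongr e).apply_symm_apply _)
    · intro p _; simp
  map_zero' := ext fun i => by simp
  map_add' f g := ext fun i => by simp
  commutes' r := ext fun i => by
    classical
    rw [Algebra.algebraMap_eq_smul_one, coeff_mk, map_smul, map_smul, map_smul, coeff_one,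
      coeff_one]
    simp only [EmbeddingLike.map_eq_zero_iff]
    split_ifs <;> simp

@[simp] theorem coeff_twist (e : σ ≃ σ) (c : R →ₐ[ℝ] R) (hc : ∀ a, ‖c a‖ = ‖a‖) (f : Wiener σ R)
    (i : σ →₀ ℕ) : coeff i (twist e c hc f) = c (coeff (Finsupp.domCongr e i) f) := rfl

theorem norm_twist (e : σ ≃ σ) (c : R →ₐ[ℝ] R) (hc : ∀ a, ‖c a‖ = ‖a‖) (f : Wiener σ R) :
    ‖twist e c hc f‖ = ‖f‖ := by
  rw [norm_def, norm_def]
  simp only [coeff_twist, hc]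
  exact (Finsupp.domCongr e).toEquiv.tsum_eq fun i => ‖coeff i f‖

/-- The monomials on which an additive weight vanishes. -/
noncomputable def truncate (w : (σ →₀ ℕ) →+ ℕ) : Wiener σ R →ₐ[ℝ] Wiener σ R where
  toFun f := mk (fun i => if w i = 0 then coeff i f else 0) <|
    (summable_norm_coeff f).of_nonneg_of_le (fun _ => norm_nonneg _) fun i => by
      split_ifs <;> simp
  map_one' := ext fun i => by
    classical
    rw [coeff_mk, coeff_one]
    split_ifs <;> simp_all
  map_mul' f g := ext fun i => by
    classical
    rw [coeff_mk, coeff_mul, coeff_mul]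
    -- The weight is additive with values in `ℕ`: a product of weight zero has both factors of
    -- weight zero, and in a product of positive weight some factor is killed. Hence the truncation
    -- is multiplicative.
    split_ifs with h
    · refine Finset.sum_congr rfl fun p hp => ?_
      have h' := congrArg w (Finset.HasAntidiagonal.mem_antidiagonal.1 hp)
      rw [map_add, h] at h'
      rw [coeff_mk, coeff_mk, if_pos (by omega), if_pos (by omega)]
    · refine (Finset.sum_eq_zero fun p hp => ?_).symm
      have h' := congrArg w (Finset.HasAntidiagonal.mem_antidiagonal.1 hp)
      rw [map_add] at h'
      rw [coeff_mk, coeff_mk]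
      by_cases h1 : w p.1 = 0
      · rw [if_neg (c := w p.2 = 0) (by omega), mul_zero]
      · rw [if_neg h1, zero_mul]
  map_zero' := ext fun i => by simp
  map_add' f g := ext fun i => by
    simp only [map_add, coeff_mk]
    split_ifs <;> simp
  commutes' r := ext fun i => by
    classical
    rw [Algebra.algebraMap_eq_smul_one, coeff_mk, map_smul, coeff_one]
    split_ifs <;> simp_all

@[simp] theorem coeff_truncate (w : (σ →₀ ℕ) →+ ℕ) (f : Wiener σ R) (i : σ →₀ ℕ) :
    coeff i (truncate w f) = if w i = 0 then coeff i f else 0 := rfl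

theorem norm_truncate_le (w : (σ →₀ ℕ) →+ ℕ) (f : Wiener σ R) : ‖truncate w f‖ ≤ ‖f‖ := by
  refine (summable_norm_coeff _).tsum_le_tsum (fun i => ?_) (summable_norm_coeff f)
  rw [coeff_truncate]
  split_ifs <;> simp

/-- The kernel is an ideal, so the absence of monomials of weight zero can be proved by applying an
algebra morphism to a formula. -/
theorem truncate_eq_zero {w : (σ →₀ ℕ) →+ ℕ} {f : Wiener σ R} :
    truncate w f = 0 ↔ ∀ i, w i = 0 → coeff i f = 0 := by
  refine ⟨fun h i hi => ?_, fun h => ext fun i => ?_⟩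
  · rw [← map_zero (coeff i), ← h, coeff_truncate, if_pos hi]
  · rw [coeff_truncate, map_zero]
    split_ifs with hi
    · exact h i hi
    · rfl

end Wiener

end Wiener

/-! ### Analytic functional calculus in commutative Banach algebras -/

section FunctionalCalculus

open scoped NNReal ENNReal

variable {ι : Type*} [Fintype ι] [DecidableEq ι] (p : FormalMultilinearSeries ℝ (ι → ℝ) ℝ)
variable (B B' : Type*) [NormedCommRing B] [NormedAlgebra ℝ B] [NormedCommRing B']
  [NormedAlgebra ℝ B']

/-- The power series with the same coefficients, in variables taken in a commutative algebra. -/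
noncomputable def extendSeries : FormalMultilinearSeries ℝ (ι → B) B := fun n =>
  ∑ j : Fin n → ι, p n (fun k => Pi.single (j k) 1) •
    (ContinuousMultilinearMap.mkPiAlgebra ℝ (Fin n) B).compContinuousLinearMap
      (fun k => ContinuousLinearMap.proj (R := ℝ) (φ := fun _ : ι => B) (j k))

theorem extendSeries_apply (n : ℕ) (v : Fin n → ι → B) :
    extendSeries p B n v =
      ∑ j : Fin n → ι, p n (fun k => Pi.single (j k) 1) • ∏ k, v k (j k) := by
  simp [extendSeries]

variable [NormOneClass B] [NormOneClass B']

/-- There are `card ^ n` terms in the expansion along the standard basis, each of norm at most `‖p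
n‖`. This loss only shrinks the radius of convergence by a constant factor. -/
theorem norm_extendSeries_le (n : ℕ) :
    ‖extendSeries p B n‖ ≤ (Fintype.card ι : ℝ) ^ n * ‖p n‖ := by
  refine ContinuousMultilinearMap.opNorm_le_bound (by positivity) fun v => ?_
  rw [extendSeries_apply]
  calc ‖∑ j : Fin n → ι, p n (fun k => Pi.single (j k) 1) • ∏ k, v k (j k)‖
      ≤ ∑ _j : Fin n → ι, ‖p n‖ * ∏ k, ‖v k‖ := by
        refine norm_sum_le_of_le _ fun j _ => ?_
        rw [norm_smul]
        gcongr
        · refine (ContinuousMultilinearMap.le_opNorm _ _).trans ?_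
          refine mul_le_of_le_one_right (norm_nonneg _) (Finset.prod_le_one
            (fun _ _ => norm_nonneg _) fun k _ => ?_)
          refine (pi_norm_le_iff_of_nonneg zero_le_one).2 fun l => ?_
          rw [Pi.single_apply]
          split_ifs <;> simp
        · refine (Finset.norm_prod_le _ _).trans
            (Finset.prod_le_prod (fun _ _ => norm_nonneg _) fun k _ => norm_le_pi_norm _ _)
    _ = _ := by
        rw [Finset.sum_const, Finset.card_univ, Fintype.card_fun, Fintype.card_fin, nsmul_eq_mul]
        push_cast
        ring

/-- Adding one to the number of variables keeps the denominator positive when there are none. -/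
theorem le_radius_extendSeries {a : ℝ≥0} (ha : (a : ℝ≥0∞) < p.radius) :
    ((a / (Fintype.card ι + 1) : ℝ≥0) : ℝ≥0∞) ≤ (extendSeries p B).radius := by
  obtain ⟨C, hC, h⟩ := p.norm_mul_pow_le_of_lt_radius ha
  refine FormalMultilinearSeries.le_radius_of_bound _ C fun n => (le_trans ?_ (h n))
  refine (mul_le_mul_of_nonneg_right (norm_extendSeries_le p B n) (by positivity)).trans ?_
  rw [mul_comm (_ ^ n) ‖p n‖, mul_assoc, ← mul_pow]
  gcongr
  push_cast
  rw [mul_div_assoc', div_le_iff₀ (by positivity)]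
  nlinarith [a.coe_nonneg]

/-- The value at a tuple of elements of a commutative Banach algebra of the analytic function
with power series `p`. -/
noncomputable def calculus (y : ι → B) : B := (extendSeries p B).sum y

variable {B B'}

theorem hasSum_calculus [CompleteSpace B] {a : ℝ≥0} (ha : (a : ℝ≥0∞) < p.radius) {y : ι → B}
    (hy : ‖y‖ < a / (Fintype.card ι + 1)) :
    HasSum (fun n => extendSeries p B n fun _ => y) (calculus p B y) := by
  refine (extendSeries p B).hasSum (Metric.mem_eball.2 ?_)
  refine lt_of_lt_of_le ?_ (le_radius_extendSeries p B ha)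
  rw [edist_zero_right, enorm_eq_nnnorm, ENNReal.coe_lt_coe, ← NNReal.coe_lt_coe]
  simpa using hy

/-- Each homogeneous term is a polynomial with real coefficients, and a contractive morphism is
continuous, so it passes through the sum. This single fact serves for evaluation, conjugation and
truncation. -/
theorem map_calculus [CompleteSpace B] [CompleteSpace B'] (φ : B →ₐ[ℝ] B')
    (hφ : ∀ b, ‖φ b‖ ≤ ‖b‖) {a : ℝ≥0} (ha : (a : ℝ≥0∞) < p.radius) {y : ι → B}
    (hy : ‖y‖ < a / (Fintype.card ι + 1)) :
    φ (calculus p B y) = calculus p B' fun l => φ (y l) := by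
  have hy' : ‖fun l => φ (y l)‖ ≤ ‖y‖ :=
    (pi_norm_le_iff_of_nonneg (norm_nonneg _)).2 fun l => (hφ _).trans (norm_le_pi_norm y l)
  have hcont : Continuous φ := AddMonoidHomClass.continuous_of_bound φ 1 (by simpa using hφ)
  have h := (hasSum_calculus p ha hy).map φ hcont
  refine h.unique ?_
  convert hasSum_calculus p ha (hy'.trans_lt hy) using 2 with n
  simp [extendSeries_apply, map_sum, map_prod]

/-- Over `ℝ`, multilinear expansion in the standard basis gives back `p n`, so nothing has been
changed on real arguments. -/
theorem calculus_real {f : (ι → ℝ) → ℝ} {r : ℝ≥0∞} (hf : HasFPowerSeriesOnBall f p 0 r)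
    {a : ℝ≥0} (ha : (a : ℝ≥0∞) < r) {y : ι → ℝ} (hy : ‖y‖ < a / (Fintype.card ι + 1)) :
    calculus p ℝ y = f y := by
  have hya : ‖y‖ < a := hy.trans_le (div_le_self a.coe_nonneg (by
    linarith [(Nat.cast_nonneg (Fintype.card ι) : (0 : ℝ) ≤ _)]))
  have h1 := hasSum_calculus p (ha.trans_le hf.r_le) hy
  have h2 := hf.hasSum (y := y) (Metric.mem_eball.2 (lt_trans (by
    rw [edist_zero_right, enorm_eq_nnnorm, ENNReal.coe_lt_coe, ← NNReal.coe_lt_coe]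
    simpa using hya) ha))
  rw [zero_add] at h2
  have hy : y = ∑ l, y l • (Pi.single l 1 : ι → ℝ) := by
    ext l
    simp [Finset.sum_apply, Pi.single_apply]
  have h (n : ℕ) : (extendSeries p ℝ n fun _ => y) = p n fun _ => y := by
    rw [extendSeries_apply]
    conv_rhs => rw [hy, ContinuousMultilinearMap.map_sum]
    refine Finset.sum_congr rfl fun j _ => ?_
    rw [ContinuousMultilinearMap.map_smul_univ, smul_eq_mul, smul_eq_mul, mul_comm]
  simp only [h] at h1
  exact h1.unique h2

/-- A convergent power series is of class `C¹` at the origin, hence Lipschitz nearby. The constants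
may depend on the algebra, which is harmless since only `Alg d` is used. -/
theorem exists_lipschitz_calculus [CompleteSpace B] (hp : 0 < p.radius) :
    ∃ r > 0, ∃ K > 0, ∀ y y' : ι → B, ‖y‖ ≤ r → ‖y'‖ ≤ r →
      ‖calculus p B y - calculus p B y'‖ ≤ K * ‖y - y'‖ := by
  obtain ⟨a, ha0, ha⟩ := ENNReal.lt_iff_exists_nnreal_btwn.1 hp
  have hrad : 0 < (extendSeries p B).radius := by
    refine lt_of_lt_of_le ?_ (le_radius_extendSeries p B ha)
    rw [ENNReal.coe_pos] at ha0 ⊢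
    positivity
  have hcd : ContDiffAt ℝ 1 (calculus p B) 0 :=
    ((extendSeries p B).hasFPowerSeriesOnBall hrad).analyticAt.contDiffAt
  obtain ⟨K, t, ht, hK⟩ := hcd.exists_lipschitzOnWith
  obtain ⟨r, hr, hrt⟩ := Metric.nhds_basis_closedBall.mem_iff.1 ht
  refine ⟨r, hr, K + 1, by positivity, fun y y' hy hy' => ?_⟩
  have := hK.dist_le_mul y (hrt (by simpa using hy)) y' (hrt (by simpa using hy'))
  rw [dist_eq_norm, dist_eq_norm] at this
  nlinarith [norm_nonneg (y - y')]

end FunctionalCalculus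

/-! ### Exponentials of matrices -/

section Exponential

open NormedSpace

variable {W : Type*} [NormedAddCommGroup W] [NormedSpace ℂ W] [FiniteDimensional ℂ W]

theorem exp_apply_of_pow_apply_eq_zero (T : W →L[ℂ] W) {v : W} {k : ℕ} (hk : (T ^ k) v = 0) :
    exp T v = ∑ j ∈ Finset.range k, ((j.factorial : ℂ)⁻¹) • (T ^ j) v := by
  have : CompleteSpace W := FiniteDimensional.complete ℂ W
  have h1 := (exp_series_hasSum_exp' (𝕂 := ℂ) T).mapL (ContinuousLinearMap.apply ℂ W v)
  refine h1.unique (hasSum_sum_of_ne_finset_zero fun j hj => ?_)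
  have hj' : k ≤ j := by simpa using hj
  obtain ⟨l, rfl⟩ := Nat.exists_eq_add_of_le' hj'
  simp [pow_add, hk]

theorem exp_smul_one_add (a : ℂ) (B : W →L[ℂ] W) :
    exp (a • (1 : W →L[ℂ] W) + B) = Complex.exp a • exp B := by
  have : CompleteSpace W := FiniteDimensional.complete ℂ W
  let _ : NormedAlgebra ℚ (W →L[ℂ] W) := NormedAlgebra.restrictScalars ℚ ℂ _
  have h : exp (a • (1 : W →L[ℂ] W)) = Complex.exp a • (1 : W →L[ℂ] W) := by
    rw [← Algebra.algebraMap_eq_smul_one, ← Algebra.algebraMap_eq_smul_one,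
      Complex.exp_eq_exp_ℂ, algebraMap_exp_comm]
  rw [exp_add_of_commute ((Commute.one_left B).smul_left a), h, smul_mul_assoc, one_mul]

theorem norm_exp_smul_one_add (a : ℝ) (B : W →L[ℂ] W) :
    ‖exp ((a : ℂ) • (1 : W →L[ℂ] W) + B)‖ = Real.exp a * ‖exp B‖ := by
  rw [exp_smul_one_add, norm_smul, ← Complex.ofReal_exp, Complex.norm_real,
    Real.norm_of_nonneg (Real.exp_pos _).le]

theorem norm_exp_apply_le_of_mem_genEigenspace (T : W →L[ℂ] W) {μ : ℂ} {c : ℝ} (hμ : μ.re < c)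
    {v : W} {k : ℕ} (hk : ((T - μ • (1 : W →L[ℂ] W)) ^ k) v = 0) :
    ∃ C : ℝ, ∀ s : ℝ, 0 ≤ s → ‖exp (s • T) v‖ ≤ C * Real.exp (c * s) := by
  have : CompleteSpace W := FiniteDimensional.complete ℂ W
  set S := T - μ • (1 : W →L[ℂ] W) with hS
  set δ := c - μ.re with hδ
  have hδ0 : 0 < δ := sub_pos.2 hμ
  refine ⟨∑ j ∈ Finset.range k, (δ ^ j)⁻¹ * ‖(S ^ j) v‖, fun s hs => ?_⟩
  have hsplit : s • T = ((s : ℂ) * μ) • (1 : W →L[ℂ] W) + (s : ℂ) • S := by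
    rw [hS, smul_sub, smul_smul, add_sub_cancel]
    rfl
  have hexp : exp (s • T) v = Complex.exp (s * μ) • exp ((s : ℂ) • S) v := by
    rw [hsplit, exp_smul_one_add]
    rfl
  have hk' : (((s : ℂ) • S) ^ k) v = 0 := by
    rw [smul_pow, _root_.smul_apply, hk, smul_zero]
  have hre : ((s : ℂ) * μ).re = s * μ.re := by simp
  rw [hexp, norm_smul, Complex.norm_exp, hre, exp_apply_of_pow_apply_eq_zero _ hk', Finset.sum_mul]
  refine (mul_le_mul_of_nonneg_left (norm_sum_le _ _) (Real.exp_pos _).le).trans ?_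
  rw [Finset.mul_sum]
  refine Finset.sum_le_sum fun j _ => ?_
  have h1 := Real.pow_div_factorial_le_exp (δ * s) (by positivity) j
  have h2 : Real.exp (c * s) = Real.exp (s * μ.re) * Real.exp (δ * s) := by
    rw [← Real.exp_add]
    congr 1
    rw [hδ]
    ring
  have h3 : ‖((j.factorial : ℂ)⁻¹) • (((s : ℂ) • S) ^ j) v‖
      = (δ ^ j)⁻¹ * ((δ * s) ^ j / j.factorial) * ‖(S ^ j) v‖ := by
    rw [smul_pow, _root_.smul_apply, norm_smul, norm_smul, norm_inv, norm_pow, Complex.norm_natCast,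
      Complex.norm_real, Real.norm_of_nonneg hs, mul_pow]
    field_simp
  rw [h3, h2]
  calc Real.exp (s * μ.re) * ((δ ^ j)⁻¹ * ((δ * s) ^ j / j.factorial) * ‖(S ^ j) v‖)
      = (δ ^ j)⁻¹ * ‖(S ^ j) v‖ * (Real.exp (s * μ.re) * ((δ * s) ^ j / j.factorial)) := by ring
    _ ≤ _ := by gcongr

/-- The vectors whose orbits obey such a bound form a subspace. It contains all generalised
eigenspaces, which span over `ℂ`; a finite basis then makes the bound uniform. -/
theorem exists_norm_exp_smul_le (T : W →L[ℂ] W) {c : ℝ}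
    (hc : ∀ μ : ℂ, Module.End.HasEigenvalue (T : W →ₗ[ℂ] W) μ → μ.re < c) :
    ∃ C : ℝ, 0 < C ∧ ∀ s : ℝ, 0 ≤ s → ‖exp (s • T)‖ ≤ C * Real.exp (c * s) := by
  let P : Submodule ℂ W :=
    { carrier := {v | ∃ C : ℝ, ∀ s : ℝ, 0 ≤ s → ‖exp (s • T) v‖ ≤ C * Real.exp (c * s)}
      add_mem' := by
        rintro u v ⟨C, hC⟩ ⟨C', hC'⟩
        refine ⟨C + C', fun s hs => ?_⟩
        rw [map_add, add_mul]
        exact norm_add_le_of_le (hC s hs) (hC' s hs)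
      zero_mem' := ⟨0, fun s _ => by simp⟩
      smul_mem' := by
        rintro a v ⟨C, hC⟩
        refine ⟨‖a‖ * C, fun s hs => ?_⟩
        rw [map_smul, norm_smul, mul_assoc]
        exact mul_le_mul_of_nonneg_left (hC s hs) (norm_nonneg _) }
  have hP : P = ⊤ := by
    rw [eq_top_iff, ← Module.End.iSup_maxGenEigenspace_eq_top (T : W →ₗ[ℂ] W)]
    refine iSup_le fun μ v hv => ?_
    by_cases hv0 : v = 0
    · rw [hv0]; exact P.zero_mem
    obtain ⟨k, hk⟩ := (Module.End.mem_maxGenEigenspace _ _ _).1 hv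
    have hμ : Module.End.HasEigenvalue (T : W →ₗ[ℂ] W) μ := by
      refine Module.End.hasEigenvalue_of_hasGenEigenvalue (k := k) ?_
      refine (Submodule.ne_bot_iff _).2 ⟨v, (Module.End.mem_genEigenspace_nat).2 hk, hv0⟩
    refine norm_exp_apply_le_of_mem_genEigenspace T (hc μ hμ) (k := k) ?_
    have : ((T - μ • (1 : W →L[ℂ] W)) ^ k : W →L[ℂ] W) v
        = (((T : W →ₗ[ℂ] W) - μ • (1 : Module.End ℂ W)) ^ k) v := by
      rw [Module.End.pow_apply, FunLike.coe_pow_eq_iterate]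
      rfl
    rw [this, hk]
  let b := Module.finBasis ℂ W
  have hb : ∀ i, ∃ C : ℝ, ∀ s : ℝ, 0 ≤ s → ‖exp (s • T) (b i)‖ ≤ C * Real.exp (c * s) :=
    fun i => (hP ▸ Submodule.mem_top : b i ∈ P)
  choose C hC using hb
  obtain ⟨K, hK0, hK⟩ := b.exists_opNorm_le (F := W)
  have hC0 (i) : 0 ≤ C i := by simpa using (norm_nonneg _).trans (hC i 0 le_rfl)
  refine ⟨K * ∑ i, C i + 1, by have := Finset.sum_nonneg fun i (_ : i ∈ Finset.univ) => hC0 i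
                               positivity, fun s hs => ?_⟩
  have h := hK (u := exp (s • T)) (M := (∑ i, C i) * Real.exp (c * s))
    (mul_nonneg (Finset.sum_nonneg fun i _ => hC0 i) (Real.exp_pos _).le) fun i =>
      (hC i s hs).trans (mul_le_mul_of_nonneg_right
        (Finset.single_le_sum (fun i _ => hC0 i) (Finset.mem_univ i)) (Real.exp_pos _).le)
  nlinarith [Real.exp_pos (c * s)]

end Exponential

/-! ### Duhamel's formula -/

section Duhamel

open NormedSpace

/-- The continuous complex valued functions of time, on the unit interval. -/
abbrev TimeFun : Type := C(unitInterval, ℂ)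

/-- The extension of a function on the unit interval by its values at the end points. -/
noncomputable def TimeFun.extend (f : TimeFun) : ℝ → ℂ :=
  Set.IccExtend (zero_le_one (α := ℝ)) f

theorem TimeFun.continuous_extend (f : TimeFun) : Continuous f.extend := f.continuous.Icc_extend'

theorem TimeFun.extend_of_mem (f : TimeFun) (s : unitInterval) : f.extend s = f s :=
  Set.IccExtend_val _ _ _

theorem TimeFun.norm_extend_le (f : TimeFun) (s : ℝ) : ‖f.extend s‖ ≤ ‖f‖ :=
  f.norm_coe_le_norm _

/-- The convolution in time with a continuous kernel. -/
noncomputable def volterraFun (k : ℝ → ℂ) (f : TimeFun) (s : ℝ) : ℂ :=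
  ∫ σ in (0 : ℝ)..s, k (s - σ) * f.extend σ

theorem continuous_volterraFun {k : ℝ → ℂ} (hk : Continuous k) (f : TimeFun) :
    Continuous (volterraFun k f) := by
  refine intervalIntegral.continuous_parametric_intervalIntegral_of_continuous
    (f := fun s σ => k (s - σ) * f.extend σ) ?_ continuous_id
  have := f.continuous_extend
  simp only [Function.uncurry_def]
  fun_prop

/-- The integral of `exp (-w (s - σ))` over `[0, s]` is at most `1 / w`: damping at rate `w` gains
the factor that will compensate a derivative. -/
theorem norm_volterraFun_le {k : ℝ → ℂ} {C w : ℝ} (hw : 0 < w)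
    (h : ∀ s, 0 ≤ s → s ≤ 1 → ‖k s‖ ≤ C * Real.exp (-w * s)) (f : TimeFun)
    {s : ℝ} (hs : 0 ≤ s) (hs1 : s ≤ 1) : ‖volterraFun k f s‖ ≤ C / w * ‖f‖ := by
  have hC : 0 ≤ C := by simpa using (norm_nonneg _).trans (h 0 le_rfl zero_le_one)
  have hderiv (σ : ℝ) : HasDerivAt (fun σ => C * ‖f‖ / w * Real.exp (-w * (s - σ)))
      (C * Real.exp (-w * (s - σ)) * ‖f‖) σ := by
    have h1 : HasDerivAt (fun σ => -w * (s - σ)) w σ := by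
      simpa using ((hasDerivAt_id σ).const_sub s).const_mul (-w)
    refine ((h1.exp).const_mul (C * ‖f‖ / w)).congr_deriv ?_
    field_simp
  have hint : IntervalIntegrable (fun σ => C * Real.exp (-w * (s - σ)) * ‖f‖) volume 0 s :=
    Continuous.intervalIntegrable (by fun_prop) _ _
  calc ‖volterraFun k f s‖
      ≤ ∫ σ in (0 : ℝ)..s, C * Real.exp (-w * (s - σ)) * ‖f‖ := by
        refine intervalIntegral.norm_integral_le_of_norm_le hs
          (ae_of_all _ fun σ hσ => ?_) hint
        rw [norm_mul]
        exact mul_le_mul (h _ (by linarith [hσ.2]) (by linarith [hσ.1])) (f.norm_extend_le σ)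
          (norm_nonneg _) (mul_nonneg hC (Real.exp_pos _).le)
    _ = C * ‖f‖ / w * Real.exp (-w * (s - s)) - C * ‖f‖ / w * Real.exp (-w * (s - 0)) :=
        intervalIntegral.integral_eq_sub_of_hasDerivAt (fun σ _ => hderiv σ) hint
    _ ≤ C / w * ‖f‖ := by
        have : 0 ≤ C * ‖f‖ / w * Real.exp (-w * (s - 0)) := by positivity
        rw [sub_self, mul_zero, Real.exp_zero, mul_one, mul_div_right_comm]
        rw [mul_div_right_comm] at this
        linarith

/-- The convolution in time with a continuous kernel, as an operator. -/
noncomputable def volterra (k : ℝ → ℂ) (hk : Continuous k) : TimeFun →ₗ[ℝ] TimeFun where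
  toFun f := ⟨fun s => volterraFun k f s, (continuous_volterraFun hk f).comp continuous_subtype_val⟩
  map_add' f g := by
    ext s
    simp only [volterraFun, ContinuousMap.coe_mk, ContinuousMap.add_apply]
    have hf := f.continuous_extend
    have hg := g.continuous_extend
    rw [← intervalIntegral.integral_add (Continuous.intervalIntegrable (by fun_prop) _ _)
      (Continuous.intervalIntegrable (by fun_prop) _ _)]
    refine intervalIntegral.integral_congr fun σ _ => ?_
    exact mul_add _ _ _
  map_smul' r f := by
    ext s
    simp only [volterraFun, ContinuousMap.coe_mk, ContinuousMap.smul_apply, RingHom.id_apply]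
    rw [← intervalIntegral.integral_smul]
    refine intervalIntegral.integral_congr fun σ _ => ?_
    exact mul_smul_comm r (k (_ - σ)) (f.extend σ)

theorem volterra_apply (k : ℝ → ℂ) (hk : Continuous k) (f : TimeFun) (s : unitInterval) :
    volterra k hk f s = volterraFun k f s := rfl

theorem norm_volterra_apply_le {k : ℝ → ℂ} (hk : Continuous k) {C w : ℝ} (hw : 0 < w)
    (h : ∀ s, 0 ≤ s → s ≤ 1 → ‖k s‖ ≤ C * Real.exp (-w * s)) (f : TimeFun) :
    ‖volterra k hk f‖ ≤ C / w * ‖f‖ := by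
  have hC : 0 ≤ C := by simpa using (norm_nonneg _).trans (h 0 le_rfl zero_le_one)
  exact (ContinuousMap.norm_le _ (by positivity)).2 fun s => norm_volterraFun_le hw h f s.2.1 s.2.2

variable {N : ℕ}

/-- The entries of the exponential of a matrix. -/
noncomputable def expEntry (M : (Fin N → ℂ) →L[ℂ] (Fin N → ℂ)) (k l : Fin N) (s : ℝ) : ℂ :=
  exp (s • M) (Pi.single l 1) k

theorem continuous_exp_smul (M : (Fin N → ℂ) →L[ℂ] (Fin N → ℂ)) :
    Continuous fun s : ℝ => exp (s • M) := by
  let _ : NormedAlgebra ℚ ((Fin N → ℂ) →L[ℂ] (Fin N → ℂ)) := NormedAlgebra.restrictScalars ℚ ℂ _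
  exact exp_continuous.comp (by fun_prop)

theorem continuous_expEntry (M : (Fin N → ℂ) →L[ℂ] (Fin N → ℂ)) (k l : Fin N) :
    Continuous (expEntry M k l) := by
  have := continuous_exp_smul M
  unfold expEntry
  fun_prop

theorem norm_expEntry_le (M : (Fin N → ℂ) →L[ℂ] (Fin N → ℂ)) (k l : Fin N) (s : ℝ) :
    ‖expEntry M k l s‖ ≤ ‖exp (s • M)‖ := by
  refine (norm_le_pi_norm _ k).trans ((ContinuousLinearMap.le_opNorm _ _).trans ?_)
  refine mul_le_of_le_one_right (norm_nonneg _)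
    ((pi_norm_le_iff_of_nonneg zero_le_one).2 fun j => ?_)
  rw [Pi.single_apply]
  split_ifs <;> simp

theorem exp_smul_mul_exp_smul (M : (Fin N → ℂ) →L[ℂ] (Fin N → ℂ)) (s t : ℝ) :
    exp (s • M) * exp (t • M) = exp ((s + t) • M) := by
  let _ : NormedAlgebra ℚ ((Fin N → ℂ) →L[ℂ] (Fin N → ℂ)) := NormedAlgebra.restrictScalars ℚ ℂ _
  have h : Commute (s • M) (t • M) := by
    refine ContinuousLinearMap.ext fun v => ?_
    change s • M (t • M v) = t • M (s • M v)
    rw [M.map_smul_of_tower, M.map_smul_of_tower, smul_comm]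
  rw [← exp_add_of_commute h]
  exact congrArg exp (add_smul s t M).symm

/-- Duhamel's formula for a linear system with constant coefficients. -/
theorem hasDerivAt_sum_volterraFun (M : (Fin N → ℂ) →L[ℂ] (Fin N → ℂ)) (f : Fin N → TimeFun)
    (k : Fin N) (s : ℝ) :
    HasDerivAt (fun s => ∑ l, volterraFun (expEntry M k l) (f l) s)
      (M (fun k' => ∑ l, volterraFun (expEntry M k' l) (f l) s) k + (f k).extend s) s := by
  let _ : NormedAlgebra ℚ ((Fin N → ℂ) →L[ℂ] (Fin N → ℂ)) := NormedAlgebra.restrictScalars ℚ ℂ _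
  set F : ℝ → Fin N → ℂ := fun σ l => (f l).extend σ with hF
  have hFc : Continuous F := continuous_pi fun l => (f l).continuous_extend
  have hE := continuous_exp_smul M
  have hEn : Continuous fun σ : ℝ => exp ((-σ) • M) := hE.comp continuous_neg
  -- Splitting the propagator removes `s` from the integrand, so that the product rule and the
  -- fundamental theorem of calculus apply.
  set Y : ℝ → Fin N → ℂ := fun s => exp (s • M) (∫ σ in (0 : ℝ)..s, exp ((-σ) • M) (F σ)) with hY
  have hcont : Continuous fun σ : ℝ => exp ((-σ) • M) (F σ) := by fun_prop
  have hYk (s : ℝ) (k : Fin N) : Y s k = ∑ l, volterraFun (expEntry M k l) (f l) s := by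
    have h1 : Y s k = ∫ σ in (0 : ℝ)..s, (exp (s • M) (exp ((-σ) • M) (F σ))) k := by
      have := (((ContinuousLinearMap.proj (R := ℂ) (φ := fun _ : Fin N => ℂ) k).comp
        (exp (s • M)))).intervalIntegral_comp_comm (hcont.intervalIntegrable 0 s (μ := volume))
      exact this.symm
    rw [h1]
    simp only [volterraFun]
    rw [← intervalIntegral.integral_finsetSum]
    · refine intervalIntegral.integral_congr fun σ _ => ?_
      have h2 : exp (s • M) * exp ((-σ) • M) = exp ((s - σ) • M) := by
        rw [exp_smul_mul_exp_smul, ← sub_eq_add_neg]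
      have h3 : F σ = ∑ l, F σ l • (Pi.single l 1 : Fin N → ℂ) := by
        ext l
        simp [Finset.sum_apply, Pi.single_apply]
      change (exp (s • M) * exp ((-σ) • M)) (F σ) k = _
      rw [h2, h3, map_sum, Finset.sum_apply]
      refine Finset.sum_congr rfl fun l _ => ?_
      rw [map_smul, Pi.smul_apply, smul_eq_mul, mul_comm]
      rfl
    · intro l _
      have := (f l).continuous_extend
      have := continuous_expEntry M k l
      exact Continuous.intervalIntegrable (by fun_prop) _ _
  have hYd : HasDerivAt Y (M (Y s) + F s) s := by
    have h1 : HasDerivAt (fun s : ℝ => exp (s • M)) (M * exp (s • M)) s := by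
      let _ : NormedAlgebra ℝ ((Fin N → ℂ) →L[ℂ] (Fin N → ℂ)) :=
        NormedAlgebra.restrictScalars ℝ ℂ _
      exact hasDerivAt_exp_smul_const' (𝕂 := ℝ) M s
    have h2 : HasDerivAt (fun s : ℝ => ∫ σ in (0 : ℝ)..s, exp ((-σ) • M) (F σ))
        (exp ((-s) • M) (F s)) s :=
      intervalIntegral.integral_hasDerivAt_right (hcont.intervalIntegrable _ _)
        hcont.stronglyMeasurable.stronglyMeasurableAtFilter hcont.continuousAt
    have h3 : exp (s • M) (exp ((-s) • M) (F s)) = F s := by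
      have : exp (s • M) * exp ((-s) • M) = 1 := by
        rw [exp_smul_mul_exp_smul, add_neg_cancel]
        exact (congrArg exp (zero_smul ℝ M)).trans exp_zero
      exact congrArg (fun T : (Fin N → ℂ) →L[ℂ] (Fin N → ℂ) => T (F s)) this
    have h4 := (((ContinuousLinearMap.restrictScalarsL ℂ (Fin N → ℂ) (Fin N → ℂ) ℝ ℝ).hasFDerivAt
      ).comp_hasDerivAt s h1).clm_apply h2
    refine h4.congr_deriv ?_
    symm
    change _ = M (exp (s • M) _) + exp (s • M) (exp ((-s) • M) (F s))
    rw [h3]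
  have h := (hasDerivAt_pi.1 hYd) k
  simp only [hYk] at h
  refine h.congr_deriv ?_
  have h5 : Y s = fun k' => ∑ l, volterraFun (expEntry M k' l) (f l) s := funext (hYk s)
  rw [← h5]
  rfl

end Duhamel

/-! ### The rescaled system -/

/-- The variables of the power series: the rescaled positions, and the two oscillating
exponentials. -/
abbrev Var (d : ℕ) : Type := Fin d ⊕ Bool

/-- The algebra in which the rescaled system is solved. -/
abbrev Alg (d : ℕ) : Type := Wiener (Var d) TimeFun

/-- The coordinates of time, position and value. -/
abbrev Coord (d N : ℕ) : Type := Unit ⊕ (Fin d ⊕ Fin N)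

section Weights

variable {d : ℕ}

/-- The degree in the positions. -/
noncomputable def zdeg : (Var d →₀ ℕ) →+ ℕ where
  toFun i := ∑ j, i (Sum.inl j)
  map_zero' := by simp
  map_add' i i' := by simp [Finset.sum_add_distrib]

/-- The degree in the oscillating exponentials. -/
noncomputable def wdeg : (Var d →₀ ℕ) →+ ℕ where
  toFun i := i (Sum.inr true) + i (Sum.inr false)
  map_zero' := by simp
  map_add' i i' := by simp; ring

/-- The frequency of a monomial. -/
noncomputable def freq (i : Var d →₀ ℕ) : ℝ := i (Sum.inr true) - i (Sum.inr false)

theorem abs_freq_le (i : Var d →₀ ℕ) : |freq i| ≤ wdeg i := by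
  have h1 : (0 : ℝ) ≤ i (Sum.inr true) := Nat.cast_nonneg _
  have h2 : (0 : ℝ) ≤ i (Sum.inr false) := Nat.cast_nonneg _
  have : (wdeg i : ℝ) = i (Sum.inr true) + i (Sum.inr false) := by simp [wdeg]
  rw [abs_le, this, freq]
  constructor <;> linarith

theorem le_zdeg (i : Var d →₀ ℕ) (j : Fin d) : i (Sum.inl j) ≤ zdeg i :=
  Finset.single_le_sum (f := fun j => i (Sum.inl j)) (fun _ _ => Nat.zero_le _) (Finset.mem_univ j)

end Weights

/-- The symbol of a first order system at a point, in a direction `ξ`: the matrix `A₀` of the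
system, with an exponential bound for the associated propagator, and the power series of its
coefficients. -/
structure Symbol (d N : ℕ) where
  /-- the direction of oscillation -/
  ξ : Fin d → ℝ
  /-- the matrix of the system in the direction `ξ` -/
  A₀ : Matrix (Fin N) (Fin N) ℝ
  /-- the rate of exponential growth -/
  c : ℝ
  /-- the constant of the exponential bound -/
  C₁ : ℝ
  c_nonneg : 0 ≤ c
  norm_exp_le : ∀ s : ℝ, ‖NormedSpace.exp (s • (Complex.I • LinearMap.toContinuousLinearMap
    (Matrix.toLin' (A₀.map fun a : ℝ => (a : ℂ)))))‖ ≤ C₁ * Real.exp (c * |s|)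
  /-- the coefficients of the principal part -/
  a : Fin d → Fin N → Fin N → FormalMultilinearSeries ℝ (Coord d N → ℝ) ℝ
  /-- the source term -/
  b : Fin N → FormalMultilinearSeries ℝ (Coord d N → ℝ) ℝ

/-- The scales of the oscillating solutions: `S` and `T` are the lengths of the time interval in
the fast and in the slow time, `Γ` is the rate of growth and `ρ` the radius in the positions. -/
structure Scale {d N : ℕ} (D : Symbol d N) where
  /-- fast time -/
  S : ℝ
  /-- rate of growth on the unit interval -/
  Γ : ℝ
  /-- slow time -/
  T : ℝ
  /-- radius -/
  ρ : ℝ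
  S_pos : 0 < S
  T_pos : 0 < T
  ρ_pos : 0 < ρ
  gap : 1 ≤ Γ - D.c * S

/-! ### Weighted operators on the coefficients -/

section Operators

variable {d N : ℕ} {D : Symbol d N} (s : Scale D)

/-- The gain of the smoothing operator on a monomial. -/
noncomputable def Scale.weight (i : Var d →₀ ℕ) : ℝ := zdeg i + (s.Γ - D.c * s.S) * wdeg i

/-- The inverse of the weight, on the monomials that contain an exponential. -/
noncomputable def Scale.winv (i : Var d →₀ ℕ) : ℝ := if wdeg i = 0 then 0 else (s.weight i)⁻¹

theorem Scale.wdeg_le_weight (i : Var d →₀ ℕ) : (wdeg i : ℝ) ≤ s.weight i := by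
  have h1 : (0 : ℝ) ≤ zdeg i := Nat.cast_nonneg _
  have h2 : (0 : ℝ) ≤ wdeg i := Nat.cast_nonneg _
  have := s.gap
  rw [Scale.weight]
  nlinarith

theorem Scale.gap_mul_wdeg_le_weight (i : Var d →₀ ℕ) :
    (s.Γ - D.c * s.S) * wdeg i ≤ s.weight i := by
  have h1 : (0 : ℝ) ≤ zdeg i := Nat.cast_nonneg _
  rw [Scale.weight]
  linarith

theorem Scale.zdeg_le_weight (i : Var d →₀ ℕ) : (zdeg i : ℝ) ≤ s.weight i := by
  have h2 : (0 : ℝ) ≤ wdeg i := Nat.cast_nonneg _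
  have := s.gap
  rw [Scale.weight]
  nlinarith

theorem Scale.weight_pos {i : Var d →₀ ℕ} (hi : wdeg i ≠ 0) : 0 < s.weight i :=
  lt_of_lt_of_le (by exact_mod_cast Nat.pos_of_ne_zero hi) (s.wdeg_le_weight i)

theorem Scale.winv_nonneg (i : Var d →₀ ℕ) : 0 ≤ s.winv i := by
  rw [Scale.winv]
  split_ifs with h
  · exact le_rfl
  · exact (inv_pos.2 (s.weight_pos h)).le

theorem Scale.mul_winv_le {i : Var d →₀ ℕ} {x y : ℝ} (hy : 0 ≤ y) (h : x ≤ y * s.weight i) :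
    x * s.winv i ≤ y := by
  rw [Scale.winv]
  split_ifs with hi
  · simpa using hy
  · rw [← div_eq_mul_inv, div_le_iff₀ (s.weight_pos hi)]
    exact h

theorem Scale.winv_le_one (i : Var d →₀ ℕ) : s.winv i ≤ 1 := by
  by_cases hi : wdeg i = 0
  · simp [Scale.winv, hi]
  · simpa using s.mul_winv_le (i := i) (x := 1) zero_le_one (by
      rw [one_mul]
      exact le_trans (by exact_mod_cast Nat.pos_of_ne_zero hi) (s.wdeg_le_weight i))

/-- The multiplication of the coefficients by bounded complex numbers. -/
noncomputable def multiplier (c : (Var d →₀ ℕ) → ℂ) (C : ℝ) (h : ∀ i, ‖c i‖ ≤ C) :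
    Alg d →L[ℝ] Alg d :=
  Wiener.diag (fun i => ContinuousLinearMap.mul ℝ TimeFun (ContinuousMap.const _ (c i))) C
    fun i => (ContinuousLinearMap.opNorm_mul_apply_le ℝ TimeFun _).trans
      (((ContinuousMap.norm_le _ (norm_nonneg _)).2 fun _ => le_rfl).trans (h i))

theorem coeff_multiplier (c : (Var d →₀ ℕ) → ℂ) (C : ℝ) (h : ∀ i, ‖c i‖ ≤ C) (f : Alg d)
    (i : Var d →₀ ℕ) : Wiener.coeff i (multiplier c C h f) =
      ContinuousMap.const _ (c i) * Wiener.coeff i f := rfl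

theorem norm_multiplier_le (c : (Var d →₀ ℕ) → ℂ) (C : ℝ) (h : ∀ i, ‖c i‖ ≤ C) (f : Alg d) :
    ‖multiplier c C h f‖ ≤ C * ‖f‖ := Wiener.norm_diag_apply_le _ _ _ _

/-- Division by the weight. -/
noncomputable def Scale.opT : Alg d →L[ℝ] Alg d :=
  multiplier (fun i => (s.winv i : ℂ)) 1 fun i => by
    rw [Complex.norm_real, Real.norm_of_nonneg (s.winv_nonneg i)]
    exact s.winv_le_one i

/-- Differentiation in the phase, after division by the weight. -/
noncomputable def Scale.opθ : Alg d →L[ℝ] Alg d :=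
  multiplier (fun i => Complex.I * freq i * s.winv i) (s.Γ - D.c * s.S)⁻¹ fun i => by
    have h0 : 0 < s.Γ - D.c * s.S := zero_lt_one.trans_le s.gap
    rw [norm_mul, norm_mul, Complex.norm_I, one_mul, Complex.norm_real, Complex.norm_real,
      Real.norm_of_nonneg (s.winv_nonneg i)]
    refine s.mul_winv_le (inv_pos.2 h0).le ((abs_freq_le i).trans ?_)
    rw [inv_mul_eq_div, le_div_iff₀ h0, mul_comm]
    exact s.gap_mul_wdeg_le_weight i

/-- Differentiation in the `j`-th rescaled position, after division by the weight. -/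
noncomputable def Scale.opZ (j : Fin d) : Alg d →L[ℝ] Alg d :=
  (Wiener.shift (Finsupp.single (Sum.inl j) 1)).comp <|
    multiplier (fun i => ((i (Sum.inl j) : ℝ) * s.winv i : ℝ)) 1 fun i => by
      rw [Complex.norm_real, Real.norm_of_nonneg (mul_nonneg (Nat.cast_nonneg _)
        (s.winv_nonneg i))]
      refine s.mul_winv_le zero_le_one ?_
      rw [one_mul]
      exact le_trans (by exact_mod_cast le_zdeg i j) (s.zdeg_le_weight i)

theorem Scale.norm_opT_le (f : Alg d) : ‖s.opT f‖ ≤ ‖f‖ :=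
  (norm_multiplier_le _ _ _ f).trans_eq (one_mul _)

/-- In the system this operator is multiplied by `S`, which will tend to infinity. A bound by the
inverse gap, rather than by one, keeps the product bounded when `Γ - c S` is comparable to `S`. -/
theorem Scale.norm_opθ_le (f : Alg d) : ‖s.opθ f‖ ≤ (s.Γ - D.c * s.S)⁻¹ * ‖f‖ :=
  norm_multiplier_le _ _ _ f

theorem Scale.norm_opZ_le (j : Fin d) (f : Alg d) : ‖s.opZ j f‖ ≤ ‖f‖ :=
  (Wiener.norm_shift_le _ _).trans 
    ((norm_multiplier_le _ _ _ f).trans_eq (one_mul _))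

theorem Scale.coeff_opT (f : Alg d) (i : Var d →₀ ℕ) :
    Wiener.coeff i (s.opT f) = ContinuousMap.const _ (s.winv i : ℂ) * Wiener.coeff i f := rfl

theorem Scale.coeff_opθ (f : Alg d) (i : Var d →₀ ℕ) :
    Wiener.coeff i (s.opθ f) = 
      ContinuousMap.const _ (Complex.I * freq i * s.winv i) * Wiener.coeff i f := rfl

theorem Scale.coeff_opZ (j : Fin d) (f : Alg d) (i : Var d →₀ ℕ) :
    Wiener.coeff i (s.opZ j f) = ContinuousMap.const _ ((((i (Sum.inl j) + 1 : ℕ) : ℝ) *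
      s.winv (i + Finsupp.single (Sum.inl j) 1) : ℝ) : ℂ) *
      Wiener.coeff (i + Finsupp.single (Sum.inl j) 1) f := by
  have h : (i + Finsupp.single (Sum.inl j) 1 : Var d →₀ ℕ) (Sum.inl j) = i (Sum.inl j) + 1 := by
    simp
  rw [Scale.opZ, ContinuousLinearMap.comp_apply, Wiener.coeff_shift, coeff_multiplier, h]

/-- The matrix of the system in the direction `ξ`, acting on complex vectors. -/
noncomputable def Symbol.mat (D : Symbol d N) : (Fin N → ℂ) →L[ℂ] (Fin N → ℂ) :=
  LinearMap.toContinuousLinearMap (Matrix.toLin' (D.A₀.map fun a : ℝ => (a : ℂ)))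

theorem Symbol.mat_apply (D : Symbol d N) (v : Fin N → ℂ) (k : Fin N) :
    D.mat v k = ∑ l, (D.A₀ k l : ℂ) * v l := by
  simp [Symbol.mat, Matrix.mulVec, dotProduct]

/-- The exponent of growth of a monomial on the unit interval. -/
noncomputable def Scale.rate (i : Var d →₀ ℕ) : ℝ := zdeg i + s.Γ * wdeg i

/-- The generator of the evolution of the coefficients of a monomial. -/
noncomputable def Scale.gen (i : Var d →₀ ℕ) : (Fin N → ℂ) →L[ℂ] (Fin N → ℂ) :=
  (-s.rate i : ℂ) • 1 + (s.S * freq i : ℂ) • (Complex.I • D.mat)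

theorem Scale.gen_apply (i : Var d →₀ ℕ) (v : Fin N → ℂ) (k : Fin N) :
    s.gen i v k = -s.rate i * v k + s.S * freq i * Complex.I * ∑ l, (D.A₀ k l : ℂ) * v l := by
  rw [← D.mat_apply]
  simp [Scale.gen]
  ring

/-- The damping `zdeg + Γ wdeg` competes with the growth `c S |freq|`. Since `|freq| ≤ wdeg`, what
is left is at least the weight. -/
theorem Scale.norm_exp_gen_le (i : Var d →₀ ℕ) {σ : ℝ} (hσ : 0 ≤ σ) :
    ‖NormedSpace.exp (σ • s.gen i)‖ ≤ D.C₁ * Real.exp (-s.weight i * σ) := by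
  have hsplit : σ • s.gen i = ((-s.rate i * σ : ℝ) : ℂ) • (1 : (Fin N → ℂ) →L[ℂ] (Fin N → ℂ)) +
      (σ * (s.S * freq i)) • (Complex.I • D.mat) := by
    ext v k
    simp [Scale.gen]
    ring
  have hC := D.norm_exp_le (σ * (s.S * freq i))
  have hC₁ : 0 ≤ D.C₁ := by simpa using (norm_nonneg _).trans (D.norm_exp_le 0)
  rw [hsplit, norm_exp_smul_one_add]
  refine (mul_le_mul_of_nonneg_left hC (Real.exp_pos _).le).trans ?_
  rw [mul_left_comm, ← Real.exp_add]
  refine mul_le_mul_of_nonneg_left (Real.exp_le_exp.2 ?_) hC₁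
  have h1 : |σ * (s.S * freq i)| ≤ σ * (s.S * wdeg i) := by
    rw [abs_mul, abs_mul, abs_of_nonneg hσ, abs_of_pos s.S_pos]
    have := s.S_pos
    gcongr
    exact abs_freq_le i
  have h2 := mul_le_mul_of_nonneg_left h1 D.c_nonneg
  rw [Scale.rate, Scale.weight]
  linarith

/-- The operator of convolution with an entry of the propagator, multiplied by the weight. -/
noncomputable def Scale.opJ (k l : Fin N) : Alg d →L[ℝ] Alg d :=
  -- The factor `weight i` cancels the gain of the convolution, which leaves the bound `C₁`, uniform
  -- in `i`. Monomials without exponential are discarded, since their weight may vanish.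
  Wiener.diag (fun i => if h : wdeg i = 0 then 0 else LinearMap.mkContinuous
      (s.weight i • volterra (expEntry (s.gen i) k l) (continuous_expEntry _ _ _)) D.C₁ <| by
        intro f
        have hw := s.weight_pos h
        rw [LinearMap.smul_apply, norm_smul, Real.norm_of_nonneg hw.le]
        refine (mul_le_mul_of_nonneg_left (norm_volterra_apply_le _ hw (C := D.C₁)
          (fun σ h0 _ => (norm_expEntry_le _ _ _ _).trans (s.norm_exp_gen_le i h0)) f)
          hw.le).trans_eq ?_
        field_simp) D.C₁ <| by
    have hC₁ : 0 ≤ D.C₁ := by simpa using (norm_nonneg _).trans (D.norm_exp_le 0)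
    intro i
    split_ifs with h
    · rwa [norm_zero]
    · exact LinearMap.mkContinuous_norm_le _ hC₁ _

theorem Scale.norm_opJ_le (k l : Fin N) (f : Alg d) : ‖s.opJ k l f‖ ≤ D.C₁ * ‖f‖ :=
  Wiener.norm_diag_apply_le _ _ _ _

theorem Scale.coeff_opJ_of_wdeg_eq_zero (k l : Fin N) (f : Alg d) {i : Var d →₀ ℕ}
    (hi : wdeg i = 0) : Wiener.coeff i (s.opJ k l f) = 0 := by
  rw [Scale.opJ, Wiener.coeff_diag, dif_pos hi]
  rfl

theorem Scale.coeff_opJ (k l : Fin N) (f : Alg d) {i : Var d →₀ ℕ} (hi : wdeg i ≠ 0) :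
    Wiener.coeff i (s.opJ k l f) = s.weight i •
      volterra (expEntry (s.gen i) k l) (continuous_expEntry _ _ _) (Wiener.coeff i f) := by
  rw [Scale.opJ, Wiener.coeff_diag, dif_neg hi]
  rfl

end Operators

/-! ### A contraction principle -/

section FixedPoint

variable {E : Type*} [NormedAddCommGroup E] [CompleteSpace E]

/-- The contraction principle for a small perturbation of a constant map. -/
theorem exists_eq_add_of_small_lipschitz {Ψ : E → E} {G₀ : E} {q R : ℝ} (hq0 : 0 ≤ q)
    (hq : q ≤ 1 / 2) (hR : 2 * ‖G₀‖ ≤ R) (h0 : Ψ 0 = 0)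
    (hΨ : ∀ x y, ‖x‖ ≤ R → ‖y‖ ≤ R → ‖Ψ x - Ψ y‖ ≤ q * ‖x - y‖) :
    ∃ G, G = G₀ + Ψ G ∧ ‖G‖ ≤ 2 * ‖G₀‖ ∧ ‖G - G₀‖ ≤ 2 * q * ‖G₀‖ ∧
      ∀ G', G' = G₀ + Ψ G' → ‖G'‖ ≤ 2 * ‖G₀‖ → G' = G := by
  have hn := norm_nonneg G₀
  have hbound {x : E} (hx : ‖x‖ ≤ 2 * ‖G₀‖) : ‖Ψ x‖ ≤ q * ‖x‖ := by
    have := hΨ x 0 (hx.trans hR) (by rw [norm_zero]; linarith)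
    rwa [h0, sub_zero, sub_zero] at this
  -- The ball of radius `2‖G₀‖` is invariant because `Ψ 0 = 0` and `q ≤ 1/2`. Using it instead of
  -- the ball of radius `R` makes all the bounds proportional to `‖G₀‖`.
  have hmaps : Set.MapsTo (fun x => G₀ + Ψ x) (Metric.closedBall 0 (2 * ‖G₀‖))
      (Metric.closedBall 0 (2 * ‖G₀‖)) := by
    intro x hx
    rw [mem_closedBall_zero_iff] at hx ⊢
    refine (norm_add_le _ _).trans ?_
    have := hbound hx
    nlinarith [norm_nonneg x]
  have hcontr : ContractingWith q.toNNReal (hmaps.restrict _ _ _) := by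
    refine ⟨by rw [← NNReal.coe_lt_coe, Real.coe_toNNReal _ hq0, NNReal.coe_one]; linarith,
      LipschitzWith.of_dist_le_mul ?_⟩
    rintro ⟨x, hx⟩ ⟨y, hy⟩
    rw [mem_closedBall_zero_iff] at hx hy
    simp only [Subtype.dist_eq, Set.MapsTo.val_restrict_apply, dist_eq_norm,
      Real.coe_toNNReal _ hq0, add_sub_add_left_eq_sub]
    exact hΨ x y (hx.trans hR) (hy.trans hR)
  obtain ⟨G, hG, hfix, -, -⟩ := hcontr.exists_fixedPoint' (x := (0 : E))
    Metric.isClosed_closedBall.isComplete hmaps (by simp) (edist_ne_top _ _)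
  rw [mem_closedBall_zero_iff] at hG
  have hfix' : G₀ + Ψ G = G := hfix
  refine ⟨G, hfix'.symm, hG, ?_, fun G' hG' hG'n => ?_⟩
  · have h1 : G - G₀ = Ψ G := by rw [← hfix', add_sub_cancel_left, hfix']
    rw [h1]
    refine (hbound hG).trans ?_
    nlinarith
  · have h1 : G' - G = Ψ G' - Ψ G := by
      conv_lhs => rw [hG', ← hfix']
      abel
    have h2 := hΨ G' G (hG'n.trans hR) (hG.trans hR)
    rw [← h1] at h2
    have h3 : ‖G' - G‖ = 0 := by nlinarith [norm_nonneg (G' - G)]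
    exact sub_eq_zero.1 (norm_eq_zero.1 h3)

end FixedPoint

/-! ### The right hand side and its Lipschitz bound -/

section RightHandSide

variable {d N : ℕ} {D : Symbol d N} (s : Scale D)

/-- The slow time, as a function on the unit interval. -/
noncomputable def Scale.time : TimeFun := ⟨fun τ => ((s.T * τ : ℝ) : ℂ), by fun_prop⟩

/-- The shrinking radius, as a function on the unit interval. -/
noncomputable def Scale.radius : TimeFun := ⟨fun τ => ((s.ρ * Real.exp (-τ) : ℝ) : ℂ), by fun_prop⟩

/-- The exponential function on the unit interval. -/
noncomputable def expTime : TimeFun := ⟨fun τ => (Real.exp τ : ℂ), by fun_prop⟩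

theorem Scale.norm_time_le : ‖s.time‖ ≤ s.T := by
  refine (ContinuousMap.norm_le _ s.T_pos.le).2 fun τ => ?_
  rw [Scale.time, ContinuousMap.coe_mk, Complex.norm_real,
    Real.norm_of_nonneg (mul_nonneg s.T_pos.le τ.2.1)]
  exact mul_le_of_le_one_right s.T_pos.le τ.2.2

theorem Scale.norm_radius_le : ‖s.radius‖ ≤ s.ρ := by
  refine (ContinuousMap.norm_le _ s.ρ_pos.le).2 fun τ => ?_
  rw [Scale.radius, ContinuousMap.coe_mk, Complex.norm_real,
    Real.norm_of_nonneg (mul_nonneg s.ρ_pos.le (Real.exp_pos _).le)]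
  refine mul_le_of_le_one_right s.ρ_pos.le (Real.exp_le_one_iff.2 ?_)
  simpa using τ.2.1

theorem norm_expTime_le : ‖expTime‖ ≤ 3 := by
  refine (ContinuousMap.norm_le _ (by norm_num)).2 fun τ => ?_
  rw [expTime, ContinuousMap.coe_mk, Complex.norm_real, Real.norm_of_nonneg (Real.exp_pos _).le]
  exact (Real.exp_le_exp.2 τ.2.2).trans (by linarith [Real.exp_one_lt_d9])

/-- Time, position and value as elements of the algebra. -/
noncomputable def Scale.coords (G : Fin N → Alg d) : Coord d N → Alg d
  | Sum.inl _ => Wiener.single 0 s.time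
  -- Inverts the change of variables: `x_j - x₀_j = ρ exp (-τ) X_j`.
  | Sum.inr (Sum.inl j) => Wiener.single (Finsupp.single (Sum.inl j) 1) s.radius
  | Sum.inr (Sum.inr k) => s.opT (G k)

theorem Scale.norm_coords_le {G : Fin N → Alg d} {ν : ℝ} (hT : s.T ≤ ν) (hρ : s.ρ ≤ ν)
    (hG : ‖G‖ ≤ ν) : ‖s.coords G‖ ≤ ν := by
  refine (pi_norm_le_iff_of_nonneg (s.T_pos.le.trans hT)).2 ?_
  rintro (_ | j | k)
  · exact (Wiener.norm_single _ _).trans_le (s.norm_time_le.trans hT)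
  · exact (Wiener.norm_single _ _).trans_le (s.norm_radius_le.trans hρ)
  · exact (s.norm_opT_le _).trans ((norm_le_pi_norm G k).trans hG)

theorem Scale.norm_coords_sub_le (G G' : Fin N → Alg d) :
    ‖s.coords G - s.coords G'‖ ≤ ‖G - G'‖ := by
  refine (pi_norm_le_iff_of_nonneg (norm_nonneg _)).2 ?_
  rintro (_ | j | k)
  · simp [Scale.coords]
  · simp [Scale.coords]
  · simp only [Scale.coords, Pi.sub_apply, ← map_sub]
    exact (s.norm_opT_le _).trans (norm_le_pi_norm (G - G') k)

/-- The increment of a coefficient of the principal part. -/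
noncomputable def Scale.coef (j : Fin d) (k l : Fin N) (G : Fin N → Alg d) : Alg d :=
  calculus (D.a j k l) (Alg d) (s.coords G)

/-- The right hand side of the rescaled system, without the constant coefficient part. -/
noncomputable def Scale.rhs (G : Fin N → Alg d) (k : Fin N) : Alg d :=
  -- By the chain rule `T ∂_{x_j} = S ξ_j ∂_θ + (T / ρ) exp τ ∂_{X_j}`. The value of the
  -- coefficients at the base point is removed from the phase part, since it is already in the
  -- generator.
  (∑ j, ∑ l, ((D.ξ j * s.S) • ((s.coef j k l G - calculus (D.a j k l) (Alg d) 0) * s.opθ (G l)) +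
    (s.T / s.ρ) • (Wiener.single 0 expTime * s.coef j k l G * s.opZ j (G l)))) +
  s.T • (calculus (D.b k) (Alg d) (s.coords G) - calculus (D.b k) (Alg d) (s.coords 0))

theorem Scale.rhs_zero (k : Fin N) : s.rhs 0 k = 0 := by
  simp [Scale.rhs]

/-- The integral form of the rescaled system, without the constant coefficient part. -/
noncomputable def Scale.duhamel (G : Fin N → Alg d) (k : Fin N) : Alg d :=
  ∑ l, s.opJ k l (s.rhs G l)

theorem norm_mul_sub_mul_le {B : Type*} [NormedRing B] {x x' u u' : B} {X X' U U' : ℝ}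
    (hx : ‖x‖ ≤ X) (hu : ‖u - u'‖ ≤ U) (hx' : ‖x - x'‖ ≤ X') (hu' : ‖u'‖ ≤ U') :
    ‖x * u - x' * u'‖ ≤ X * U + X' * U' := by
  have : x * u - x' * u' = x * (u - u') + (x - x') * u' := by noncomm_ring
  rw [this]
  refine norm_add_le_of_le ((norm_mul_le _ _).trans ?_) ((norm_mul_le _ _).trans ?_)
  · exact mul_le_mul hx hu (norm_nonneg _) ((norm_nonneg _).trans hx)
  · exact mul_le_mul hx' hu' (norm_nonneg _) ((norm_nonneg _).trans hx')

/-- A common Lipschitz bound for the coefficients of the system. -/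
structure Symbol.LipschitzBound (D : Symbol d N) (r K : ℝ) : Prop where
  coef : ∀ j k l, ∀ y y' : Coord d N → Alg d, ‖y‖ ≤ r → ‖y'‖ ≤ r →
    ‖calculus (D.a j k l) (Alg d) y - calculus (D.a j k l) (Alg d) y'‖ ≤ K * ‖y - y'‖
  source : ∀ k, ∀ y y' : Coord d N → Alg d, ‖y‖ ≤ r → ‖y'‖ ≤ r →
    ‖calculus (D.b k) (Alg d) y - calculus (D.b k) (Alg d) y'‖ ≤ K * ‖y - y'‖
  zero : ∀ j k l, ‖calculus (D.a j k l) (Alg d) 0‖ ≤ K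

/-- The form with filters lets finitely many coefficients share one radius and one constant. -/
theorem eventually_lipschitz_calculus {ι : Type*} [Fintype ι] [DecidableEq ι]
    {p : FormalMultilinearSeries ℝ (ι → ℝ) ℝ} (hp : 0 < p.radius) :
    ∀ᶠ r in 𝓝[>] (0 : ℝ), ∀ᶠ K in atTop, ∀ y y' : ι → Alg d, ‖y‖ ≤ r → ‖y'‖ ≤ r →
      ‖calculus p (Alg d) y - calculus p (Alg d) y'‖ ≤ K * ‖y - y'‖ := by
  obtain ⟨r₀, hr₀, K₀, -, h⟩ := exists_lipschitz_calculus (B := Alg d) p hp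
  filter_upwards [Ioc_mem_nhdsGT hr₀] with r hr
  filter_upwards [eventually_ge_atTop K₀] with K hK y y' hy hy'
  exact (h y y' (hy.trans hr.2) (hy'.trans hr.2)).trans
    (mul_le_mul_of_nonneg_right hK (norm_nonneg _))

theorem Symbol.exists_lipschitzBound (D : Symbol d N) (ha : ∀ j k l, 0 < (D.a j k l).radius)
    (hb : ∀ k, 0 < (D.b k).radius) : ∃ r K : ℝ, 0 < r ∧ 0 < K ∧ D.LipschitzBound r K := by
  have h1 : ∀ᶠ r in 𝓝[>] (0 : ℝ), ∀ j k l, ∀ᶠ K in atTop, ∀ y y' : Coord d N → Alg d,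
      ‖y‖ ≤ r → ‖y'‖ ≤ r →
      ‖calculus (D.a j k l) (Alg d) y - calculus (D.a j k l) (Alg d) y'‖ ≤ K * ‖y - y'‖ :=
    eventually_all.2 fun j => eventually_all.2 fun k => eventually_all.2 fun l =>
      eventually_lipschitz_calculus (ha j k l)
  have h2 : ∀ᶠ r in 𝓝[>] (0 : ℝ), ∀ k, ∀ᶠ K in atTop, ∀ y y' : Coord d N → Alg d,
      ‖y‖ ≤ r → ‖y'‖ ≤ r →
      ‖calculus (D.b k) (Alg d) y - calculus (D.b k) (Alg d) y'‖ ≤ K * ‖y - y'‖ :=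
    eventually_all.2 fun k => eventually_lipschitz_calculus (hb k)
  obtain ⟨r, ⟨h1, h2⟩, hr⟩ := ((h1.and h2).and self_mem_nhdsWithin).exists
  have h3 : ∀ᶠ K in atTop, ∀ j k l, ‖calculus (D.a j k l) (Alg d) 0‖ ≤ K :=
    eventually_all.2 fun j => eventually_all.2 fun k => eventually_all.2 fun l =>
      eventually_ge_atTop _
  obtain ⟨K, ⟨⟨h1, h2⟩, h3⟩, hK⟩ := (((eventually_all.2 fun j => eventually_all.2 fun k =>
    eventually_all.2 fun l => h1 j k l).and (eventually_all.2 h2)).and h3 |>.and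
    (eventually_gt_atTop 0)).exists
  exact ⟨r, K, hr, hK, h1, h2, h3⟩

/-- The Lipschitz bound of the right hand side, in terms of the small parameter. -/
theorem Scale.norm_rhs_sub_le {r K H ν : ℝ} (hD : D.LipschitzBound r K) (hK : 0 < K)
    (hH : s.S * (s.Γ - D.c * s.S)⁻¹ ≤ H) (hT : s.T ≤ ν) (hρ : s.ρ ≤ ν) (hTρ : s.T / s.ρ ≤ ν)
    (hνr : ν ≤ r) (hν1 : ν ≤ 1) {G G' : Fin N → Alg d} (hG : ‖G‖ ≤ ν) (hG' : ‖G'‖ ≤ ν)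
    (k : Fin N) :
    ‖s.rhs G k - s.rhs G' k‖ ≤
      ((∑ j, ∑ _l : Fin N, (|D.ξ j| * (2 * K * H) + 9 * K)) + K) * ν * ‖G - G'‖ := by
  have hν : 0 < ν := s.T_pos.trans_le hT
  set δ := ‖G - G'‖ with hδ
  have hδ0 : 0 ≤ δ := norm_nonneg _
  have hy := s.norm_coords_le hT hρ hG
  have hy' := s.norm_coords_le hT hρ hG'
  have hyy := s.norm_coords_sub_le G G'
  have hGl (l) : ‖G l - G' l‖ ≤ δ := norm_le_pi_norm (G - G') l
  have hGl' (l) : ‖G' l‖ ≤ ν := (norm_le_pi_norm G' l).trans hG'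
  have hm : 0 < (s.Γ - D.c * s.S)⁻¹ := inv_pos.2 (zero_lt_one.trans_le s.gap)
  have hc (j l) : ‖s.coef j k l G - s.coef j k l G'‖ ≤ K * δ :=
    (hD.coef j k l _ _ (hy.trans hνr) (hy'.trans hνr)).trans (by gcongr)
  have hc0 (j l) : ‖s.coef j k l G - calculus (D.a j k l) (Alg d) 0‖ ≤ K * ν := by
    refine (hD.coef j k l _ _ (hy.trans hνr) (by rw [norm_zero]; linarith)).trans ?_
    rw [sub_zero]
    gcongr
  have hc1 (j l) : ‖s.coef j k l G‖ ≤ 2 * K := by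
    have := norm_le_norm_add_norm_sub' (s.coef j k l G) (calculus (D.a j k l) (Alg d) 0)
    nlinarith [hc0 j l, hD.zero j k l]
  -- Each product carries a factor `ν`. In the phase term it comes from the increment of the
  -- coefficient or from `G'`, while `S (Γ - c S)⁻¹ ≤ H` absorbs `S`. In the position term it is `T
  -- / ρ`. The constant `9` is `3 · 2 + 3`, where `3` bounds `exp τ`.
  have hterm (j l) : ‖((D.ξ j * s.S) • ((s.coef j k l G - calculus (D.a j k l) (Alg d) 0) *
        s.opθ (G l)) + (s.T / s.ρ) • (Wiener.single 0 expTime * s.coef j k l G * s.opZ j (G l))) -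
      ((D.ξ j * s.S) • ((s.coef j k l G' - calculus (D.a j k l) (Alg d) 0) *
        s.opθ (G' l)) + (s.T / s.ρ) • (Wiener.single 0 expTime * s.coef j k l G' *
          s.opZ j (G' l)))‖ ≤ (|D.ξ j| * (2 * K * H) + 9 * K) * ν * δ := by
    have h1 : ‖(s.coef j k l G - calculus (D.a j k l) (Alg d) 0) * s.opθ (G l) -
        (s.coef j k l G' - calculus (D.a j k l) (Alg d) 0) * s.opθ (G' l)‖ ≤
        K * ν * ((s.Γ - D.c * s.S)⁻¹ * δ) + K * δ * ((s.Γ - D.c * s.S)⁻¹ * ν) := by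
      refine norm_mul_sub_mul_le (hc0 j l) ?_ (by rw [sub_sub_sub_cancel_right]; exact hc j l) ?_
      · rw [← map_sub]
        exact (s.norm_opθ_le _).trans (mul_le_mul_of_nonneg_left (hGl l) hm.le)
      · exact (s.norm_opθ_le _).trans (mul_le_mul_of_nonneg_left (hGl' l) hm.le)
    have h2 : ‖Wiener.single 0 expTime * s.coef j k l G * s.opZ j (G l) -
        Wiener.single 0 expTime * s.coef j k l G' * s.opZ j (G' l)‖ ≤
        (3 * (2 * K)) * δ + 3 * (K * δ) * ν := by
      have h3 : ‖(Wiener.single 0 expTime : Alg d)‖ ≤ 3 :=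
        (Wiener.norm_single _ _).trans_le norm_expTime_le
      refine norm_mul_sub_mul_le ((norm_mul_le _ _).trans
        (mul_le_mul h3 (hc1 j l) (norm_nonneg _) (by norm_num))) ?_ ?_ ?_
      · rw [← map_sub]
        exact (s.norm_opZ_le j _).trans (hGl l)
      · rw [← mul_sub]
        exact (norm_mul_le _ _).trans (mul_le_mul h3 (hc j l) (norm_nonneg _) (by norm_num))
      · exact (s.norm_opZ_le j _).trans (hGl' l)
    rw [add_sub_add_comm, ← smul_sub, ← smul_sub]
    refine (norm_add_le _ _).trans ?_
    rw [norm_smul, norm_smul, norm_mul, Real.norm_eq_abs, Real.norm_of_nonneg s.S_pos.le,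
      Real.norm_of_nonneg (div_pos s.T_pos s.ρ_pos).le]
    have h4 : |D.ξ j| * s.S * ‖(s.coef j k l G - calculus (D.a j k l) (Alg d) 0) * s.opθ (G l) -
        (s.coef j k l G' - calculus (D.a j k l) (Alg d) 0) * s.opθ (G' l)‖ ≤
        |D.ξ j| * (2 * K * H) * ν * δ := by
      calc _ ≤ |D.ξ j| * s.S * (K * ν * ((s.Γ - D.c * s.S)⁻¹ * δ) +
            K * δ * ((s.Γ - D.c * s.S)⁻¹ * ν)) :=
            mul_le_mul_of_nonneg_left h1 (mul_nonneg (abs_nonneg _) s.S_pos.le)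
        _ = |D.ξ j| * (2 * K * (s.S * (s.Γ - D.c * s.S)⁻¹)) * ν * δ := by ring
        _ ≤ _ := by gcongr
    have h5 : s.T / s.ρ * ‖Wiener.single 0 expTime * s.coef j k l G * s.opZ j (G l) -
        Wiener.single 0 expTime * s.coef j k l G' * s.opZ j (G' l)‖ ≤ 9 * K * ν * δ := by
      calc _ ≤ ν * ((3 * (2 * K)) * δ + 3 * (K * δ) * ν) :=
            mul_le_mul hTρ h2 (norm_nonneg _) hν.le
        _ ≤ ν * ((3 * (2 * K)) * δ + 3 * (K * δ) * 1) := by gcongr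
        _ = _ := by ring
    linarith
  have hsrc : ‖s.T • (calculus (D.b k) (Alg d) (s.coords G) -
        calculus (D.b k) (Alg d) (s.coords 0)) - s.T • (calculus (D.b k) (Alg d) (s.coords G') -
        calculus (D.b k) (Alg d) (s.coords 0))‖ ≤ K * ν * δ := by
    rw [← smul_sub, sub_sub_sub_cancel_right, norm_smul, Real.norm_of_nonneg s.T_pos.le]
    calc _ ≤ ν * (K * δ) := mul_le_mul hT
          ((hD.source k _ _ (hy.trans hνr) (hy'.trans hνr)).trans (by gcongr)) (norm_nonneg _) hν.le
      _ = _ := by ring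
  rw [Scale.rhs, Scale.rhs, add_sub_add_comm, add_mul, add_mul, ← Finset.sum_sub_distrib]
  refine norm_add_le_of_le ?_ hsrc
  rw [Finset.sum_mul, Finset.sum_mul]
  refine norm_sum_le_of_le _ fun j _ => ?_
  rw [← Finset.sum_sub_distrib, Finset.sum_mul, Finset.sum_mul]
  exact norm_sum_le_of_le _ fun l _ => hterm j l

/-- The rescaled system has a unique small solution, close to the solution of the constant
coefficient system. -/
theorem Symbol.exists_solution (D : Symbol d N) (ha : ∀ j k l, 0 < (D.a j k l).radius)
    (hb : ∀ k, 0 < (D.b k).radius) (H : ℝ) :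
    ∃ ν₀ C : ℝ, 0 < ν₀ ∧ 0 < C ∧ ∀ (s : Scale D) (ν : ℝ) (G₀ : Fin N → Alg d), ν ≤ ν₀ →
      s.S * (s.Γ - D.c * s.S)⁻¹ ≤ H → s.T ≤ ν → s.ρ ≤ ν → s.T / s.ρ ≤ ν → 2 * ‖G₀‖ ≤ ν →
      ∃ G, G = G₀ + s.duhamel G ∧ ‖G‖ ≤ 2 * ‖G₀‖ ∧ ‖G - G₀‖ ≤ C * ν * ‖G₀‖ ∧
        ∀ G', G' = G₀ + s.duhamel G' → ‖G'‖ ≤ 2 * ‖G₀‖ → G' = G := by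
  obtain ⟨r, K, hr, hK, hD⟩ := D.exists_lipschitzBound ha hb
  have hC₁ : 0 ≤ D.C₁ := by simpa using (norm_nonneg _).trans (D.norm_exp_le 0)
  set C₂ := (∑ j, ∑ _l : Fin N, (|D.ξ j| * (2 * K * |H|) + 9 * K)) + K with hC₂
  have hC₂0 : 0 ≤ C₂ := by positivity
  -- `ν * C₃` will be the Lipschitz constant of the integral operator: `N` counts the components and
  -- `C₁` bounds `opJ`. The threshold below makes it at most `1/2`.
  set C₃ := N * (D.C₁ * C₂) + 1 with hC₃
  have hC₃0 : 0 < C₃ := by positivity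
  refine ⟨min (min r 1) (1 / (2 * C₃)), 2 * C₃, lt_min (lt_min hr one_pos) (by positivity),
    by positivity, fun s ν G₀ hν hH hT hρ hTρ hG₀ => ?_⟩
  have hν0 : 0 < ν := s.T_pos.trans_le hT
  have hνr : ν ≤ r := hν.trans ((min_le_left _ _).trans (min_le_left _ _))
  have hν1 : ν ≤ 1 := hν.trans ((min_le_left _ _).trans (min_le_right _ _))
  have hνC : ν * C₃ ≤ 1 / 2 := by
    have := hν.trans (min_le_right _ _)
    rw [le_div_iff₀ (by positivity)] at this
    linarith
  obtain ⟨G, h1, h2, h3, h4⟩ := exists_eq_add_of_small_lipschitz (Ψ := s.duhamel) (G₀ := G₀)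
    (q := ν * C₃) (R := ν) (by positivity) hνC hG₀
    (by ext k : 1; simp [Scale.duhamel, s.rhs_zero]) (fun x y hx hy => by
      refine (pi_norm_le_iff_of_nonneg (by positivity)).2 fun k => ?_
      simp only [Pi.sub_apply, Scale.duhamel, ← Finset.sum_sub_distrib, ← map_sub]
      calc ‖∑ l, s.opJ k l (s.rhs x l - s.rhs y l)‖
          ≤ ∑ _l : Fin N, D.C₁ * (C₂ * ν * ‖x - y‖) := by
            refine norm_sum_le_of_le _ fun l _ => (s.norm_opJ_le k l _).trans ?_
            exact mul_le_mul_of_nonneg_left (s.norm_rhs_sub_le hD hK (hH.trans (le_abs_self H)) hT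
              hρ hTρ hνr hν1 hx hy l) hC₁
        _ = N * (D.C₁ * C₂) * (ν * ‖x - y‖) := by
            rw [Finset.sum_const, Finset.card_univ, Fintype.card_fin, nsmul_eq_mul]
            ring
        _ ≤ C₃ * (ν * ‖x - y‖) := by
            gcongr
            linarith
        _ = _ := by ring)
  exact ⟨G, h1, h2, by linarith, h4⟩

end RightHandSide

/-! ### Conjugation symmetry, and monomials without exponential -/

section Conjugation

open scoped ComplexConjugate

/-- Complex conjugation of functions of time. -/
noncomputable def conjTime : TimeFun →ₐ[ℝ] TimeFun :=
  AlgHom.compLeftContinuous ℝ Complex.conjAe.toAlgHom Complex.continuous_conj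

theorem conjTime_apply (f : TimeFun) (τ : unitInterval) : conjTime f τ = conj (f τ) := rfl

theorem norm_conjTime (f : TimeFun) : ‖conjTime f‖ = ‖f‖ := by
  have h (f : TimeFun) : ‖conjTime f‖ ≤ ‖f‖ :=
    (ContinuousMap.norm_le _ (norm_nonneg _)).2 fun τ => by
      rw [conjTime_apply, Complex.norm_conj]
      exact f.norm_coe_le_norm τ
  refine le_antisymm (h f) ?_
  have h2 : conjTime (conjTime f) = f := by
    ext τ
    simp [conjTime_apply]
  calc ‖f‖ = ‖conjTime (conjTime f)‖ := by rw [h2]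
    _ ≤ _ := h _

theorem extend_conjTime (f : TimeFun) (τ : ℝ) : (conjTime f).extend τ = conj (f.extend τ) := rfl

theorem conj_exp_smul_apply {N : ℕ} {M M' : (Fin N → ℂ) →L[ℂ] (Fin N → ℂ)}
    (h : ∀ v k, conj (M v k) = M' (fun l => conj (v l)) k) (r : ℝ) (v : Fin N → ℂ) (k : Fin N) :
    conj (NormedSpace.exp (r • M) v k) = NormedSpace.exp (r • M') (fun l => conj (v l)) k := by
  have hpow (n : ℕ) : ∀ v k, conj (((r • M) ^ n) v k) = ((r • M') ^ n) (fun l => conj (v l)) k := by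
    induction n with
    | zero => intro v k; rfl
    | succ n ih =>
      intro v k
      rw [pow_succ, pow_succ, mul_apply_eq_comp, mul_apply_eq_comp, ih]
      refine congrArg (fun w => ((r • M') ^ n) w k) (funext fun l => ?_)
      change conj ((r : ℂ) * M v l) = (r : ℂ) * M' (fun l => conj (v l)) l
      rw [map_mul, h, Complex.conj_ofReal]
  have hs (M : (Fin N → ℂ) →L[ℂ] (Fin N → ℂ)) (v : Fin N → ℂ) :
      HasSum (fun n : ℕ => ((n.factorial : ℂ)⁻¹) * (M ^ n) v k) (NormedSpace.exp M v k) :=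
    (NormedSpace.exp_series_hasSum_exp' (𝕂 := ℂ) M).mapL
      ((ContinuousLinearMap.proj (R := ℂ) (φ := fun _ : Fin N => ℂ) k).comp
        (ContinuousLinearMap.apply ℂ (Fin N → ℂ) v))
  have h1 := (hs (r • M) v).map (starRingEnd ℂ) Complex.continuous_conj
  refine h1.unique ?_
  convert hs (r • M') fun l => conj (v l) using 2 with n
  simp only [Function.comp_apply, map_mul, hpow, map_inv₀, map_natCast]

theorem conj_expEntry {N : ℕ} {M M' : (Fin N → ℂ) →L[ℂ] (Fin N → ℂ)}
    (h : ∀ v k, conj (M v k) = M' (fun l => conj (v l)) k) (k l : Fin N) (r : ℝ) :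
    conj (expEntry M k l r) = expEntry M' k l r := by
  rw [expEntry, conj_exp_smul_apply h, expEntry]
  refine congrArg (fun w => NormedSpace.exp (r • M') w k) (funext fun j => ?_)
  rw [Pi.single_apply]
  split_ifs <;> simp

theorem conjTime_volterra {κ κ' : ℝ → ℂ} (hκ : Continuous κ) (hκ' : Continuous κ')
    (h : ∀ r, conj (κ r) = κ' r) (f : TimeFun) :
    conjTime (volterra κ hκ f) = volterra κ' hκ' (conjTime f) := by
  ext τ
  rw [conjTime_apply, volterra_apply, volterra_apply, volterraFun, volterraFun]
  have := (Complex.conjCLE : ℂ →L[ℝ] ℂ).intervalIntegral_comp_comm (μ := volume)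
    (a := 0) (b := τ) (f := fun σ => κ (τ - σ) * f.extend σ) (by
      have := f.continuous_extend
      exact Continuous.intervalIntegrable (by fun_prop) _ _)
  refine this.symm.trans (intervalIntegral.integral_congr fun σ _ => ?_)
  change conj (κ (τ - σ) * f.extend σ) = _
  rw [map_mul, h, extend_conjTime]

variable {d N : ℕ}

/-- The exchange of the two exponentials. -/
def swapVar (d : ℕ) : Var d ≃ Var d := Equiv.sumCongr (Equiv.refl _) Equiv.boolNot

/-- The exchange of the two exponentials, on the monomials. -/
noncomputable def swapIdx (i : Var d →₀ ℕ) : Var d →₀ ℕ := Finsupp.domCongr (swapVar d) i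

theorem swapIdx_apply_inl (i : Var d →₀ ℕ) (j : Fin d) :
    swapIdx i (Sum.inl j) = i (Sum.inl j) := rfl

theorem swapIdx_apply_inr (i : Var d →₀ ℕ) (b : Bool) :
    swapIdx i (Sum.inr b) = i (Sum.inr !b) := rfl

theorem swapIdx_add (i i' : Var d →₀ ℕ) : swapIdx (i + i') = swapIdx i + swapIdx i' :=
  map_add (Finsupp.domCongr (swapVar d)) i i'

theorem swapIdx_single_inl (j : Fin d) :
    swapIdx (Finsupp.single (Sum.inl j) 1) = Finsupp.single (Sum.inl j) 1 := by
  simp [swapIdx, swapVar]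

theorem swapIdx_swapIdx (i : Var d →₀ ℕ) : swapIdx (swapIdx i) = i := by
  ext (j | b)
  · rfl
  · rw [swapIdx_apply_inr, swapIdx_apply_inr, Bool.not_not]

theorem zdeg_swapIdx (i : Var d →₀ ℕ) : zdeg (swapIdx i) = zdeg i := rfl

theorem wdeg_swapIdx (i : Var d →₀ ℕ) : wdeg (swapIdx i) = wdeg i := add_comm _ _

theorem freq_swapIdx (i : Var d →₀ ℕ) : freq (swapIdx i) = -freq i := by
  rw [freq, freq, swapIdx_apply_inr, swapIdx_apply_inr, neg_sub]
  rfl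

/-- Complex conjugation, for functions of real positions and of the phase. -/
noncomputable def conjAlg (d : ℕ) : Alg d →ₐ[ℝ] Alg d :=
  Wiener.twist (swapVar d) conjTime norm_conjTime

theorem coeff_conjAlg (f : Alg d) (i : Var d →₀ ℕ) :
    Wiener.coeff i (conjAlg d f) = conjTime (Wiener.coeff (swapIdx i) f) := rfl

theorem norm_conjAlg (f : Alg d) : ‖conjAlg d f‖ = ‖f‖ := Wiener.norm_twist _ _ _ _

theorem conjAlg_single {i : Var d →₀ ℕ} (hi : swapIdx i = i) {f : TimeFun} (hf : conjTime f = f) :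
    conjAlg d (Wiener.single i f) = Wiener.single i f := by
  classical
  refine Wiener.ext fun i' => ?_
  rw [coeff_conjAlg, Wiener.coeff_single, Wiener.coeff_single]
  have : swapIdx i' = i ↔ i' = i :=
    ⟨fun h => by rw [← swapIdx_swapIdx i', h, hi], fun h => by rw [h, hi]⟩
  simp only [this]
  split_ifs
  · exact hf
  · exact map_zero _

theorem conjTime_const (c : ℂ) :
    conjTime (ContinuousMap.const _ c) = ContinuousMap.const _ (conj c) := rfl

variable {D : Symbol d N} (s : Scale D)

theorem Scale.weight_swapIdx (i : Var d →₀ ℕ) : s.weight (swapIdx i) = s.weight i := by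
  rw [Scale.weight, Scale.weight, zdeg_swapIdx, wdeg_swapIdx]

theorem Scale.winv_swapIdx (i : Var d →₀ ℕ) : s.winv (swapIdx i) = s.winv i := by
  rw [Scale.winv, Scale.winv, s.weight_swapIdx, wdeg_swapIdx]

theorem Scale.conjAlg_opT (f : Alg d) : conjAlg d (s.opT f) = s.opT (conjAlg d f) :=
  Wiener.ext fun i => by
    rw [coeff_conjAlg, s.coeff_opT, s.coeff_opT, map_mul, conjTime_const, s.winv_swapIdx,
      Complex.conj_ofReal, coeff_conjAlg]

theorem Scale.conjAlg_opθ (f : Alg d) : conjAlg d (s.opθ f) = s.opθ (conjAlg d f) :=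
  Wiener.ext fun i => by
    rw [coeff_conjAlg, s.coeff_opθ, s.coeff_opθ, map_mul, conjTime_const, s.winv_swapIdx,
      coeff_conjAlg, freq_swapIdx]
    simp

theorem Scale.conjAlg_opZ (j : Fin d) (f : Alg d) :
    conjAlg d (s.opZ j f) = s.opZ j (conjAlg d f) :=
  Wiener.ext fun i => by
    have h : swapIdx i + Finsupp.single (Sum.inl j) 1 =
        swapIdx (i + Finsupp.single (Sum.inl j) 1) := by
      rw [swapIdx_add, swapIdx_single_inl]
    rw [coeff_conjAlg, s.coeff_opZ, s.coeff_opZ, map_mul, conjTime_const, h, s.winv_swapIdx,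
      coeff_conjAlg, Complex.conj_ofReal, swapIdx_apply_inl]

/-- Conjugation changes the sign of `Complex.I` and the exchange of the exponentials that of `freq`;
the product is invariant because `A₀` is real. -/
theorem Scale.conj_gen (i : Var d →₀ ℕ) (v : Fin N → ℂ) (k : Fin N) :
    conj (s.gen (swapIdx i) v k) = s.gen i (fun l => conj (v l)) k := by
  rw [s.gen_apply, s.gen_apply, Scale.rate, Scale.rate, zdeg_swapIdx, wdeg_swapIdx, freq_swapIdx]
  simp

theorem Scale.conjAlg_opJ (k l : Fin N) (f : Alg d) :
    conjAlg d (s.opJ k l f) = s.opJ k l (conjAlg d f) :=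
  Wiener.ext fun i => by
    rw [coeff_conjAlg]
    by_cases hi : wdeg i = 0
    · rw [s.coeff_opJ_of_wdeg_eq_zero k l _ hi,
        s.coeff_opJ_of_wdeg_eq_zero k l _ ((wdeg_swapIdx i).trans hi), map_zero]
    · rw [s.coeff_opJ k l _ hi, s.coeff_opJ k l _ (i := swapIdx i) (by rwa [wdeg_swapIdx]),
        map_smul, s.weight_swapIdx, coeff_conjAlg]
      congr 1
      exact conjTime_volterra _ _ (conj_expEntry (s.conj_gen i) k l) _

/-- A common lower bound for the radii of convergence of the coefficients. -/
structure Symbol.RadiusBound (D : Symbol d N) (a : NNReal) : Prop where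
  coef : ∀ j k l, (a : ENNReal) < (D.a j k l).radius
  source : ∀ k, (a : ENNReal) < (D.b k).radius

theorem Scale.conjAlg_coords (G : Fin N → Alg d) (m : Coord d N) :
    conjAlg d (s.coords G m) = s.coords (fun k => conjAlg d (G k)) m := by
  rcases m with _ | j | k
  · refine conjAlg_single (map_zero (Finsupp.domCongr (swapVar d))) ?_
    ext τ
    exact Complex.conj_ofReal _
  · refine conjAlg_single (swapIdx_single_inl j) ?_
    ext τ
    exact Complex.conj_ofReal _
  · exact s.conjAlg_opT _

theorem Scale.norm_coords_zero_le (G : Fin N → Alg d) : ‖s.coords 0‖ ≤ ‖s.coords G‖ := by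
  refine (pi_norm_le_iff_of_nonneg (norm_nonneg _)).2 ?_
  rintro (_ | j | k)
  · exact norm_le_pi_norm (s.coords G) (Sum.inl ())
  · exact norm_le_pi_norm (s.coords G) (Sum.inr (Sum.inl j))
  · simp [Scale.coords]

section

variable {a : NNReal} (hD : D.RadiusBound a) {G : Fin N → Alg d}
  (hG : ‖s.coords G‖ < a / (Fintype.card (Coord d N) + 1))
include hD hG

theorem Scale.map_coef {B : Type*} [NormedCommRing B] [NormedAlgebra ℝ B] [NormOneClass B]
    [CompleteSpace B] (φ : Alg d →ₐ[ℝ] B) (hφ : ∀ f, ‖φ f‖ ≤ ‖f‖) (j : Fin d) (k l : Fin N) :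
    φ (s.coef j k l G) = calculus (D.a j k l) B fun m => φ (s.coords G m) :=
  map_calculus _ φ hφ (hD.coef j k l) hG

theorem Scale.map_coef_zero {B : Type*} [NormedCommRing B] [NormedAlgebra ℝ B] [NormOneClass B]
    [CompleteSpace B] (φ : Alg d →ₐ[ℝ] B) (hφ : ∀ f, ‖φ f‖ ≤ ‖f‖) (j : Fin d) (k l : Fin N) :
    φ (calculus (D.a j k l) (Alg d) 0) = calculus (D.a j k l) B 0 := by
  rw [map_calculus _ φ hφ (hD.coef j k l)
    (by rw [norm_zero]; exact (norm_nonneg _).trans_lt hG)]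
  simp only [Pi.zero_apply, map_zero]
  rfl

theorem Scale.map_source {B : Type*} [NormedCommRing B] [NormedAlgebra ℝ B] [NormOneClass B]
    [CompleteSpace B] (φ : Alg d →ₐ[ℝ] B) (hφ : ∀ f, ‖φ f‖ ≤ ‖f‖) (k : Fin N) :
    φ (calculus (D.b k) (Alg d) (s.coords G)) = calculus (D.b k) B fun m => φ (s.coords G m) :=
  map_calculus _ φ hφ (hD.source k) hG

theorem Scale.map_source_zero {B : Type*} [NormedCommRing B] [NormedAlgebra ℝ B] [NormOneClass B]
    [CompleteSpace B] (φ : Alg d →ₐ[ℝ] B) (hφ : ∀ f, ‖φ f‖ ≤ ‖f‖) (k : Fin N) :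
    φ (calculus (D.b k) (Alg d) (s.coords 0)) = calculus (D.b k) B fun m => φ (s.coords 0 m) :=
  map_calculus _ φ hφ (hD.source k) ((s.norm_coords_zero_le G).trans_lt hG)

/-- Stated for a general target, since it is applied to conjugation, to truncation and to evaluation
at a point. -/
theorem Scale.map_rhs {B : Type*} [NormedCommRing B] [NormedAlgebra ℝ B] [NormOneClass B]
    [CompleteSpace B] (φ : Alg d →ₐ[ℝ] B) (hφ : ∀ f, ‖φ f‖ ≤ ‖f‖) (k : Fin N) :
    φ (s.rhs G k) = (∑ j, ∑ l, ((D.ξ j * s.S) • ((calculus (D.a j k l) B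
      (fun m => φ (s.coords G m)) - calculus (D.a j k l) B 0) * φ (s.opθ (G l))) +
      (s.T / s.ρ) • (φ (Wiener.single 0 expTime) * calculus (D.a j k l) B
        (fun m => φ (s.coords G m)) * φ (s.opZ j (G l))))) +
      s.T • (calculus (D.b k) B (fun m => φ (s.coords G m)) -
        calculus (D.b k) B fun m => φ (s.coords 0 m)) := by
  simp only [Scale.rhs, map_add, map_sum, map_smul, map_mul, map_sub, s.map_coef hD hG φ hφ,
    s.map_coef_zero hD hG φ hφ, s.map_source hD hG φ hφ, s.map_source_zero hD hG φ hφ]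

theorem Scale.conjAlg_rhs (k : Fin N) :
    conjAlg d (s.rhs G k) = s.rhs (fun k => conjAlg d (G k)) k := by
  have hz : (fun m => conjAlg d (s.coords (0 : Fin N → Alg d) m)) = s.coords 0 := by
    funext m
    rw [s.conjAlg_coords]
    simp only [Pi.zero_apply, map_zero]
    rfl
  have he : conjAlg d (Wiener.single 0 expTime) = Wiener.single 0 expTime :=
    conjAlg_single (map_zero (Finsupp.domCongr (swapVar d))) (by
      ext τ
      exact Complex.conj_ofReal _)
  rw [s.map_rhs hD hG (conjAlg d) (fun f => (norm_conjAlg f).le), hz, he]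
  simp only [s.conjAlg_coords, s.conjAlg_opθ, s.conjAlg_opZ]
  rfl

/-- Uniqueness implies that the solution is invariant under conjugation. -/
theorem Scale.conjAlg_eq {G₀ : Fin N → Alg d} (h₀ : ∀ k, conjAlg d (G₀ k) = G₀ k)
    (hsol : G = G₀ + s.duhamel G) (hn : ‖G‖ ≤ 2 * ‖G₀‖)
    (huniq : ∀ G', G' = G₀ + s.duhamel G' → ‖G'‖ ≤ 2 * ‖G₀‖ → G' = G) (k : Fin N) :
    conjAlg d (G k) = G k := by
  refine congrFun (huniq (fun k => conjAlg d (G k)) ?_ ?_) k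
  · funext k
    conv_lhs => rw [hsol]
    simp only [Pi.add_apply, map_add, h₀, Scale.duhamel, map_sum, s.conjAlg_opJ,
      s.conjAlg_rhs hD hG]
  · refine (pi_norm_le_iff_of_nonneg ((norm_nonneg _).trans hn)).2 fun k => ?_
    rw [norm_conjAlg]
    exact (norm_le_pi_norm G k).trans hn

/-- The right hand side only contains monomials that are divisible by an exponential. -/
theorem Scale.coeff_rhs_eq_zero (k : Fin N) {i : Var d →₀ ℕ} (hi : wdeg i = 0) :
    Wiener.coeff i (s.rhs G k) = 0 := by
  have hT (f : Alg d) : Wiener.truncate wdeg (s.opT f) = 0 :=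
    Wiener.truncate_eq_zero.2 fun i hi => by
      rw [s.coeff_opT, Scale.winv, if_pos hi, Complex.ofReal_zero]
      exact zero_mul _
  have hθ (f : Alg d) : Wiener.truncate wdeg (s.opθ f) = 0 :=
    Wiener.truncate_eq_zero.2 fun i hi => by
      rw [s.coeff_opθ, Scale.winv, if_pos hi, Complex.ofReal_zero, mul_zero]
      exact zero_mul _
  have hZ (j : Fin d) (f : Alg d) : Wiener.truncate wdeg (s.opZ j f) = 0 :=
    Wiener.truncate_eq_zero.2 fun i hi => by
      have : wdeg (i + Finsupp.single (Sum.inl j) 1) = 0 := by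
        rw [map_add, hi, zero_add]
        simp [wdeg]
      rw [s.coeff_opZ, Scale.winv, if_pos this, mul_zero, Complex.ofReal_zero]
      exact zero_mul _
  -- Truncation kills the unknown, so the coordinates of `G` and of `0` have the same image and the
  -- increment of the source disappears. The other terms have a factor `opθ` or `opZ`, which is
  -- killed as well.
  have hc : (fun m => Wiener.truncate wdeg (s.coords G m)) =
      fun m => Wiener.truncate wdeg (s.coords 0 m) := by
    funext m
    rcases m with _ | j | k
    · rfl
    · rfl
    · exact (hT _).trans (hT _).symm
  refine Wiener.truncate_eq_zero.1 ?_ i hi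
  rw [s.map_rhs hD hG (Wiener.truncate wdeg) (Wiener.norm_truncate_le wdeg)]
  simp [hθ, hZ, hc]

end

end Conjugation

/-! ### Power series with coefficients depending on time -/

section Series

open Wiener

variable {σ : Type*} [Fintype σ]

/-- The partial derivative of a monomial. -/
noncomputable def pmonom (l : σ) (x : σ → ℂ) (i : σ →₀ ℕ) : ℂ :=
  i l * monom x (i - Finsupp.single l 1)

/-- Euler's identity. The truncated subtraction in `pmonom` is harmless: when `i l = 0` the
prefactor vanishes. -/
theorem mul_pmonom (l : σ) (x : σ → ℂ) (i : σ →₀ ℕ) : x l * pmonom l x i = i l * monom x i := by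
  classical
  by_cases hi : i l = 0
  · simp [pmonom, hi]
  · have h : i = (i - Finsupp.single l 1) + Finsupp.single l 1 := by
      refine (tsub_add_cancel_of_le ?_).symm
      rw [Finsupp.single_le_iff]
      omega
    have h1 : monom x (Finsupp.single l 1) = x l := by
      simp [monom, Finsupp.single_apply, Finset.prod_ite_eq]
    conv_rhs => rw [h, monom_add, h1, ← h]
    rw [pmonom]
    ring

theorem norm_pmonom_le {x : σ → ℂ} {q : ℝ} (hq : 0 ≤ q) (hx : ∀ l, ‖x l‖ ≤ q) (l : σ)
    (i : σ →₀ ℕ) : ‖pmonom l x i‖ ≤ (∑ m, i m : ℕ) * q ^ ((∑ m, i m) - 1) := by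
  classical
  by_cases hi : i l = 0
  · simp only [pmonom, hi, Nat.cast_zero, zero_mul, norm_zero]
    positivity
  · rw [pmonom, norm_mul, Complex.norm_natCast]
    have hsum : ∑ m, (i - Finsupp.single l 1 : σ →₀ ℕ) m = (∑ m, i m) - 1 := by
      have h : i = (i - Finsupp.single l 1) + Finsupp.single l 1 := by
        refine (tsub_add_cancel_of_le ?_).symm
        rw [Finsupp.single_le_iff]
        omega
      have h2 : ∑ m, i m = ∑ m, (i - Finsupp.single l 1 : σ →₀ ℕ) m + 1 := by
        conv_lhs => rw [h]
        simp only [Finsupp.add_apply, Finset.sum_add_distrib]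
        simp [Finsupp.single_apply]
      omega
    have h1 := norm_monom_le_pow hx (i - Finsupp.single l 1)
    rw [hsum] at h1
    have h2 : i l ≤ ∑ m, i m :=
      Finset.single_le_sum (fun m _ => Nat.zero_le (i m)) (Finset.mem_univ l)
    gcongr

theorem hasFDerivAt_monom (i : σ →₀ ℕ) (x : σ → ℂ) :
    HasFDerivAt (𝕜 := ℝ) (fun x : σ → ℂ => monom x i)
      (∑ l, pmonom l x i • (ContinuousLinearMap.proj l : (σ → ℂ) →L[ℝ] ℂ)) x := by
  classical
  have h1 (l : σ) : HasFDerivAt (𝕜 := ℝ) (fun x : σ → ℂ => x l ^ i l)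
      ((i l * x l ^ (i l - 1)) • (ContinuousLinearMap.proj l : (σ → ℂ) →L[ℝ] ℂ)) x := by
    have := ((ContinuousLinearMap.proj l : (σ → ℂ) →L[ℝ] ℂ).hasFDerivAt (x := x)).pow (i l)
    refine this.congr_fderiv ?_
    ext v
    simp
  have h2 := HasFDerivAt.finsetProd (u := Finset.univ) (g := fun l (x : σ → ℂ) => x l ^ i l) (fun l _ => h1 l)
  refine h2.congr_fderiv ?_
  refine Finset.sum_congr rfl fun l _ => ?_
  rw [smul_smul]
  congr 1
  rw [pmonom, monom, ← Finset.mul_prod_erase _ _ (Finset.mem_univ l)]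
  have : ∏ m ∈ Finset.univ.erase l, x m ^ (i - Finsupp.single l 1 : σ →₀ ℕ) m =
      ∏ m ∈ Finset.univ.erase l, x m ^ i m := by
    refine Finset.prod_congr rfl fun m hm => ?_
    have : m ≠ l := (Finset.mem_erase.1 hm).1
    simp [this.symm]
  rw [this]
  simp
  ring

/-- In a polydisc of radius `q < 1`, geometric decay pays for the factor lost in differentiating a
monomial, and for the factor allowed to the time derivatives. -/
theorem exists_natCast_mul_pow_le {q : ℝ} (hq0 : 0 ≤ q) (hq1 : q < 1) :
    ∃ C : ℝ, 0 ≤ C ∧ ∀ n : ℕ, (n : ℝ) * q ^ (n - 1) ≤ C ∧ (1 + n : ℝ) * q ^ n ≤ C := by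
  have h := (tendsto_self_mul_const_pow_of_lt_one hq0 hq1).add
    (tendsto_pow_atTop_nhds_zero_of_lt_one hq0 hq1)
  obtain ⟨C, hC⟩ := h.bddAbove_range
  have hC' (n : ℕ) : (1 + n : ℝ) * q ^ n ≤ C := by
    refine le_trans (le_of_eq ?_) (hC ⟨n, rfl⟩)
    ring
  have hC0 : 0 ≤ C := by
    have := hC' 0
    norm_num at this
    linarith
  refine ⟨C, hC0, fun n => ⟨?_, hC' n⟩⟩
  rcases n with _ | n
  · simpa using hC0
  · refine le_trans (le_of_eq ?_) (hC' n)
    push_cast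
    ring

/-- The derivative of a term of a power series with coefficients depending on time. -/
noncomputable def termDeriv (c c' : (σ →₀ ℕ) → ℝ → ℂ) (i : σ →₀ ℕ) (p : ℝ × (σ → ℂ)) :
    ℝ × (σ → ℂ) →L[ℝ] ℂ :=
  (ContinuousLinearMap.fst ℝ ℝ (σ → ℂ)).smulRight (c' i p.1 * monom p.2 i) +
    ∑ l, (c i p.1 * pmonom l p.2 i) •
      (ContinuousLinearMap.proj l : (σ → ℂ) →L[ℝ] ℂ).comp (ContinuousLinearMap.snd ℝ ℝ (σ → ℂ))

theorem termDeriv_apply (c c' : (σ →₀ ℕ) → ℝ → ℂ) (i : σ →₀ ℕ) (p v : ℝ × (σ → ℂ)) :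
    termDeriv c c' i p v = v.1 * (c' i p.1 * monom p.2 i) +
      ∑ l, v.2 l * (c i p.1 * pmonom l p.2 i) := by
  simp [termDeriv, mul_comm]

/-- The hypotheses of termwise differentiation. -/
structure DiffSeries (c c' : (σ →₀ ℕ) → ℝ → ℂ) (B : (σ →₀ ℕ) → ℝ) : Prop where
  deriv : ∀ i τ, HasDerivAt (c i) (c' i τ) τ
  cont : ∀ i, Continuous (c' i)
  summable : Summable B
  le : ∀ i τ, |τ| < 1 → ‖c i τ‖ ≤ B i
  le' : ∀ i τ, |τ| < 1 → ‖c' i τ‖ ≤ (1 + (∑ l, i l : ℕ)) * B i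

variable {c c' : (σ →₀ ℕ) → ℝ → ℂ} {B : (σ →₀ ℕ) → ℝ}

theorem hasFDerivAt_term (h : DiffSeries c c' B) (i : σ →₀ ℕ) (p : ℝ × (σ → ℂ)) :
    HasFDerivAt (fun p : ℝ × (σ → ℂ) => c i p.1 * monom p.2 i) (termDeriv c c' i p) p := by
  have h1 : HasFDerivAt (fun p : ℝ × (σ → ℂ) => c i p.1) _ p :=
    (h.deriv i p.1).hasFDerivAt.comp p hasFDerivAt_fst
  have h2 : HasFDerivAt (fun p : ℝ × (σ → ℂ) => monom p.2 i) _ p :=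
    (hasFDerivAt_monom i p.2).comp p hasFDerivAt_snd
  refine (h1.mul h2).congr_fderiv ?_
  ext v
  · simp [termDeriv]
    ring
  · simp [termDeriv, Finset.mul_sum, mul_assoc]

theorem norm_termDeriv_le (h : DiffSeries c c' B) {q C : ℝ} (hq0 : 0 ≤ q) (hC0 : 0 ≤ C)
    (hC : ∀ n : ℕ, (n : ℝ) * q ^ (n - 1) ≤ C ∧ (1 + n : ℝ) * q ^ n ≤ C) {p : ℝ × (σ → ℂ)}
    (hp1 : |p.1| < 1) (hp : ∀ l, ‖p.2 l‖ ≤ q) (i : σ →₀ ℕ) :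
    ‖termDeriv c c' i p‖ ≤ (C + Fintype.card σ * C) * B i := by
  have hB : 0 ≤ B i := (norm_nonneg _).trans (h.le i p.1 hp1)
  refine ContinuousLinearMap.opNorm_le_bound _ (by positivity) fun v => ?_
  rw [termDeriv_apply, add_mul, add_mul]
  refine norm_add_le_of_le ?_ ?_
  · rw [norm_mul, norm_mul, Complex.norm_real]
    have h1 := h.le' i p.1 hp1
    have h2 := norm_monom_le_pow hp i
    have h3 := (hC (∑ l, i l)).2
    have h4 : ‖v.1‖ ≤ ‖v‖ := norm_fst_le v
    calc ‖v.1‖ * (‖c' i p.1‖ * ‖monom p.2 i‖)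
        ≤ ‖v‖ * (((1 + (∑ l, i l : ℕ)) * B i) * q ^ (∑ l, i l)) := by gcongr
      _ = ((1 + (∑ l, i l : ℕ)) * q ^ (∑ l, i l)) * B i * ‖v‖ := by ring
      _ ≤ _ := by gcongr
  · calc ‖∑ l, v.2 l * (c i p.1 * pmonom l p.2 i)‖ ≤ ∑ _l : σ, C * B i * ‖v‖ := by
          refine norm_sum_le_of_le _ fun l _ => ?_
          rw [norm_mul, norm_mul]
          have h1 := h.le i p.1 hp1
          have h2 := (norm_pmonom_le hq0 hp l i).trans (hC _).1
          have h4 : ‖v.2 l‖ ≤ ‖v‖ := (norm_le_pi_norm v.2 l).trans (norm_snd_le v)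
          calc ‖v.2 l‖ * (‖c i p.1‖ * ‖pmonom l p.2 i‖) ≤ ‖v‖ * (B i * C) := by gcongr
            _ = _ := by ring
      _ = _ := by
          rw [Finset.sum_const, Finset.card_univ, nsmul_eq_mul]
          ring

/-- The sum of a power series with coefficients depending on time. -/
noncomputable def seriesSum (c : (σ →₀ ℕ) → ℝ → ℂ) (p : ℝ × (σ → ℂ)) : ℂ :=
  ∑' i, c i p.1 * monom p.2 i

/-- The domain of termwise differentiation. -/
def seriesDomain (σ : Type*) [Fintype σ] (q : ℝ) : Set (ℝ × (σ → ℂ)) :=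
  -- Negative times are included so that `t = 0` becomes an interior point, where the one-sided
  -- derivatives of the Cauchy problem are ordinary ones.
  Set.Ioo (-1) 1 ×ˢ Metric.ball 0 q

theorem isOpen_seriesDomain (q : ℝ) : IsOpen (seriesDomain σ q) :=
  isOpen_Ioo.prod Metric.isOpen_ball

theorem mem_seriesDomain {q : ℝ} {p : ℝ × (σ → ℂ)} (hp : p ∈ seriesDomain σ q) :
    |p.1| < 1 ∧ ∀ l, ‖p.2 l‖ ≤ q := by
  refine ⟨abs_lt.2 hp.1, fun l => ?_⟩
  exact (norm_le_pi_norm _ _).trans (mem_ball_zero_iff.1 hp.2).le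

theorem hasFDerivAt_seriesSum (h : DiffSeries c c' B) {q : ℝ} (hq0 : 0 < q) (hq1 : q < 1)
    {p : ℝ × (σ → ℂ)} (hp : p ∈ seriesDomain σ q) :
    HasFDerivAt (seriesSum c) (∑' i, termDeriv c c' i p) p := by
  obtain ⟨C, hC0, hC⟩ := exists_natCast_mul_pow_le hq0.le hq1
  refine hasFDerivAt_tsum_of_isPreconnected
    (h.summable.mul_left (C + Fintype.card σ * C)) (isOpen_seriesDomain q)
    ((convex_Ioo _ _).prod (convex_ball _ _)).isPreconnected
    (fun i p _ => hasFDerivAt_term h i p)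
    (fun i p hp => norm_termDeriv_le h hq0.le hC0 hC (mem_seriesDomain hp).1
      (mem_seriesDomain hp).2 i) hp ?_ hp
  refine Summable.of_norm (h.summable.of_nonneg_of_le (fun _ => norm_nonneg _) fun i => ?_)
  rw [norm_mul]
  exact (mul_le_of_le_one_right (norm_nonneg _) (norm_monom_le_one (fun l =>
    ((mem_seriesDomain hp).2 l).trans hq1.le) i)).trans (h.le i _ (mem_seriesDomain hp).1)

theorem summable_termDeriv (h : DiffSeries c c' B) {q : ℝ} (hq0 : 0 < q) (hq1 : q < 1)
    {p : ℝ × (σ → ℂ)} (hp : p ∈ seriesDomain σ q) : Summable fun i => termDeriv c c' i p := by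
  obtain ⟨C, hC0, hC⟩ := exists_natCast_mul_pow_le hq0.le hq1
  exact Summable.of_norm ((h.summable.mul_left _).of_nonneg_of_le (fun _ => norm_nonneg _)
    fun i => norm_termDeriv_le h hq0.le hC0 hC (mem_seriesDomain hp).1 (mem_seriesDomain hp).2 i)

theorem contDiffOn_seriesSum (h : DiffSeries c c' B) {q : ℝ} (hq0 : 0 < q) (hq1 : q < 1) :
    ContDiffOn ℝ 1 (seriesSum c) (seriesDomain σ q) := by
  obtain ⟨C, hC0, hC⟩ := exists_natCast_mul_pow_le hq0.le hq1
  rw [← zero_add (1 : WithTop ℕ∞), contDiffOn_succ_iff_fderiv_of_isOpen (isOpen_seriesDomain q)]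
  refine ⟨fun p hp => (hasFDerivAt_seriesSum h hq0 hq1 hp).differentiableAt.differentiableWithinAt,
    by simp, ?_⟩
  rw [contDiffOn_zero]
  refine ContinuousOn.congr (f := fun p => ∑' i, termDeriv c c' i p) ?_
    fun p hp => (hasFDerivAt_seriesSum h hq0 hq1 hp).fderiv
  refine continuousOn_tsum (fun i => Continuous.continuousOn ?_)
    (h.summable.mul_left (C + Fintype.card σ * C))
    fun i p hp => norm_termDeriv_le h hq0.le hC0 hC (mem_seriesDomain hp).1 (mem_seriesDomain hp).2 i
  have h1 : Continuous (c i) := continuous_iff_continuousAt.2 fun τ => (h.deriv i τ).continuousAt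
  have h2 := h.cont i
  have h3 : ∀ j : σ →₀ ℕ, Continuous fun x : σ → ℂ => monom x j := fun j => by
    unfold monom
    fun_prop
  have h4 : ∀ l, Continuous fun x : σ → ℂ => pmonom l x i := fun l => by
    unfold pmonom
    exact continuous_const.mul (h3 _)
  unfold termDeriv
  refine Continuous.add ?_ (continuous_finsetSum _ fun l _ => ?_)
  · exact ((ContinuousLinearMap.smulRightL ℝ (ℝ × (σ → ℂ)) ℂ
      (ContinuousLinearMap.fst ℝ ℝ (σ → ℂ))).continuous).comp
        ((h2.comp continuous_fst).mul ((h3 i).comp continuous_snd))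
  · exact ((h1.comp continuous_fst).mul ((h4 l).comp continuous_snd)).smul continuous_const

end Series

/-! ### Evaluation at the points of the physical space -/

section Evaluation

open Wiener ComplexConjugate

variable {d : ℕ}

/-- Evaluation of an element of the algebra. -/
noncomputable def evalAt (τ : unitInterval) (X : Var d → ℂ) (hX : ∀ l, ‖X l‖ ≤ 1) :
    Alg d →ₐ[ℝ] ℂ :=
  Wiener.eval (ContinuousMap.evalAlgHom ℝ ℂ τ) (fun f => f.norm_coe_le_norm τ) X hX

variable (τ : unitInterval) (X : Var d → ℂ) (hX : ∀ l, ‖X l‖ ≤ 1)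

theorem norm_evalAt_le (f : Alg d) : ‖evalAt τ X hX f‖ ≤ ‖f‖ := norm_eval_le _ _ _ _ _

theorem hasSum_evalAt (f : Alg d) :
    HasSum (fun i => coeff i f τ * monom X i) (evalAt τ X hX f) :=
  (summable_eval (ContinuousMap.evalAlgHom ℝ ℂ τ) (fun f => f.norm_coe_le_norm τ) hX f
    ).of_norm.hasSum

theorem evalAt_single (i : Var d →₀ ℕ) (f : TimeFun) :
    evalAt τ X hX (single i f) = f τ * monom X i := eval_single _ _ _ _ _ _

/-- The exchange of the two exponentials, as a permutation of the monomials. -/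
noncomputable def swapEquiv (d : ℕ) : (Var d →₀ ℕ) ≃ (Var d →₀ ℕ) :=
  ⟨swapIdx, swapIdx, swapIdx_swapIdx, swapIdx_swapIdx⟩

theorem monom_swapIdx (X : Var d → ℂ) (i : Var d →₀ ℕ) :
    monom X (swapIdx i) = monom (fun l => X (swapVar d l)) i := by
  simp only [monom, Fintype.prod_sum_type, Fintype.prod_bool, swapIdx_apply_inl,
    swapIdx_apply_inr, swapVar, Equiv.sumCongr_apply, Sum.map_inl, Sum.map_inr,
    Equiv.refl_apply, Equiv.boolNot_apply, Bool.not_true, Bool.not_false]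
  ring

/-- Conjugating the series term by term amounts to reindexing it by the exchange of the two
exponentials, which does not change its sum. -/
theorem conj_evalAt {f : Alg d} (hf : conjAlg d f = f)
    (hc : ∀ l, conj (X l) = X (swapVar d l)) : conj (evalAt τ X hX f) = evalAt τ X hX f := by
  have h1 := Complex.hasSum_conj'.2 (hasSum_evalAt τ X hX f)
  have h2 := (swapEquiv d).hasSum_iff.2 (hasSum_evalAt τ X hX f)
  refine h1.unique ?_
  have h3 : (fun i => conj (coeff i f τ * monom X i)) =
      (fun i => coeff i f τ * monom X i) ∘ swapEquiv d := by
    funext i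
    have h4 : coeff (swapIdx i) f = conjTime (coeff i f) := by
      conv_lhs => rw [← hf]
      rw [coeff_conjAlg, swapIdx_swapIdx]
    have h5 : conj (monom X i) = monom X (swapIdx i) := by
      rw [monom_swapIdx, monom, map_prod, monom]
      simp only [map_pow, hc]
    change conj (coeff i f τ * monom X i) = coeff (swapIdx i) f τ * monom X (swapIdx i)
    rw [map_mul, h5, h4, conjTime_apply]
  rw [h3]
  exact h2

end Evaluation

/-! ### Evolution of the coefficients -/

section Evolution

open Wiener

variable {d N : ℕ} {D : Symbol d N} (s : Scale D)

/-- The solutions of the constant coefficient system. -/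
def Scale.IsFree (G₀ : Fin N → Alg d) : Prop :=
  ∀ i, wdeg i ≠ 0 → ∃ y : ℝ → Fin N → ℂ,
    (∀ k (τ : unitInterval), s.winv i * coeff i (G₀ k) τ = y τ k) ∧
      ∀ τ, HasDerivAt y (s.gen i (y τ)) τ

/-- The time derivative of the coefficients. -/
noncomputable def Scale.velocity (G : Fin N → Alg d) (k : Fin N) (i : Var d →₀ ℕ) : TimeFun :=
  (-s.rate i) • coeff i (s.opT (G k)) + (s.S * freq i) • (ContinuousMap.const _ Complex.I *
    ∑ l, D.A₀ k l • coeff i (s.opT (G l))) + coeff i (s.rhs G k)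

/-- The coefficients, extended to all times. -/
noncomputable def Scale.profile (G : Fin N → Alg d) (k : Fin N) (i : Var d →₀ ℕ) (τ : ℝ) : ℂ :=
  coeff i (s.opT (G k)) 0 + ∫ σ in (0 : ℝ)..τ, (s.velocity G k i).extend σ

theorem Scale.velocity_apply (G : Fin N → Alg d) (k : Fin N) (i : Var d →₀ ℕ) (τ : unitInterval) :
    s.velocity G k i τ = s.gen i (fun l => coeff i (s.opT (G l)) τ) k + coeff i (s.rhs G k) τ := by
  rw [s.gen_apply]
  simp [Scale.velocity]
  ring

theorem Scale.hasDerivAt_profile (G : Fin N → Alg d) (k : Fin N) (i : Var d →₀ ℕ) (τ : ℝ) :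
    HasDerivAt (s.profile G k i) ((s.velocity G k i).extend τ) τ := by
  have hc := (s.velocity G k i).continuous_extend
  exact (intervalIntegral.integral_hasDerivAt_right (hc.intervalIntegrable _ _)
    hc.stronglyMeasurable.stronglyMeasurableAtFilter hc.continuousAt).const_add _

theorem coeff_opT_of_wdeg_eq_zero (f : Alg d) {i : Var d →₀ ℕ} (hi : wdeg i = 0) :
    coeff i (s.opT f) = 0 := by
  rw [s.coeff_opT, Scale.winv, if_pos hi, Complex.ofReal_zero]
  exact zero_mul _

theorem Scale.winv_mul_weight {i : Var d →₀ ℕ} (hi : wdeg i ≠ 0) : s.winv i * s.weight i = 1 := by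
  rw [Scale.winv, if_neg hi, inv_mul_cancel₀ (s.weight_pos hi).ne']

/-- After division by the weight, the fixed point equation reads: free solution plus convolution
with the propagator. By Duhamel's formula its derivative is the velocity, and the profile is a
primitive of the velocity with the same initial value. On monomials without exponential both sides
vanish. -/
theorem Scale.profile_eq {a : NNReal} (hD : D.RadiusBound a) {G G₀ : Fin N → Alg d}
    (hG : ‖s.coords G‖ < a / (Fintype.card (Coord d N) + 1)) (h₀ : s.IsFree G₀)
    (hsol : G = G₀ + s.duhamel G) (k : Fin N) (i : Var d →₀ ℕ) (τ : unitInterval) :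
    s.profile G k i τ = coeff i (s.opT (G k)) τ := by
  by_cases hi : wdeg i = 0
  · have h1 : s.velocity G k i = 0 := by
      refine ContinuousMap.ext fun σ => ?_
      rw [s.velocity_apply, s.coeff_rhs_eq_zero hD hG k hi]
      simp only [coeff_opT_of_wdeg_eq_zero s _ hi, ContinuousMap.zero_apply, add_zero]
      exact congrFun (map_zero (s.gen i)) k
    rw [Scale.profile, h1, coeff_opT_of_wdeg_eq_zero s _ hi]
    have : ∀ σ, TimeFun.extend 0 σ = 0 := fun σ => rfl
    simp [this]
  · obtain ⟨y, hy, hy'⟩ := h₀ i hi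
    set f : Fin N → TimeFun := fun l => coeff i (s.rhs G l) with hf
    set Y : ℝ → Fin N → ℂ :=
      fun r k => y r k + ∑ l, volterraFun (expEntry (s.gen i) k l) (f l) r with hY
    have hYG (k : Fin N) (τ : unitInterval) : coeff i (s.opT (G k)) τ = Y τ k := by
      have hw : (s.winv i : ℂ) * s.weight i = 1 := by exact_mod_cast s.winv_mul_weight hi
      have h1 : coeff i (G k) τ = coeff i (G₀ k) τ +
          s.weight i * ∑ l, volterraFun (expEntry (s.gen i) k l) (f l) τ := by
        conv_lhs => rw [hsol]
        simp only [Pi.add_apply, map_add, Scale.duhamel, map_sum, s.coeff_opJ k _ _ hi,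
          ContinuousMap.add_apply, ContinuousMap.sum_apply, ContinuousMap.smul_apply,
          volterra_apply, Complex.real_smul, Finset.mul_sum, hf]
      rw [s.coeff_opT, ContinuousMap.mul_apply, ContinuousMap.const_apply, h1, mul_add, ← mul_assoc,
        hw, one_mul, hy]
    have hYd (r : ℝ) : HasDerivAt (fun r => Y r k) (s.gen i (Y r) k + (f k).extend r) r := by
      have h1 := (hasDerivAt_pi.1 (hy' r) k).add (hasDerivAt_sum_volterraFun (s.gen i) f k r)
      refine h1.congr_deriv ?_
      have : Y r = y r + fun k' => ∑ l, volterraFun (expEntry (s.gen i) k' l) (f l) r := rfl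
      rw [this, map_add, Pi.add_apply, add_assoc]
    have hvel : ∀ r ∈ Set.uIcc (0 : ℝ) τ,
        HasDerivAt (fun r => Y r k) ((s.velocity G k i).extend r) r := by
      intro r hr
      rw [Set.uIcc_of_le τ.2.1] at hr
      refine (hYd r).congr_deriv ?_
      have hr' : r ∈ unitInterval := ⟨hr.1, hr.2.trans τ.2.2⟩
      have h1 := (s.velocity G k i).extend_of_mem ⟨r, hr'⟩
      have h2 := (f k).extend_of_mem ⟨r, hr'⟩
      simp only at h1 h2
      rw [h1, h2, s.velocity_apply]
      simp only [hYG]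
      rfl
    rw [Scale.profile, intervalIntegral.integral_eq_sub_of_hasDerivAt hvel
      ((s.velocity G k i).continuous_extend.intervalIntegrable _ _), hYG, hYG]
    simp

/-- The factors `rate` and `freq` are controlled by the weight by which `opT` divides, since `rate ≤
Γ · weight` and `|freq| ≤ weight`. So the time derivatives of the coefficients are still summable,
as is required for a `C¹` wave. -/
theorem Scale.norm_velocity_le (G : Fin N → Alg d) (k : Fin N) (i : Var d →₀ ℕ) :
    ‖s.velocity G k i‖ ≤ s.Γ * ‖coeff i (G k)‖ + s.S * ∑ l, |D.A₀ k l| * ‖coeff i (G l)‖ +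
      ‖coeff i (s.rhs G k)‖ := by
  have hΓ : 1 ≤ s.Γ := by
    have := s.gap
    have := mul_nonneg D.c_nonneg s.S_pos.le
    linarith
  have hT (f : Alg d) : ‖coeff i (s.opT f)‖ ≤ s.winv i * ‖coeff i f‖ := by
    rw [s.coeff_opT]
    refine (norm_mul_le _ _).trans (mul_le_mul_of_nonneg_right ?_ (norm_nonneg _))
    refine (ContinuousMap.norm_le _ (s.winv_nonneg i)).2 fun _ => ?_
    rw [ContinuousMap.const_apply, Complex.norm_real, Real.norm_of_nonneg (s.winv_nonneg i)]
  have hz : (0 : ℝ) ≤ zdeg i := Nat.cast_nonneg _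
  have hw : (0 : ℝ) ≤ wdeg i := Nat.cast_nonneg _
  have hr0 : 0 ≤ s.rate i := by
    rw [Scale.rate]
    positivity
  have hr : s.rate i * s.winv i ≤ s.Γ := by
    refine s.mul_winv_le (by linarith) ?_
    have := s.gap
    rw [Scale.rate, Scale.weight, mul_add]
    have h1 : (wdeg i : ℝ) ≤ (s.Γ - D.c * s.S) * wdeg i := by nlinarith
    nlinarith
  have hf : |freq i| * s.winv i ≤ 1 :=
    s.mul_winv_le zero_le_one (by rw [one_mul]; exact (abs_freq_le i).trans (s.wdeg_le_weight i))
  refine norm_add_le_of_le (norm_add_le_of_le ?_ ?_) le_rfl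
  · rw [norm_smul, norm_neg, Real.norm_of_nonneg hr0]
    calc _ ≤ s.rate i * (s.winv i * ‖coeff i (G k)‖) := mul_le_mul_of_nonneg_left (hT _) hr0
      _ = s.rate i * s.winv i * ‖coeff i (G k)‖ := by ring
      _ ≤ _ := by gcongr
  · rw [norm_smul, norm_mul, Real.norm_of_nonneg s.S_pos.le, Real.norm_eq_abs, mul_assoc]
    refine mul_le_mul_of_nonneg_left ?_ s.S_pos.le
    have h1 : ‖(ContinuousMap.const _ Complex.I : TimeFun)‖ ≤ 1 :=
      (ContinuousMap.norm_le _ zero_le_one).2 fun _ => by simp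
    calc |freq i| * ‖ContinuousMap.const _ Complex.I * ∑ l, D.A₀ k l • coeff i (s.opT (G l))‖
        ≤ |freq i| * (1 * ∑ l, |D.A₀ k l| * (s.winv i * ‖coeff i (G l)‖)) := by
          refine mul_le_mul_of_nonneg_left ((norm_mul_le _ _).trans ?_) (abs_nonneg _)
          refine mul_le_mul h1 (norm_sum_le_of_le _ fun l _ => ?_) (norm_nonneg _) zero_le_one
          rw [norm_smul, Real.norm_eq_abs]
          exact mul_le_mul_of_nonneg_left (hT _) (abs_nonneg _)
      _ = ∑ l, (|freq i| * s.winv i) * (|D.A₀ k l| * ‖coeff i (G l)‖) := by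
          rw [one_mul, Finset.mul_sum]
          exact Finset.sum_congr rfl fun l _ => by ring
      _ ≤ ∑ l, 1 * (|D.A₀ k l| * ‖coeff i (G l)‖) := by
          gcongr
      _ = _ := by simp

theorem Scale.diffSeries (G : Fin N → Alg d) (k : Fin N) :
    DiffSeries (s.profile G k) (fun i => (s.velocity G k i).extend)
      (fun i => ‖coeff i (G k)‖ + (s.Γ * ‖coeff i (G k)‖ +
        s.S * ∑ l, |D.A₀ k l| * ‖coeff i (G l)‖ + ‖coeff i (s.rhs G k)‖)) where
  deriv i τ := s.hasDerivAt_profile G k i τ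
  cont i := (s.velocity G k i).continuous_extend
  summable := by
    have h (f : Alg d) := summable_norm_coeff f
    exact (h _).add ((((h _).mul_left _).add
      ((summable_sum fun l _ => (h (G l)).mul_left _).mul_left _)).add (h _))
  le i τ hτ := by
    refine norm_add_le_of_le ?_ ?_
    · refine (ContinuousMap.norm_coe_le_norm _ _).trans ?_
      rw [s.coeff_opT]
      refine (norm_mul_le _ _).trans (mul_le_of_le_one_left (norm_nonneg _) ?_)
      refine (ContinuousMap.norm_le _ zero_le_one).2 fun _ => ?_
      rw [ContinuousMap.const_apply, Complex.norm_real, Real.norm_of_nonneg (s.winv_nonneg i)]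
      exact s.winv_le_one i
    · refine (intervalIntegral.norm_integral_le_of_norm_le_const
        fun σ _ => (TimeFun.norm_extend_le _ σ).trans (s.norm_velocity_le G k i)).trans ?_
      rw [sub_zero]
      exact mul_le_of_le_one_right ((norm_nonneg _).trans (s.norm_velocity_le G k i)) hτ.le
  le' i τ _ := by
    refine ((TimeFun.norm_extend_le _ τ).trans (s.norm_velocity_le G k i)).trans ?_
    have h0 := (norm_nonneg _).trans (s.norm_velocity_le G k i)
    have h1 := norm_nonneg (coeff i (G k))
    refine (le_add_of_nonneg_left h1).trans (le_mul_of_one_le_left (by linarith) ?_)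
    linarith [(Nat.cast_nonneg (∑ l, i l) : (0 : ℝ) ≤ _)]

end Evolution

/-! ### Waves in the physical space, and their derivatives -/

section Waves

open Wiener ComplexConjugate

variable {d N : ℕ} {D : Symbol d N} (s : Scale D)

/-- The phase of the oscillations. -/
noncomputable def Scale.angle (z : Pos d) : ℝ := s.S / s.T * ∑ j, D.ξ j * z j

/-- The sign of a frequency. -/
def sgn (b : Bool) : ℝ := bif b then 1 else -1

/-- The values of the variables of the power series at a point of the physical space. -/
noncomputable def Scale.point (x₀ : Pos d) (p : ℝ × Pos d) : Var d → ℂ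
  | Sum.inl j => (((p.2 j - x₀ j) / s.ρ * Real.exp (p.1 / s.T) : ℝ) : ℂ)
  -- The shift by `-1` keeps the modulus at most one up to `t = T`; a factor `exp Γ` in the
  -- coefficients of the modes compensates for it.
  | Sum.inr b => Complex.exp ((s.Γ * (p.1 / s.T - 1) : ℝ) +
      (sgn b * s.angle (p.2 - x₀) : ℝ) * Complex.I)

theorem Scale.norm_point_inr (x₀ : Pos d) (p : ℝ × Pos d) (b : Bool) :
    ‖s.point x₀ p (Sum.inr b)‖ = Real.exp (s.Γ * (p.1 / s.T - 1)) := by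
  simp [Scale.point, Complex.norm_exp]

theorem Scale.conj_point (x₀ : Pos d) (p : ℝ × Pos d) (l : Var d) :
    conj (s.point x₀ p l) = s.point x₀ p (swapVar d l) := by
  rcases l with j | b
  · exact Complex.conj_ofReal _
  · have h : sgn (!b) = -sgn b := by cases b <;> simp [sgn]
    simp [Scale.point, swapVar, ← Complex.exp_conj, h]

theorem Scale.contDiff_point (x₀ : Pos d) : ContDiff ℝ ∞ (s.point x₀) := by
  have hx (j : Fin d) : ContDiff ℝ ∞ fun p : ℝ × Pos d => p.2 j :=
    (EuclideanSpace.proj j : Pos d →L[ℝ] ℝ).contDiff.comp contDiff_snd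
  have hof : ContDiff ℝ ∞ (fun r : ℝ => (r : ℂ)) := Complex.ofRealCLM.contDiff
  have ht : ContDiff ℝ ∞ fun p : ℝ × Pos d => p.1 / s.T := contDiff_fst.div_const _
  have hθ : ContDiff ℝ ∞ fun p : ℝ × Pos d => s.angle (p.2 - x₀) :=
    contDiff_const.mul (ContDiff.sum fun j _ => contDiff_const.mul ((hx j).sub contDiff_const))
  refine contDiff_pi.2 ?_
  rintro (j | b)
  · exact hof.comp ((((hx j).sub contDiff_const).div_const _).mul ht.exp)
  · exact ((hof.comp (contDiff_const.mul (ht.sub contDiff_const))).add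
      ((hof.comp (contDiff_const.mul hθ)).mul contDiff_const)).cexp

/-- The directional derivative of the variables of the power series. -/
noncomputable def Scale.pointDeriv (x₀ : Pos d) (p v : ℝ × Pos d) : Var d → ℂ
  | Sum.inl j => (v.1 / s.T : ℝ) * s.point x₀ p (Sum.inl j) +
      ((v.2 j * (Real.exp (p.1 / s.T) / s.ρ) : ℝ) : ℂ)
  | Sum.inr b => s.point x₀ p (Sum.inr b) * ((v.1 / s.T * s.Γ : ℝ) +
      (sgn b * s.angle v.2 : ℝ) * Complex.I)

/-- In the time direction every variable is multiplied by its own rate, `1 / T` or `Γ / T`, up to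
the increment of time. For a monomial these rates add up to `rate i / T`, which cancels the damping
in the generator. -/
theorem Scale.hasDerivAt_point (x₀ : Pos d) (p v : ℝ × Pos d) :
    HasDerivAt (fun h : ℝ => s.point x₀ (p + h • v)) (s.pointDeriv x₀ p v) 0 := by
  have ht : HasDerivAt (fun h : ℝ => (p.1 + h * v.1) / s.T) (v.1 / s.T) 0 := by
    simpa using (((hasDerivAt_id (0 : ℝ)).mul_const v.1).const_add p.1).div_const s.T
  have hx (j : Fin d) : HasDerivAt (fun h : ℝ => p.2 j + h * v.2 j - x₀ j) (v.2 j) 0 := by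
    simpa using (((hasDerivAt_id (0 : ℝ)).mul_const (v.2 j)).const_add (p.2 j)).sub_const (x₀ j)
  refine hasDerivAt_pi.2 ?_
  rintro (j | b)
  · refine (((hx j).div_const s.ρ).mul ht.exp).ofReal_comp.congr_deriv ?_
    simp only [Scale.pointDeriv, Scale.point, zero_mul, add_zero]
    push_cast
    ring
  · have hθ : HasDerivAt (fun h : ℝ => s.angle (p.2 + h • v.2 - x₀)) (s.angle v.2) 0 := by
      refine (HasDerivAt.fun_sum fun j _ => (hx j).const_mul (D.ξ j)).const_mul (s.S / s.T)
    have h1 := (((ht.sub_const 1).const_mul s.Γ).ofReal_comp.add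
      ((hθ.const_mul (sgn b)).ofReal_comp.mul_const Complex.I)).cexp
    refine h1.congr_deriv ?_
    simp only [Scale.pointDeriv, Scale.point, Pi.add_apply, zero_mul, add_zero, zero_smul]
    push_cast
    ring

/-- A component of the oscillating wave with given coefficients. -/
noncomputable def Scale.wave (x₀ : Pos d) (G : Fin N → Alg d) (k : Fin N) (p : ℝ × Pos d) : ℂ :=
  seriesSum (s.profile G k) (p.1 / s.T, s.point x₀ p)

/-- The real oscillating wave with given coefficients. -/
noncomputable def Scale.field (x₀ : Pos d) (G : Fin N → Alg d) (p : ℝ × Pos d) : Val N :=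
  WithLp.toLp 2 fun k => (s.wave x₀ G k p).re

/-- The domain of definition of the oscillating waves. -/
def Scale.domain (x₀ : Pos d) (q : ℝ) : Set (ℝ × Pos d) :=
  (fun p => (p.1 / s.T, s.point x₀ p)) ⁻¹' seriesDomain (Var d) q

theorem Scale.contDiff_domain (x₀ : Pos d) :
    ContDiff ℝ ∞ fun p : ℝ × Pos d => (p.1 / s.T, s.point x₀ p) :=
  (contDiff_fst.div_const _).prodMk (s.contDiff_point x₀)

theorem Scale.isOpen_domain (x₀ : Pos d) (q : ℝ) : IsOpen (s.domain x₀ q) :=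
  (isOpen_seriesDomain q).preimage (s.contDiff_domain x₀).continuous

variable {q : ℝ} (hq0 : 0 < q) (hq1 : q < 1)
include hq0 hq1

theorem Scale.contDiffOn_wave (x₀ : Pos d) (G : Fin N → Alg d) (k : Fin N) :
    ContDiffOn ℝ 1 (s.wave x₀ G k) (s.domain x₀ q) :=
  (contDiffOn_seriesSum (s.diffSeries G k) hq0 hq1).comp
    ((s.contDiff_domain x₀).of_le (mod_cast le_top)).contDiffOn (Set.mapsTo_preimage _ _)

theorem Scale.contDiffOn_field (x₀ : Pos d) (G : Fin N → Alg d) :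
    ContDiffOn ℝ 1 (s.field x₀ G) (s.domain x₀ q) :=
  contDiffOn_euclidean.2 fun k =>
    Complex.reCLM.contDiff.comp_contDiffOn (s.contDiffOn_wave hq0 hq1 x₀ G k)

omit hq0 in
theorem Scale.norm_point_le_one {x₀ : Pos d} {p : ℝ × Pos d} (hp : p ∈ s.domain x₀ q)
    (l : Var d) : ‖s.point x₀ p l‖ ≤ 1 :=
  ((mem_seriesDomain hp).2 l).trans hq1.le

omit hq0 hq1 in
theorem Scale.time_mem {x₀ : Pos d} {p : ℝ × Pos d} (hp : p ∈ s.domain x₀ q) (h0 : 0 ≤ p.1) :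
    p.1 / s.T ∈ unitInterval :=
  ⟨div_nonneg h0 s.T_pos.le, (abs_lt.1 (mem_seriesDomain hp).1).2.le⟩

variable {a : NNReal} (hD : D.RadiusBound a) {G G₀ : Fin N → Alg d}
  (hG : ‖s.coords G‖ < a / (Fintype.card (Coord d N) + 1)) (h₀ : s.IsFree G₀)
  (hsol : G = G₀ + s.duhamel G) {x₀ : Pos d} {p : ℝ × Pos d} (hp : p ∈ s.domain x₀ q)
  (h0 : 0 ≤ p.1)
include hD hG h₀ hsol

omit hq0 in
-- The wave is built from profiles extended to negative times, so as to be differentiable; at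
-- nonnegative times it is the image of `opT (G k)` under an algebra morphism.
theorem Scale.wave_eq (k : Fin N) : s.wave x₀ G k p =
    evalAt ⟨p.1 / s.T, s.time_mem hp h0⟩ (s.point x₀ p) (s.norm_point_le_one hq1 hp)
      (s.opT (G k)) := by
  refine Eq.trans (tsum_congr fun i => ?_) (hasSum_evalAt _ _ _ _).tsum_eq
  rw [← s.profile_eq hD hG h₀ hsol k i ⟨p.1 / s.T, s.time_mem hp h0⟩]

omit hq0 hq1 hD hG h₀ hsol in
-- Shift of the index by one in the `j`-th position; the indices outside the range of the shift have
-- exponent zero there, hence zero derivative.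
theorem Scale.hasSum_opZ (j : Fin d) (f : Alg d) (τ : unitInterval) (X : Var d → ℂ)
    (hX : ∀ l, ‖X l‖ ≤ 1) : HasSum (fun i => coeff i (s.opT f) τ * pmonom (Sum.inl j) X i)
      (evalAt τ X hX (s.opZ j f)) := by
  have hinj : Function.Injective fun i : Var d →₀ ℕ => i + Finsupp.single (Sum.inl j) 1 :=
    add_left_injective _
  refine (hinj.hasSum_iff fun i hi => ?_).1 ?_
  · have : i (Sum.inl j) = 0 := by
      by_contra h
      refine hi ⟨i - Finsupp.single (Sum.inl j) 1, tsub_add_cancel_of_le ?_⟩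
      rw [Finsupp.single_le_iff]
      omega
    simp [pmonom, this]
  · convert hasSum_evalAt τ X hX (s.opZ j f) using 1
    funext i
    simp only [Function.comp_apply, s.coeff_opZ, s.coeff_opT, pmonom, add_tsub_cancel_right,
      Finsupp.add_apply, Finsupp.single_eq_same, ContinuousMap.mul_apply,
      ContinuousMap.const_apply]
    push_cast
    ring

/-- Termwise differentiation along a line. In time, the growth of the variables cancels the term
`-rate` of the velocity, which leaves the frozen system applied to the phase derivative, plus the
right hand side. -/
theorem Scale.fderiv_wave (k : Fin N) (v : ℝ × Pos d) (E : Alg d →ₐ[ℝ] ℂ)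
    (hE : E = evalAt ⟨p.1 / s.T, s.time_mem hp h0⟩ (s.point x₀ p) (s.norm_point_le_one hq1 hp)) :
    fderiv ℝ (s.wave x₀ G k) p v =
      (v.1 / s.T : ℝ) * (s.S * ∑ l, D.A₀ k l * E (s.opθ (G l)) + E (s.rhs G k)) +
      (∑ j, (v.2 j * (Real.exp (p.1 / s.T) / s.ρ) : ℝ) * E (s.opZ j (G k)) +
        (s.angle v.2 : ℝ) * E (s.opθ (G k))) := by
  set τ : unitInterval := ⟨p.1 / s.T, s.time_mem hp h0⟩ with hτ
  set X := s.point x₀ p with hX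
  have hdiff : DifferentiableAt ℝ (s.wave x₀ G k) p :=
    (((s.contDiffOn_wave hq0 hq1 x₀ G k).contDiffAt ((s.isOpen_domain x₀ q).mem_nhds hp)
      ).differentiableAt one_ne_zero)
  have h1 := hdiff.hasFDerivAt.hasLineDerivAt v
  have hline : HasDerivAt (fun h : ℝ => ((p.1 + h * v.1) / s.T, s.point x₀ (p + h • v)))
      (v.1 / s.T, s.pointDeriv x₀ p v) 0 := by
    refine HasDerivAt.prodMk ?_ (s.hasDerivAt_point x₀ p v)
    simpa using (((hasDerivAt_id (0 : ℝ)).mul_const v.1).const_add p.1).div_const s.T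
  have h2 : HasDerivAt (fun h : ℝ => s.wave x₀ G k (p + h • v))
      ((∑' i, termDeriv (s.profile G k) (fun i => (s.velocity G k i).extend) i (p.1 / s.T, X))
        (v.1 / s.T, s.pointDeriv x₀ p v)) 0 := by
    refine HasFDerivAt.comp_hasDerivAt_of_eq 0
      (hasFDerivAt_seriesSum (s.diffSeries G k) hq0 hq1 hp) hline ?_
    simp [hX]
  rw [HasDerivAt.unique h1 h2]
  have h3 := (summable_termDeriv (s.diffSeries G k) hq0 hq1 hp).hasSum.mapL
    (ContinuousLinearMap.apply ℝ ℂ ((v.1 / s.T, s.pointDeriv x₀ p v) : ℝ × (Var d → ℂ)))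
  simp only [ContinuousLinearMap.apply_apply] at h3
  refine h3.unique ?_
  have hEs (f : Alg d) : HasSum (fun i => coeff i f τ * monom X i) (E f) := by
    rw [hE]
    exact hasSum_evalAt _ _ _ f
  have hEz (j : Fin d) := s.hasSum_opZ j (G k) τ X (s.norm_point_le_one hq1 hp)
  rw [← hE] at hEz
  have h4 := (((hasSum_sum fun l (_ : l ∈ Finset.univ) =>
    (hEs (s.opθ (G l))).mul_left (D.A₀ k l : ℂ)).mul_left (s.S : ℂ)).add
    (hEs (s.rhs G k))).mul_left ((v.1 / s.T : ℝ) : ℂ)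
  have h5 := hasSum_sum fun j (_ : j ∈ Finset.univ) =>
    (hEz j).mul_left ((v.2 j * (Real.exp (p.1 / s.T) / s.ρ) : ℝ) : ℂ)
  have h6 := (hEs (s.opθ (G k))).mul_left ((s.angle v.2 : ℝ) : ℂ)
  have h7 := h4.add (h5.add h6)
  refine (iff_of_eq (congrArg (fun f => HasSum f _) (funext fun i => ?_))).2 h7
  have hθ (f : Alg d) : coeff i (s.opθ f) τ = Complex.I * freq i * coeff i (s.opT f) τ := by
    rw [s.coeff_opθ, s.coeff_opT]
    simp only [ContinuousMap.mul_apply, ContinuousMap.const_apply]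
    ring
  have hprof : s.profile G k i (p.1 / s.T) = coeff i (s.opT (G k)) τ :=
    s.profile_eq hD hG h₀ hsol k i τ
  have hvel : (s.velocity G k i).extend (p.1 / s.T) = s.velocity G k i τ :=
    (s.velocity G k i).extend_of_mem τ
  rw [termDeriv_apply, hprof, hvel, s.velocity_apply, s.gen_apply]
  set g := coeff i (s.opT (G k)) τ with hg
  -- Euler's identity turns the degrees in the positions and in the two exponentials into `rate i`,
  -- and the difference of the exponential degrees into `freq i`.
  have hsum : ∑ l, s.pointDeriv x₀ p v l * (g * pmonom l X i) =
      (v.1 / s.T : ℝ) * s.rate i * g * monom X i +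
      (∑ j, ((v.2 j * (Real.exp (p.1 / s.T) / s.ρ) : ℝ) : ℂ) * (g * pmonom (Sum.inl j) X i) +
        (s.angle v.2 : ℝ) * (Complex.I * freq i * g * monom X i)) := by
    have ht := mul_pmonom (Sum.inr true) X i
    have hf := mul_pmonom (Sum.inr false) X i
    have hz : ∑ j, X (Sum.inl j) * (g * pmonom (Sum.inl j) X i) = (zdeg i : ℂ) * g * monom X i := by
      have : (zdeg i : ℂ) = ∑ j, (i (Sum.inl j) : ℂ) := by simp [zdeg]
      rw [this, Finset.sum_mul, Finset.sum_mul]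
      refine Finset.sum_congr rfl fun j _ => ?_
      rw [mul_left_comm, mul_pmonom]
      ring
    have hw : (wdeg i : ℂ) = i (Sum.inr true) + i (Sum.inr false) := by simp [wdeg]
    simp only [Fintype.sum_sum_type, Fintype.sum_bool, Scale.pointDeriv, ← hX, add_mul,
      Finset.sum_add_distrib, sgn, cond_true, cond_false, mul_assoc, ← Finset.mul_sum] at hz ⊢
    rw [hz, Scale.rate, freq]
    push_cast
    rw [hw]
    linear_combination ((v.1 / s.T * s.Γ : ℂ) + s.angle v.2 * Complex.I) * g * ht +
      ((v.1 / s.T * s.Γ : ℂ) - s.angle v.2 * Complex.I) * g * hf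
  rw [hsum]
  simp only [hθ, ← hg]
  have h8 : ∑ l, (D.A₀ k l : ℂ) * (Complex.I * freq i * coeff i (s.opT (G l)) τ * monom X i) =
      Complex.I * freq i * monom X i * ∑ l, (D.A₀ k l : ℂ) * coeff i (s.opT (G l)) τ := by
    rw [Finset.mul_sum]
    exact Finset.sum_congr rfl fun l _ => by ring
  rw [h8]
  push_cast
  ring

end Waves

/-! ### The waves satisfy the differential system -/

section Equation

open Wiener ComplexConjugate

variable {d N : ℕ}

/-- The coordinates of a point and a value, relatively to a base point. -/
def toCoord (x₀ : Pos d) (p : ℝ × Pos d) (v : Val N) : Coord d N → ℝ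
  | Sum.inl _ => p.1
  | Sum.inr (Sum.inl j) => p.2 j - x₀ j
  | Sum.inr (Sum.inr k) => v k

/-- The symbol is that of the system with the given coefficients, in local coordinates. -/
structure Symbol.Represents (D : Symbol d N) (fa : Fin d → Fin N → Fin N → (Coord d N → ℝ) → ℝ)
    (fb : Fin N → (Coord d N → ℝ) → ℝ) (a : NNReal) (R : ENNReal) : Prop where
  lt : (a : ENNReal) < R
  coef : ∀ j k l, HasFPowerSeriesOnBall (fa j k l) (D.a j k l) 0 R
  source : ∀ k, HasFPowerSeriesOnBall (fb k) (D.b k) 0 R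
  symbol : ∀ k l, D.A₀ k l = ∑ j, D.ξ j * fa j k l 0
  zero : ∀ k y, ‖y‖ < a → (∀ k', y (Sum.inr (Sum.inr k')) = 0) → fb k y = 0

theorem Symbol.Represents.radiusBound {D : Symbol d N}
    {fa : Fin d → Fin N → Fin N → (Coord d N → ℝ) → ℝ} {fb : Fin N → (Coord d N → ℝ) → ℝ}
    {a : NNReal} {R : ENNReal} (h : D.Represents fa fb a R) : D.RadiusBound a where
  coef j k l := h.lt.trans_le (h.coef j k l).r_le
  source k := h.lt.trans_le (h.source k).r_le

theorem calculus_complex {ι : Type*} [Fintype ι] [DecidableEq ι]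
    {p : FormalMultilinearSeries ℝ (ι → ℝ) ℝ} {f : (ι → ℝ) → ℝ} {r : ENNReal}
    (hf : HasFPowerSeriesOnBall f p 0 r) {a : NNReal} (ha : (a : ENNReal) < r) {y : ι → ℝ}
    (hy : ‖y‖ < a / (Fintype.card ι + 1)) :
    calculus p ℂ (fun l => (y l : ℂ)) = f y := by
  have h := map_calculus p (Algebra.ofId ℝ ℂ)
    (fun b => (Complex.norm_real b).le) (ha.trans_le hf.r_le) hy
  rw [calculus_real p hf ha hy] at h
  exact h.symm

variable {D : Symbol d N} (s : Scale D)
  {q : ℝ} (hq0 : 0 < q) (hq1 : q < 1)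
  {fa : Fin d → Fin N → Fin N → (Coord d N → ℝ) → ℝ} {fb : Fin N → (Coord d N → ℝ) → ℝ}
  {a : NNReal} {R : ENNReal} (hf : D.Represents fa fb a R) {G G₀ : Fin N → Alg d}
  (hG : ‖s.coords G‖ < a / (Fintype.card (Coord d N) + 1)) (h₀ : s.IsFree G₀)
  (hsol : G = G₀ + s.duhamel G) (hconj : ∀ k, conjAlg d (G k) = G k)
  {x₀ : Pos d} {p : ℝ × Pos d} (hp : p ∈ s.domain x₀ q) (h0 : 0 ≤ p.1)
include hf hG h₀ hsol hconj

theorem Scale.evalAt_coords (m : Coord d N) :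
    evalAt ⟨p.1 / s.T, s.time_mem hp h0⟩ (s.point x₀ p) (s.norm_point_le_one hq1 hp)
      (s.coords G m) = (toCoord x₀ p (s.field x₀ G p) m : ℂ) := by
  rcases m with _ | j | k
  · have hT := s.T_pos.ne'
    rw [Scale.coords, evalAt_single, monom_zero, mul_one]
    simp only [Scale.time, ContinuousMap.coe_mk, toCoord]
    rw [mul_div_cancel₀ _ hT]
  · have hρ := s.ρ_pos.ne'
    have h1 : monom (s.point x₀ p) (Finsupp.single (Sum.inl j) 1) = s.point x₀ p (Sum.inl j) := by
      simp [monom, Finsupp.single_apply, Finset.prod_ite_eq]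
    rw [Scale.coords, evalAt_single, h1]
    simp only [Scale.radius, ContinuousMap.coe_mk, toCoord, Scale.point, ← Complex.ofReal_mul]
    congr 1
    rw [Real.exp_neg]
    field_simp
  · have h1 := conj_evalAt ⟨p.1 / s.T, s.time_mem hp h0⟩ (s.point x₀ p)
      (s.norm_point_le_one hq1 hp) (f := s.opT (G k)) (by rw [s.conjAlg_opT, hconj])
      (s.conj_point x₀ p)
    have h2 := s.wave_eq hq1 hf.radiusBound hG h₀ hsol hp h0 k
    simp only [Scale.coords, toCoord, Scale.field]
    rw [h2]
    exact (Complex.conj_eq_iff_re.1 h1).symm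

include hq1 hp h0

theorem Scale.norm_toCoord_le : ‖toCoord x₀ p (s.field x₀ G p)‖ ≤ ‖s.coords G‖ := by
  refine (pi_norm_le_iff_of_nonneg (norm_nonneg _)).2 fun m => ?_
  rw [← Complex.norm_real, ← s.evalAt_coords hq1 hf hG h₀ hsol hconj hp h0]
  exact (norm_evalAt_le _ _ _ _).trans (norm_le_pi_norm _ m)

include hq0

/-- Point evaluation commutes with the calculus, so the right hand side in the algebra becomes the
actual coefficients at the actual point. The complex identity has real coefficients, and its real
part is the claim. -/
theorem Scale.field_equation (k : Fin N) :
    fderiv ℝ (s.field x₀ G) p (1, 0) k =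
      (∑ j, ∑ l, fa j k l (toCoord x₀ p (s.field x₀ G p)) *
        fderiv ℝ (s.field x₀ G) p (0, EuclideanSpace.single j 1) l) +
      fb k (toCoord x₀ p (s.field x₀ G p)) := by
  have hD := hf.radiusBound
  have hnhds := (s.isOpen_domain x₀ q).mem_nhds hp
  have hre (k : Fin N) (v : ℝ × Pos d) :
      fderiv ℝ (s.field x₀ G) p v k = (fderiv ℝ (s.wave x₀ G k) p v).re := by
    have h1 := (((s.contDiffOn_field hq0 hq1 x₀ G).contDiffAt hnhds).differentiableAt
      one_ne_zero).hasFDerivAt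
    have h2 := (((s.contDiffOn_wave hq0 hq1 x₀ G k).contDiffAt hnhds).differentiableAt
      one_ne_zero).hasFDerivAt
    have h3 := ((EuclideanSpace.proj k : Val N →L[ℝ] ℝ).hasFDerivAt).comp p h1
    have h4 := (Complex.reCLM.hasFDerivAt).comp p h2
    exact congrArg (fun L : ℝ × Pos d →L[ℝ] ℝ => L v) (h3.unique h4)
  set y := toCoord x₀ p (s.field x₀ G p) with hy
  have hyn : ‖y‖ < a / (Fintype.card (Coord d N) + 1) :=
    (s.norm_toCoord_le hq1 hf hG h₀ hsol hconj hp h0).trans_lt hG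
  have hpos : 0 < (a : ℝ) / (Fintype.card (Coord d N) + 1) := (norm_nonneg y).trans_lt hyn
  obtain ⟨E, hE⟩ : ∃ E, E = evalAt ⟨p.1 / s.T, s.time_mem hp h0⟩ (s.point x₀ p)
    (s.norm_point_le_one hq1 hp) := ⟨_, rfl⟩
  have hEn (f : Alg d) : ‖E f‖ ≤ ‖f‖ := by
    rw [hE]
    exact norm_evalAt_le _ _ _ f
  have hEy : (fun m => E (s.coords G m)) = fun m => (y m : ℂ) := funext fun m => by
    rw [hE, s.evalAt_coords hq1 hf hG h₀ hsol hconj hp h0]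
  set y₀ := toCoord x₀ p (0 : Val N) with hy₀
  have hEy₀ : (fun m => E (s.coords (0 : Fin N → Alg d) m)) = fun m => (y₀ m : ℂ) :=
    funext fun m => by
      rcases m with _ | j | l
      · exact congrFun hEy (Sum.inl ())
      · exact congrFun hEy (Sum.inr (Sum.inl j))
      · simp [Scale.coords, hy₀, toCoord]
  have hy₀n : ‖y₀‖ < a / (Fintype.card (Coord d N) + 1) := by
    refine lt_of_le_of_lt ((pi_norm_le_iff_of_nonneg (norm_nonneg y)).2 fun m => ?_) hyn
    rcases m with _ | j | l
    · exact norm_le_pi_norm y (Sum.inl ())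
    · exact norm_le_pi_norm y (Sum.inr (Sum.inl j))
    · simp [hy₀, toCoord]
  -- Here the vanishing of the source at `u = 0` makes the subtracted term of `rhs` disappear.
  have hb0 : fb k y₀ = 0 := by
    refine hf.zero k y₀ (hy₀n.trans_le (div_le_self a.coe_nonneg ?_)) fun k' => rfl
    linarith [(Nat.cast_nonneg (Fintype.card (Coord d N)) : (0 : ℝ) ≤ _)]
  have ha0 (j l) : calculus (D.a j k l) ℂ 0 = (fa j k l 0 : ℂ) := by
    rw [← calculus_complex (hf.coef j k l) hf.lt (y := 0) (by simpa using hpos)]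
    simp only [Pi.zero_apply, Complex.ofReal_zero]
    rfl
  have hrhs := s.map_rhs hD hG E hEn k
  rw [hEy, hEy₀, calculus_complex (hf.source k) hf.lt hyn, calculus_complex (hf.source k) hf.lt hy₀n,
    hb0] at hrhs
  simp only [ha0, calculus_complex (hf.coef _ k _) hf.lt hyn] at hrhs
  have hexp : E (single 0 expTime) = (Real.exp (p.1 / s.T) : ℂ) := by
    rw [hE, evalAt_single, monom_zero, mul_one]
    rfl
  have hk1 := s.fderiv_wave hq0 hq1 hD hG h₀ hsol hp h0 k (1, 0) E hE
  have hk2 (j l) := s.fderiv_wave hq0 hq1 hD hG h₀ hsol hp h0 l (0, EuclideanSpace.single j 1) E hE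
  have hT := s.T_pos.ne'
  have hρ := s.ρ_pos.ne'
  have hangle (j : Fin d) : s.angle (EuclideanSpace.single j 1) = s.S / s.T * D.ξ j := by
    simp [Scale.angle]
  have hangle0 : s.angle (0 : Pos d) = 0 := by simp [Scale.angle]
  have hk2' (j l) : fderiv ℝ (s.wave x₀ G l) p (0, EuclideanSpace.single j 1) =
      (Real.exp (p.1 / s.T) / s.ρ : ℝ) * E (s.opZ j (G l)) +
        (s.S / s.T * D.ξ j : ℝ) * E (s.opθ (G l)) := by
    rw [hk2, hangle, zero_div, Complex.ofReal_zero, zero_mul, zero_add]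
    congr 1
    rw [Finset.sum_eq_single j (fun j' _ hj' => by simp [hj']) (by simp)]
    simp
  have key : fderiv ℝ (s.wave x₀ G k) p (1, 0) =
      (∑ j, ∑ l, (fa j k l y : ℂ) * fderiv ℝ (s.wave x₀ G l) p (0, EuclideanSpace.single j 1)) +
        (fb k y : ℂ) := by
    -- `A₀` restores the values at the base point that were subtracted in `rhs`; together they give
    -- the full principal part.
    have hsym : ∑ l, (D.A₀ k l : ℂ) * E (s.opθ (G l)) =
        ∑ j, ∑ l, (D.ξ j : ℂ) * fa j k l 0 * E (s.opθ (G l)) := by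
      rw [Finset.sum_comm]
      refine Finset.sum_congr rfl fun l _ => ?_
      rw [hf.symbol, ← Finset.sum_mul]
      push_cast
      rfl
    have hT' : (s.T : ℂ) ≠ 0 := Complex.ofReal_ne_zero.2 hT
    have hρ' : (s.ρ : ℂ) ≠ 0 := Complex.ofReal_ne_zero.2 hρ
    have hsplit : (s.S : ℂ) * ∑ l, (D.A₀ k l : ℂ) * E (s.opθ (G l)) + E (s.rhs G k) = s.T *
        ((∑ j, ∑ l, (fa j k l y : ℂ) * fderiv ℝ (s.wave x₀ G l) p
          (0, EuclideanSpace.single j 1)) + (fb k y : ℂ)) := by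
      rw [hsym, hrhs, hexp, ← add_assoc, mul_add]
      congr 1
      · rw [Finset.mul_sum, Finset.mul_sum, ← Finset.sum_add_distrib]
        refine Finset.sum_congr rfl fun j _ => ?_
        rw [Finset.mul_sum, Finset.mul_sum, ← Finset.sum_add_distrib]
        refine Finset.sum_congr rfl fun l _ => ?_
        rw [hk2', Complex.real_smul, Complex.real_smul]
        push_cast
        field_simp
        ring
      · rw [Complex.real_smul, Complex.ofReal_zero, sub_zero]
    rw [hk1, hangle0, hsplit]
    simp [hT']
  rw [hre, key]
  simp only [Complex.add_re, Complex.re_sum, Complex.re_ofReal_mul, Complex.ofReal_re, hre]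

end Equation

/-! ### Plane wave solutions of the frozen system -/

section Mode

open Wiener ComplexConjugate

variable {d N : ℕ} {D : Symbol d N} (s : Scale D)

/-- The amplitude of a plane wave solution of the constant coefficient system. -/
noncomputable def Scale.amplitude (lam : ℂ) (τ : ℝ) : ℂ :=
  Complex.exp ((Complex.I * lam * s.S - s.Γ) * τ)

/-- The coefficient of a plane wave solution of the constant coefficient system. -/
noncomputable def Scale.modeCoeff (η : ℝ) (lam c : ℂ) : TimeFun :=
  -- `Γ - c S` is the weight of a single exponential and will be removed by `opT`; `exp Γ` undoes
  -- the shift in the exponential variables.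
  ⟨fun τ => (s.Γ - D.c * s.S : ℝ) * (η * Real.exp s.Γ * c * s.amplitude lam τ), by
    unfold Scale.amplitude
    fun_prop⟩

/-- The index of an exponential. -/
noncomputable def expIdx (d : ℕ) (b : Bool) : Var d →₀ ℕ := Finsupp.single (Sum.inr b) 1

theorem swapIdx_expIdx (b : Bool) : swapIdx (expIdx d b) = expIdx d !b := by
  simp [swapIdx, expIdx, swapVar]

theorem wdeg_expIdx (b : Bool) : wdeg (expIdx d b) = 1 := by
  cases b <;> simp [wdeg, expIdx]

theorem zdeg_expIdx (b : Bool) : zdeg (expIdx d b) = 0 := by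
  simp [zdeg, expIdx]

theorem freq_expIdx (b : Bool) : freq (expIdx d b) = sgn b := by
  cases b <;> simp [freq, expIdx, sgn]

theorem expIdx_ne : expIdx d true ≠ expIdx d false := by
  intro h
  have := congrArg freq h
  norm_num [freq_expIdx, sgn] at this

/-- The plane wave solutions of the constant coefficient system. -/
noncomputable def Scale.mode (η : ℝ) (lam : ℂ) (r : Fin N → ℂ) (k : Fin N) : Alg d :=
  single (expIdx d true) (s.modeCoeff η lam (r k)) +
    single (expIdx d false) (conjTime (s.modeCoeff η lam (r k)))

variable (η : ℝ) (lam : ℂ) (r : Fin N → ℂ)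

theorem Scale.conjAlg_mode (k : Fin N) :
    conjAlg d (s.mode η lam r k) = s.mode η lam r k := by
  classical
  refine Wiener.ext fun i => ?_
  have h (b : Bool) : swapIdx i = expIdx d b ↔ i = expIdx d !b := by
    rw [← swapIdx_expIdx]
    exact ⟨fun h => by rw [← h, swapIdx_swapIdx], fun h => by rw [h, swapIdx_swapIdx]⟩
  have hcc (f : TimeFun) : conjTime (conjTime f) = f := by
    ext τ
    exact Complex.conj_conj _
  rw [coeff_conjAlg, Scale.mode, map_add, map_add, map_add, coeff_single, coeff_single,
    coeff_single, coeff_single, add_comm]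
  simp only [h]
  simp only [Bool.not_true, Bool.not_false]
  congr 1
  · split_ifs
    · exact hcc _
    · exact map_zero _
  · split_ifs
    · rfl
    · exact map_zero _

variable {lam r} (hr : ∀ k, ∑ l, (D.A₀ k l : ℂ) * r l = lam * r k)
include hr

/-- On the eigenvector `r`, the generator at frequency one is the scalar `i λ S - Γ`. Frequency
minus one is the conjugate, and every other coefficient is zero. -/
theorem Scale.isFree_mode : s.IsFree (s.mode η lam r) := by
  classical
  intro i hi
  have hgap : (((s.Γ - D.c * s.S : ℝ)) : ℂ) ≠ 0 :=
    Complex.ofReal_ne_zero.2 (zero_lt_one.trans_le s.gap).ne'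
  have hw (b : Bool) : s.winv (expIdx d b) = (s.Γ - D.c * s.S)⁻¹ := by
    rw [Scale.winv, if_neg (by rw [wdeg_expIdx]; exact one_ne_zero), Scale.weight, zdeg_expIdx,
      wdeg_expIdx]
    simp
  have hrate (b : Bool) : s.rate (expIdx d b) = s.Γ := by
    rw [Scale.rate, zdeg_expIdx, wdeg_expIdx]
    simp
  have hamp (τ : ℝ) : HasDerivAt (fun τ : ℝ => s.amplitude lam τ)
      ((Complex.I * lam * s.S - s.Γ) * s.amplitude lam τ) τ := by
    have h1 := ((hasDerivAt_id τ).ofReal_comp.const_mul (Complex.I * lam * s.S - s.Γ)).cexp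
    refine h1.congr_deriv ?_
    simp only [Scale.amplitude, id]
    push_cast
    ring
  have hcoef (k : Fin N) : coeff i (s.mode η lam r k) =
      (if i = expIdx d true then s.modeCoeff η lam (r k) else 0) +
        (if i = expIdx d false then conjTime (s.modeCoeff η lam (r k)) else 0) := by
    rw [Scale.mode, map_add, coeff_single, coeff_single]
  have hd (k : Fin N) (τ : ℝ) : HasDerivAt (fun τ : ℝ => η * Real.exp s.Γ * r k *
      s.amplitude lam τ) (η * Real.exp s.Γ * r k * ((Complex.I * lam * s.S - s.Γ) *
        s.amplitude lam τ)) τ := (hamp τ).const_mul _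
  by_cases ht : i = expIdx d true
  · refine ⟨fun τ k => η * Real.exp s.Γ * r k * s.amplitude lam τ, fun k τ => ?_, fun τ =>
      hasDerivAt_pi.2 fun k => (hd k τ).congr_deriv ?_⟩
    · rw [hcoef, if_pos ht, if_neg (by rw [ht]; exact expIdx_ne), add_zero, ht, hw]
      simp only [Scale.modeCoeff, ContinuousMap.coe_mk]
      push_cast at hgap ⊢
      rw [inv_mul_cancel_left₀ hgap]
    · rw [ht, s.gen_apply, hrate, freq_expIdx]
      have : ∑ l, (D.A₀ k l : ℂ) * (η * Real.exp s.Γ * r l * s.amplitude lam τ) =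
          η * Real.exp s.Γ * s.amplitude lam τ * (lam * r k) := by
        rw [← hr, Finset.mul_sum]
        exact Finset.sum_congr rfl fun l _ => by ring
      rw [this]
      simp [sgn]
      ring
  by_cases hf : i = expIdx d false
  · refine ⟨fun τ k => conj (η * Real.exp s.Γ * r k * s.amplitude lam τ), fun k τ => ?_, fun τ =>
      hasDerivAt_pi.2 fun k => ?_⟩
    · rw [hcoef, if_pos hf, if_neg ht, zero_add, hf, hw, conjTime_apply]
      simp only [Scale.modeCoeff, ContinuousMap.coe_mk]
      rw [map_mul, Complex.conj_ofReal]
      push_cast at hgap ⊢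
      rw [inv_mul_cancel_left₀ hgap]
    · have h1 := (Complex.conjCLE : ℂ →L[ℝ] ℂ).hasFDerivAt.comp_hasDerivAt τ (hd k τ)
      refine h1.congr_deriv ?_
      rw [hf, s.gen_apply, hrate, freq_expIdx]
      have : ∑ l, (D.A₀ k l : ℂ) * conj (η * Real.exp s.Γ * r l * s.amplitude lam τ) =
          conj (η * Real.exp s.Γ * s.amplitude lam τ * (lam * r k)) := by
        rw [← hr, Finset.mul_sum, map_sum]
        refine Finset.sum_congr rfl fun l _ => ?_
        simp only [map_mul, Complex.conj_ofReal]
        ring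
      rw [this]
      change conj _ = _
      simp [sgn]
      ring
  · refine ⟨0, fun k τ => ?_, fun τ => ?_⟩
    · rw [hcoef, if_neg ht, if_neg hf, add_zero]
      exact mul_zero _
    · rw [Pi.zero_apply, map_zero]
      exact hasDerivAt_const _ _

omit hr in
theorem Scale.norm_amplitude (τ : ℝ) :
    ‖s.amplitude lam τ‖ = Real.exp ((-lam.im * s.S - s.Γ) * τ) := by
  simp [Scale.amplitude, Complex.norm_exp]

omit hr in
-- The amplitude does not grow after the factor `exp (Γ τ)` has been moved into the variables, so
-- its modulus is largest at `τ = 0`. The factor `exp Γ` is what forces `η` to be very small.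
theorem Scale.norm_mode_le (hη : 0 ≤ η) (hlam : -lam.im * s.S ≤ s.Γ) :
    ‖s.mode η lam r‖ ≤ 2 * ((s.Γ - D.c * s.S) * (η * Real.exp s.Γ * ‖r‖)) := by
  have hgap : 0 < s.Γ - D.c * s.S := zero_lt_one.trans_le s.gap
  refine (pi_norm_le_iff_of_nonneg (by positivity)).2 fun k => ?_
  have h1 : ‖s.modeCoeff η lam (r k)‖ ≤ (s.Γ - D.c * s.S) * (η * Real.exp s.Γ * ‖r‖) := by
    refine (ContinuousMap.norm_le _ (by positivity)).2 fun τ => ?_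
    simp only [Scale.modeCoeff, ContinuousMap.coe_mk, norm_mul, Complex.norm_real, s.norm_amplitude,
      Real.norm_of_nonneg hgap.le, Real.norm_of_nonneg hη, Real.norm_of_nonneg (Real.exp_pos _).le]
    have h2 : Real.exp ((-lam.im * s.S - s.Γ) * τ) ≤ 1 :=
      Real.exp_le_one_iff.2 (mul_nonpos_of_nonpos_of_nonneg (by linarith) τ.2.1)
    have h3 := norm_le_pi_norm r k
    calc _ ≤ (s.Γ - D.c * s.S) * (η * Real.exp s.Γ * ‖r‖ * 1) := by gcongr
      _ = _ := by ring
  refine (norm_add_le _ _).trans ?_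
  rw [norm_single, norm_single, norm_conjTime]
  linarith

omit hr in
theorem Scale.evalAt_mode {q : ℝ} (hq1 : q < 1) {x₀ : Pos d} {p : ℝ × Pos d}
    (hp : p ∈ s.domain x₀ q) (h0 : 0 ≤ p.1) (k : Fin N) :
    evalAt ⟨p.1 / s.T, s.time_mem hp h0⟩ (s.point x₀ p) (s.norm_point_le_one hq1 hp)
      (s.opT (s.mode η lam r k)) = (2 * η * (Complex.exp
        ((s.angle (p.2 - x₀) + lam * (s.S * (p.1 / s.T))) * Complex.I) * r k).re : ℝ) := by
  classical
  have hgap : (((s.Γ - D.c * s.S : ℝ)) : ℂ) ≠ 0 :=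
    Complex.ofReal_ne_zero.2 (zero_lt_one.trans_le s.gap).ne'
  have hw (b : Bool) : s.winv (expIdx d b) = (s.Γ - D.c * s.S)⁻¹ := by
    rw [Scale.winv, if_neg (by rw [wdeg_expIdx]; exact one_ne_zero), Scale.weight, zdeg_expIdx,
      wdeg_expIdx]
    simp
  set E := evalAt ⟨p.1 / s.T, s.time_mem hp h0⟩ (s.point x₀ p) (s.norm_point_le_one hq1 hp) with hE
  have hsingle (b : Bool) (f : TimeFun) : s.opT (single (expIdx d b) f) =
      single (expIdx d b) (ContinuousMap.const _ (((s.Γ - D.c * s.S)⁻¹ : ℝ) : ℂ) * f) := by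
    refine Wiener.ext fun i => ?_
    rw [s.coeff_opT, coeff_single, coeff_single]
    split_ifs with hi
    · rw [hi, hw]
    · exact mul_zero _
  have hmonom (b : Bool) : monom (s.point x₀ p) (expIdx d b) = s.point x₀ p (Sum.inr b) := by
    simp [monom, expIdx, Finsupp.single_apply, Finset.prod_ite_eq]
  have hone : E (single (expIdx d true) (ContinuousMap.const _ (((s.Γ - D.c * s.S)⁻¹ : ℝ) : ℂ) *
      s.modeCoeff η lam (r k))) = η * (Complex.exp
        ((s.angle (p.2 - x₀) + lam * (s.S * (p.1 / s.T))) * Complex.I) * r k) := by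
    rw [hE, evalAt_single, hmonom]
    simp only [ContinuousMap.mul_apply, ContinuousMap.const_apply, Scale.modeCoeff,
      ContinuousMap.coe_mk, Scale.amplitude, Scale.point, Complex.ofReal_exp]
    rw [Complex.ofReal_inv, inv_mul_cancel_left₀ hgap]
    have h1 : Complex.exp ((s.angle (p.2 - x₀) + lam * (s.S * (p.1 / s.T))) * Complex.I) =
        Complex.exp s.Γ * (Complex.exp ((Complex.I * lam * s.S - s.Γ) * (p.1 / s.T : ℝ)) *
        Complex.exp ((s.Γ * (p.1 / s.T - 1) : ℝ) +
          (sgn true * s.angle (p.2 - x₀) : ℝ) * Complex.I)) := by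
      rw [← Complex.exp_add, ← Complex.exp_add]
      congr 1
      simp only [sgn, cond_true]
      push_cast
      ring
    rw [h1]
    ring
  have htwo : E (single (expIdx d false) (ContinuousMap.const _ (((s.Γ - D.c * s.S)⁻¹ : ℝ) : ℂ) *
      conjTime (s.modeCoeff η lam (r k)))) = conj (η * (Complex.exp
        ((s.angle (p.2 - x₀) + lam * (s.S * (p.1 / s.T))) * Complex.I) * r k)) := by
    rw [← hone, hE, evalAt_single, evalAt_single, map_mul, hmonom, hmonom, s.conj_point]
    simp only [ContinuousMap.mul_apply, ContinuousMap.const_apply, map_mul, Complex.conj_ofReal]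
    rfl
  rw [Scale.mode, map_add, map_add, hsingle, hsingle, hone, htwo, Complex.add_conj,
    Complex.re_ofReal_mul, mul_assoc]

omit hr in
-- Every monomial that survives `opT` contains an exponential. The error thus carries a factor `exp
-- (Γ (τ - 1))` and can be compared with the growing wave at every time, not only at the final one.
theorem norm_evalAt_opT_le (τ : unitInterval) (X : Var d → ℂ) (hX : ∀ l, ‖X l‖ ≤ 1) {y : ℝ}
    (hy : ∀ b, ‖X (Sum.inr b)‖ ≤ y) (f : Alg d) :
    ‖evalAt τ X hX (s.opT f)‖ ≤ y * ‖f‖ := by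
  have hy0 : 0 ≤ y := (norm_nonneg _).trans (hy true)
  rw [← (hasSum_evalAt τ X hX (s.opT f)).tsum_eq]
  refine tsum_of_norm_bounded ((hasSum_norm f).mul_left y) fun i => ?_
  rw [norm_mul]
  by_cases hi : wdeg i = 0
  · rw [coeff_opT_of_wdeg_eq_zero s f hi]
    simpa using mul_nonneg hy0 (norm_nonneg _)
  have h1 : ‖coeff i (s.opT f) τ‖ ≤ ‖coeff i f‖ := by
    refine (ContinuousMap.norm_coe_le_norm _ _).trans ?_
    rw [s.coeff_opT]
    refine (norm_mul_le _ _).trans (mul_le_of_le_one_left (norm_nonneg _) ?_)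
    refine (ContinuousMap.norm_le _ zero_le_one).2 fun _ => ?_
    rw [ContinuousMap.const_apply, Complex.norm_real, Real.norm_of_nonneg (s.winv_nonneg i)]
    exact s.winv_le_one i
  have h2 : ‖monom X i‖ ≤ y := by
    obtain ⟨b, hb⟩ : ∃ b, i (Sum.inr b) ≠ 0 := by
      by_contra! h
      exact hi (by simp [wdeg, h])
    have h3 : i = (i - expIdx d b) + expIdx d b := by
      refine (tsub_add_cancel_of_le ?_).symm
      rw [expIdx, Finsupp.single_le_iff]
      omega
    have h4 : monom X (expIdx d b) = X (Sum.inr b) := by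
      simp [monom, expIdx, Finsupp.single_apply, Finset.prod_ite_eq]
    rw [h3, monom_add, norm_mul, h4]
    exact (mul_le_of_le_one_left (norm_nonneg _) (norm_monom_le_one hX _)).trans (hy b)
  calc _ ≤ ‖coeff i f‖ * y := by gcongr
    _ = _ := mul_comm _ _

end Mode

/-! ### Lenses -/

section Lens

variable {d : ℕ} {x₀ : Pos d} {r δ : ℝ}

theorem continuous_lens (x₀ : Pos d) (δ : ℝ) :
    Continuous fun p : ℝ × Pos d => ‖p.2 - x₀‖ ^ 2 + δ * p.1 := by
  fun_prop

theorem isOpen_lens_interior (x₀ : Pos d) (r δ : ℝ) :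
    IsOpen {p : ℝ × Pos d | 0 < p.1 ∧ ‖p.2 - x₀‖ ^ 2 + δ * p.1 < r ^ 2} :=
  (isOpen_lt continuous_const continuous_fst).inter (isOpen_lt (continuous_lens x₀ δ) continuous_const)

theorem convex_lens (x₀ : Pos d) (r δ : ℝ) : Convex ℝ (lens x₀ r δ) := by
  have h1 : ConvexOn ℝ Set.univ fun p : ℝ × Pos d => ‖p.2 - x₀‖ ^ 2 + δ * p.1 := by
    refine ConvexOn.add (ConvexOn.pow ?_ (fun _ _ => norm_nonneg _) 2) ?_
    · have h : ConvexOn ℝ Set.univ fun x : Pos d => ‖x - x₀‖ := by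
        simpa [dist_eq_norm] using convexOn_univ_dist x₀
      exact h.comp_linearMap (LinearMap.snd ℝ ℝ (Pos d))
    · exact ((δ • LinearMap.fst ℝ ℝ (Pos d)).convexOn convex_univ)
  have h2 := h1.convex_lt (r ^ 2)
  have h3 : Convex ℝ {p : ℝ × Pos d | 0 ≤ p.1} :=
    convex_halfSpace_ge (LinearMap.fst ℝ ℝ (Pos d)).isLinear 0
  convert h3.inter h2 using 1
  ext p
  simp [lens]

theorem closure_lens_subset (x₀ : Pos d) (r δ : ℝ) :
    closure (lens x₀ r δ) ⊆ {p | 0 ≤ p.1 ∧ ‖p.2 - x₀‖ ^ 2 + δ * p.1 ≤ r ^ 2} := by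
  refine closure_minimal (fun p hp => ⟨hp.1, hp.2.le⟩) ?_
  exact (isClosed_le continuous_const continuous_fst).inter
    (isClosed_le (continuous_lens x₀ δ) continuous_const)

theorem uniqueDiffOn_closure_lens (hr : 0 < r) (hδ : 0 < δ) :
    UniqueDiffOn ℝ (closure (lens x₀ r δ)) := by
  have hsub : {p : ℝ × Pos d | 0 < p.1 ∧ ‖p.2 - x₀‖ ^ 2 + δ * p.1 < r ^ 2} ⊆
      closure (lens x₀ r δ) := fun p hp => subset_closure ⟨hp.1.le, hp.2⟩
  refine uniqueDiffOn_convex (convex_lens x₀ r δ).closure ⟨(r ^ 2 / (2 * δ), x₀), ?_⟩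
  refine interior_maximal hsub (isOpen_lens_interior x₀ r δ) ⟨by positivity, ?_⟩
  have : 0 < r ^ 2 := by positivity
  simp only [sub_self, norm_zero]
  field_simp
  linarith

end Lens

/-! ### Exact solutions on lenses -/

section Solution

open Wiener ComplexConjugate

variable {d N : ℕ}

/-- The point with given coordinates. -/
noncomputable def fromCoord (x₀ : Pos d) (y : Coord d N → ℝ) : ℝ × Pos d × Val N :=
  (y (Sum.inl ()), x₀ + WithLp.toLp 2 fun j => y (Sum.inr (Sum.inl j)),
    WithLp.toLp 2 fun k => y (Sum.inr (Sum.inr k)))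

theorem fromCoord_toCoord (x₀ : Pos d) (p : ℝ × Pos d) (v : Val N) :
    fromCoord x₀ (toCoord x₀ p v) = (p.1, p.2, v) := by
  refine Prod.ext rfl (Prod.ext ?_ ?_)
  · ext j
    simp [fromCoord, toCoord]
  · ext k
    simp [fromCoord, toCoord]

variable {D : Symbol d N} (s : Scale D) {x₀ : Pos d} {r δ : ℝ}

/-- The height of the lens is at most `κ T`, so the exponentials stay below `exp (κ - 1) < 1`. The
positions are at most `1/4` of `ρ`, and `exp τ ≤ 3`, which gives `3/4`. The strict inequalities
leave room for the closed lens. -/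
theorem Scale.exists_closure_lens_subset_domain {κ : ℝ} (hδ : 0 < δ) (hκ : κ < 1)
    (hrκ : r ^ 2 ≤ δ * (κ * s.T)) (hrρ : 4 * r ≤ s.ρ) (hr : 0 < r) :
    ∃ q, 0 < q ∧ q < 1 ∧ closure (lens x₀ r δ) ⊆ s.domain x₀ q := by
  have hΓ : 1 ≤ s.Γ := by
    have := s.gap
    have := mul_nonneg D.c_nonneg s.S_pos.le
    linarith
  obtain ⟨q, hq, hq1⟩ := exists_between (show max (3 / 4) (Real.exp (κ - 1)) < 1 from
    max_lt (by norm_num) (Real.exp_lt_one_iff.2 (by linarith)))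
  have hq34 : 3 / 4 < q := (le_max_left _ _).trans_lt hq
  refine ⟨q, by linarith, hq1, fun p hp => ?_⟩
  obtain ⟨h0, h1⟩ := closure_lens_subset x₀ r δ hp
  have hT := s.T_pos
  have hρ := s.ρ_pos
  have hτ0 : 0 ≤ p.1 / s.T := div_nonneg h0 hT.le
  have hτ : p.1 / s.T ≤ κ := by
    rw [div_le_iff₀ hT]
    have : δ * p.1 ≤ δ * (κ * s.T) := by nlinarith [sq_nonneg ‖p.2 - x₀‖]
    exact le_of_mul_le_mul_left this hδ
  refine ⟨⟨by linarith, by linarith⟩, ?_⟩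
  rw [mem_ball_zero_iff, pi_norm_lt_iff (by linarith)]
  rintro (j | b)
  · have hx : ‖p.2 - x₀‖ ≤ r := by
      refine abs_le_of_sq_le_sq' ?_ hr.le |>.2
      nlinarith [mul_nonneg hδ.le h0]
    have hxj : |p.2 j - x₀ j| ≤ r := (PiLp.norm_apply_le (p.2 - x₀) j).trans hx
    simp only [Scale.point, Complex.norm_real, norm_mul, norm_div, Real.norm_eq_abs, abs_of_pos hρ,
      Real.abs_exp]
    have h2 : Real.exp (p.1 / s.T) ≤ 3 :=
      (Real.exp_le_exp.2 (hτ.trans hκ.le)).trans (by linarith [Real.exp_one_lt_d9])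
    have h3 : |p.2 j - x₀ j| / s.ρ ≤ 1 / 4 := by
      rw [div_le_iff₀ hρ]
      linarith
    calc _ ≤ 1 / 4 * 3 := by gcongr
      _ < q := by linarith
  · rw [s.norm_point_inr]
    refine lt_of_le_of_lt (Real.exp_le_exp.2 ?_) ((le_max_right _ _).trans_lt hq)
    nlinarith

variable {fa : Fin d → Fin N → Fin N → (Coord d N → ℝ) → ℝ} {fb : Fin N → (Coord d N → ℝ) → ℝ}
  {a : NNReal} {R : ENNReal} (hf : D.Represents fa fb a R) {G : Fin N → Alg d}
  (hG : ‖s.coords G‖ < a / (Fintype.card (Coord d N) + 1)) {η : ℝ} {lam : ℂ} {w : Fin N → ℂ}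
  (hw : ∀ k, ∑ l, (D.A₀ k l : ℂ) * w l = lam * w k)
  (hsol : G = s.mode η lam w + s.duhamel G)
include hf hG hw hsol

theorem Scale.norm_field_sub_le {q : ℝ} (hq1 : q < 1) {p : ℝ × Pos d}
    (hp : p ∈ s.domain x₀ q) (h0 : 0 ≤ p.1) (k : Fin N) :
    |s.field x₀ G p k - 2 * η * (Complex.exp
      ((s.angle (p.2 - x₀) + lam * (s.S * (p.1 / s.T))) * Complex.I) * w k).re| ≤
      Real.exp (s.Γ * (p.1 / s.T - 1)) * ‖G - s.mode η lam w‖ := by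
  have h1 := s.evalAt_mode η (lam := lam) (r := w) hq1 hp h0 k
  have h2 := s.wave_eq hq1 hf.radiusBound hG (s.isFree_mode η hw) hsol hp h0 k
  have h3 := norm_evalAt_opT_le s ⟨p.1 / s.T, s.time_mem hp h0⟩ (s.point x₀ p)
    (s.norm_point_le_one hq1 hp) (fun b => (s.norm_point_inr x₀ p b).le) (G k - s.mode η lam w k)
  rw [map_sub, map_sub, h1, ← h2] at h3
  have h4 : s.field x₀ G p k - 2 * η * (Complex.exp
      ((s.angle (p.2 - x₀) + lam * (s.S * (p.1 / s.T))) * Complex.I) * w k).re =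
      (s.wave x₀ G k p - (2 * η * (Complex.exp ((s.angle (p.2 - x₀) +
        lam * (s.S * (p.1 / s.T))) * Complex.I) * w k).re : ℝ)).re := by
    rw [Complex.sub_re, Complex.ofReal_re]
    rfl
  rw [h4]
  refine (Complex.abs_re_le_norm _).trans (h3.trans ?_)
  exact mul_le_mul_of_nonneg_left (norm_le_pi_norm (G - s.mode η lam w) k) (Real.exp_pos _).le

/-- The convolutions vanish at `τ = 0`, so the nonlinear solution has exactly the datum of the plane
wave. -/
theorem Scale.field_zero {q : ℝ} (hq1 : q < 1) {x : Pos d} (hp : (0, x) ∈ s.domain x₀ q)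
    (k : Fin N) : s.field x₀ G (0, x) k =
      2 * η * (Complex.exp (s.angle (x - x₀) * Complex.I) * w k).re := by
  have h1 := s.evalAt_mode η (lam := lam) (r := w) hq1 hp le_rfl k
  have h2 := s.wave_eq hq1 hf.radiusBound hG (s.isFree_mode η hw) hsol hp le_rfl k
  have hz : (⟨(0 : ℝ) / s.T, s.time_mem hp le_rfl⟩ : unitInterval) = 0 :=
    Subtype.ext (zero_div _)
  have h3 : ∀ i, coeff i (s.opT (G k)) 0 = coeff i (s.opT (s.mode η lam w k)) 0 := fun i => by
    by_cases hi : wdeg i = 0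
    · rw [coeff_opT_of_wdeg_eq_zero s _ hi, coeff_opT_of_wdeg_eq_zero s _ hi]
    · rw [s.coeff_opT, s.coeff_opT, ContinuousMap.mul_apply, ContinuousMap.mul_apply]
      congr 1
      conv_lhs => rw [hsol]
      simp only [Pi.add_apply, map_add, Scale.duhamel, map_sum, s.coeff_opJ k _ _ hi,
        ContinuousMap.add_apply, ContinuousMap.sum_apply, ContinuousMap.smul_apply, volterra_apply,
        volterraFun, Set.Icc.coe_zero, intervalIntegral.integral_same, smul_zero,
        Finset.sum_const_zero, add_zero]
  have h4 : s.wave x₀ G k (0, x) = (2 * η * (Complex.exp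
        ((s.angle (x - x₀) + lam * (s.S * (0 / s.T))) * Complex.I) * w k).re : ℝ) := by
    rw [h2]
    refine Eq.trans ?_ (h1.trans (by simp))
    refine (hasSum_evalAt _ _ _ _).unique ?_
    have h5 := hasSum_evalAt ⟨(0 : ℝ) / s.T, s.time_mem hp le_rfl⟩ (s.point x₀ (0, x))
      (s.norm_point_le_one hq1 hp) (s.opT (s.mode η lam w k))
    refine (iff_of_eq (congrArg (fun f => HasSum f _) (funext fun i => ?_))).2 h5
    change coeff i (s.opT (G k)) ⟨(0 : ℝ) / s.T, s.time_mem hp le_rfl⟩ * _ =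
      coeff i (s.opT (s.mode η lam w k)) ⟨(0 : ℝ) / s.T, s.time_mem hp le_rfl⟩ * _
    rw [hz, h3]
  rw [zero_div, mul_zero, mul_zero, add_zero] at h4
  change (s.wave x₀ G k (0, x)).re = _
  rw [h4, Complex.ofReal_re]

theorem Scale.isSolution_field (hconj : ∀ k, conjAlg d (G k) = G k)
    {A : Fin d → ℝ × Pos d × Val N → Matrix (Fin N) (Fin N) ℝ}
    {F : ℝ × Pos d × Val N → Val N} {U : Set (ℝ × Pos d × Val N)}
    (hA : ∀ j k l y, fa j k l y = A j (fromCoord x₀ y) k l)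
    (hF : ∀ k y, fb k y = F (fromCoord x₀ y) k)
    (hU : ∀ y : Coord d N → ℝ, ‖y‖ < a → fromCoord x₀ y ∈ U) {κ : ℝ} (hδ : 0 < δ) (hκ : κ < 1)
    (hrκ : r ^ 2 ≤ δ * (κ * s.T)) (hrρ : 4 * r ≤ s.ρ) (hr : 0 < r) :
    IsSolution A F U x₀ r δ (fun x => WithLp.toLp 2 fun k =>
      2 * η * (Complex.exp (s.angle (x - x₀) * Complex.I) * w k).re) (s.field x₀ G) := by
  obtain ⟨q, hq0, hq1, hsub⟩ := s.exists_closure_lens_subset_domain (x₀ := x₀) hδ hκ hrκ hrρ hr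
  have h₀ := s.isFree_mode η hw
  have hfw (p) (hp : p ∈ lens x₀ r δ) : fderivWithin ℝ (s.field x₀ G) (closure (lens x₀ r δ)) p =
      fderiv ℝ (s.field x₀ G) p :=
    (((s.contDiffOn_field hq0 hq1 x₀ G).contDiffAt ((s.isOpen_domain x₀ q).mem_nhds
      (hsub (subset_closure hp)))).differentiableAt one_ne_zero).fderivWithin
      (uniqueDiffOn_closure_lens hr hδ p (subset_closure hp))
  refine ⟨(s.contDiffOn_field hq0 hq1 x₀ G).mono hsub, fun p hp => ?_, fun p hp k => ?_, ?_⟩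
  · rw [← fromCoord_toCoord x₀]
    refine hU _ ((s.norm_toCoord_le hq1 hf hG h₀ hsol hconj (hsub (subset_closure hp)) hp.1
      ).trans_lt (hG.trans_le (div_le_self a.coe_nonneg ?_)))
    linarith [(Nat.cast_nonneg (Fintype.card (Coord d N)) : (0 : ℝ) ≤ _)]
  · rw [hfw p hp, s.field_equation hq0 hq1 hf hG h₀ hsol hconj (hsub (subset_closure hp)) hp.1 k,
      hF, fromCoord_toCoord]
    simp only [hA, fromCoord_toCoord]
  · refine (ae_restrict_iff' Metric.isOpen_ball.measurableSet).2 (ae_of_all _ fun x hx => ?_)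
    have hp : (0, x) ∈ lens x₀ r δ := by
      refine ⟨le_rfl, ?_⟩
      rw [mem_ball_iff_norm] at hx
      simp only [mul_zero, add_zero]
      gcongr
    ext k
    exact s.field_zero hf hG hw hsol hq1 (hsub (subset_closure hp)) k

end Solution

/-! ### Sobolev norms of plane waves -/

section WeakDerivatives

variable {d N : ℕ} {B : Set (Pos d)}

theorem IsWeakDeriv.ae_eq (hB : IsOpen B) (hB' : volume B ≠ ⊤) {β : Fin d → ℕ}
    {h g g' : Pos d → Val N} (hg : IsWeakDeriv B β h g) (hg' : IsWeakDeriv B β h g') :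
    g =ᵐ[volume.restrict B] g' := by
  have : IsFiniteMeasure (volume.restrict B) := isFiniteMeasure_restrict.2 hB'
  have h1 : Integrable g (volume.restrict B) := hg.1.integrable one_le_two
  have h2 : Integrable g' (volume.restrict B) := hg'.1.integrable one_le_two
  have h3 := hB.ae_eq_zero_of_integral_contDiff_smul_eq_zero (μ := volume.restrict B) (f := g - g')
    ((h1.sub h2).locallyIntegrable.locallyIntegrableOn B) fun φ hφ hφc hφB => by
      have e1 := hg.2 φ hφ hφc hφB
      rw [hg'.2 φ hφ hφc hφB] at e1
      have i1 := h1.locallyIntegrable.integrable_smul_left_of_hasCompactSupport hφ.continuous hφc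
      have i2 := h2.locallyIntegrable.integrable_smul_left_of_hasCompactSupport hφ.continuous hφc
      have e2 : ∫ x in B, φ x • g' x = ∫ x in B, φ x • g x :=
        smul_right_injective _ (pow_ne_zero _ (by norm_num : (-1 : ℝ) ≠ 0)) e1
      simp only [Pi.sub_apply, smul_sub]
      rw [integral_sub i1 i2, e2, sub_self]
  filter_upwards [h3, ae_restrict_mem hB.measurableSet] with x hx hxB
  exact sub_eq_zero.1 (hx hxB)

theorem IsWeakDeriv.weakDeriv_ae_eq (hB : IsOpen B) (hB' : volume B ≠ ⊤) {β : Fin d → ℕ}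
    {h g : Pos d → Val N} (hg : IsWeakDeriv B β h g) :
    weakDeriv B β h =ᵐ[volume.restrict B] g := by
  have H : ∃ g, IsWeakDeriv B β h g := ⟨g, hg⟩
  rw [weakDeriv, dif_pos H]
  exact H.choose_spec.ae_eq hB hB' hg

/-- `weakDeriv` is obtained by choice; uniqueness almost everywhere allows its norm to be computed
from any explicit weak derivative. -/
theorem IsWeakDeriv.l2Norm_weakDeriv (hB : IsOpen B) (hB' : volume B ≠ ⊤) {β : Fin d → ℕ}
    {h g : Pos d → Val N} (hg : IsWeakDeriv B β h g) :
    l2Norm B (weakDeriv B β h) = l2Norm B g := by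
  rw [l2Norm, l2Norm, eLpNorm_congr_ae (hg.weakDeriv_ae_eq hB hB')]

theorem isWeakDeriv_zero (B : Set (Pos d)) (β : Fin d → ℕ) :
    IsWeakDeriv B β (0 : Pos d → Val N) 0 :=
  ⟨MemLp.zero, fun φ _ _ _ => by simp⟩

theorem memSobolev_zero (m : ℕ) (B : Set (Pos d)) : MemSobolev m B (0 : Pos d → Val N) :=
  ⟨MemLp.zero, fun β _ => ⟨0, isWeakDeriv_zero B β⟩⟩

theorem sobolevNorm_zero (hB : IsOpen B) (hB' : volume B ≠ ⊤) (m : ℕ) :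
    sobolevNorm m B (0 : Pos d → Val N) = 0 := by
  have h (β : Fin d → ℕ) : l2Norm B (weakDeriv B β (0 : Pos d → Val N)) = 0 := by
    rw [(isWeakDeriv_zero B β).l2Norm_weakDeriv hB hB']
    simp [l2Norm]
  simp [sobolevNorm, h]

theorem multiDeriv_zero (φ : Pos d → ℝ) : multiDeriv 0 φ = φ := by
  rw [multiDeriv]
  induction List.finRange d with
  | nil => rfl
  | cons j l ih => rw [List.foldr_cons, ih]; rfl

theorem l2Norm_le_sobolevNorm (hB : IsOpen B) (hB' : volume B ≠ ⊤) (m : ℕ) {h : Pos d → Val N}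
    (hh : MemLp h 2 (volume.restrict B)) : l2Norm B h ≤ sobolevNorm m B h := by
  have h0 : IsWeakDeriv B 0 h h := ⟨hh, fun φ _ _ _ => by simp [multiDeriv_zero]⟩
  rw [← h0.l2Norm_weakDeriv hB hB', sobolevNorm]
  refine Real.le_sqrt_of_sq_le ?_
  have hnn : ∀ k ∈ Finset.range (m + 1), 0 ≤ ∑ β ∈ Finset.piAntidiag (Finset.univ : Finset (Fin d))
      k, l2Norm B (weakDeriv B β h) ^ 2 := fun k _ => Finset.sum_nonneg fun β _ => sq_nonneg _
  refine le_trans ?_ (Finset.single_le_sum hnn (Finset.mem_range.2 m.succ_pos))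
  refine Finset.single_le_sum (f := fun β => l2Norm B (weakDeriv B β h) ^ 2)
    (fun β _ => sq_nonneg _) ?_
  simp

theorem sobolevNorm_le {h : Pos d → Val N} {m : ℕ} {M : ℝ}
    (hM : ∀ β : Fin d → ℕ, ∑ j, β j ≤ m → l2Norm B (weakDeriv B β h) ≤ M) :
    sobolevNorm m B h ≤ Real.sqrt (∑ k ∈ Finset.range (m + 1),
      (Finset.piAntidiag (Finset.univ : Finset (Fin d)) k).card) * M := by
  have hM0 : 0 ≤ M := ENNReal.toReal_nonneg.trans (hM 0 (by simp))
  rw [← Real.sqrt_sq hM0, ← Real.sqrt_mul (by positivity), sobolevNorm, Finset.sum_mul]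
  refine Real.sqrt_le_sqrt (Finset.sum_le_sum fun k hk => ?_)
  rw [← nsmul_eq_mul]
  refine Finset.sum_le_card_nsmul _ _ _ fun β hβ => ?_
  rw [Finset.mem_range] at hk
  have h1 : ∑ j, β j = k := (Finset.mem_piAntidiag.1 hβ).1
  have h2 : 0 ≤ l2Norm B (weakDeriv B β h) := ENNReal.toReal_nonneg
  gcongr
  exact hM β (by omega)

end WeakDerivatives

/-! ### Plane waves and their weak derivatives -/

section PlaneWaves

variable {d N : ℕ}

/-- The real part of a plane wave. -/
noncomputable def planeWave (x₀ : Pos d) (ζ : Fin d → ℝ) (c : Fin N → ℂ) (x : Pos d) : Val N :=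
  WithLp.toLp 2 fun k => (Complex.exp ((∑ j, ζ j * (x j - x₀ j) : ℝ) * Complex.I) * c k).re

variable (x₀ : Pos d) (ζ : Fin d → ℝ) (c : Fin N → ℂ)

theorem continuous_planeWave : Continuous (planeWave x₀ ζ c) := by
  unfold planeWave
  fun_prop

theorem norm_planeWave_le (x : Pos d) : ‖planeWave x₀ ζ c x‖ ≤ Real.sqrt N * ‖c‖ := by
  rw [EuclideanSpace.norm_eq, ← Real.sqrt_sq (norm_nonneg c), ← Real.sqrt_mul (Nat.cast_nonneg N)]
  refine Real.sqrt_le_sqrt ?_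
  calc ∑ k, ‖planeWave x₀ ζ c x k‖ ^ 2 ≤ ∑ _k : Fin N, ‖c‖ ^ 2 := by
        refine Finset.sum_le_sum fun k _ => ?_
        gcongr
        refine (Complex.abs_re_le_norm _).trans ?_
        rw [norm_mul, Complex.norm_exp_ofReal_mul_I, one_mul]
        exact norm_le_pi_norm c k
    _ = _ := by simp

/-- Complex amplitudes make the family stable under differentiation, which becomes multiplication of
the amplitude by `i ζ_j`. -/
theorem hasLineDerivAt_planeWave (j : Fin d) (x : Pos d) :
    HasLineDerivAt ℝ (planeWave x₀ ζ c) (planeWave x₀ ζ ((Complex.I * ζ j) • c) x) x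
      (EuclideanSpace.single j 1) := by
  have h1 : HasDerivAt (fun h : ℝ => ∑ i, ζ i * ((x + h • EuclideanSpace.single j 1 : Pos d) i - x₀ i))
      (ζ j) 0 := by
    have h2 (i : Fin d) : HasDerivAt
        (fun h : ℝ => ζ i * ((x + h • EuclideanSpace.single j 1 : Pos d) i - x₀ i))
        (ζ i * (EuclideanSpace.single j (1 : ℝ) : Pos d) i) 0 := by
      simpa using ((((hasDerivAt_id (0 : ℝ)).mul_const
        ((EuclideanSpace.single j (1 : ℝ) : Pos d) i)).const_add (x i)).sub_const
          (x₀ i)).const_mul (ζ i)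
    refine (HasDerivAt.fun_sum fun i _ => h2 i).congr_deriv ?_
    simp
  have h3 := (h1.ofReal_comp.mul_const Complex.I).cexp
  change HasDerivAt _ _ _
  refine ((PiLp.continuousLinearEquiv 2 ℝ (fun _ : Fin N => ℝ)).symm.toContinuousLinearMap
    |>.hasFDerivAt).comp_hasDerivAt 0 (hasDerivAt_pi.2 fun k => ?_)
  have h4 := Complex.reCLM.hasFDerivAt.comp_hasDerivAt (0 : ℝ) (h3.mul_const (c k))
  refine h4.congr_deriv ?_
  simp only [zero_smul, add_zero, Pi.smul_apply, smul_eq_mul, Complex.reCLM_apply]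
  congr 1
  ring

theorem contDiff_pderiv {φ : Pos d → ℝ} (hφ : ContDiff ℝ ∞ φ) (j : Fin d) :
    ContDiff ℝ ∞ (pderiv j φ) :=
  (hφ.fderiv_right (m := ∞) (by simp)).clm_apply contDiff_const

theorem hasCompactSupport_pderiv {φ : Pos d → ℝ} (hφ : HasCompactSupport φ) (j : Fin d) :
    HasCompactSupport (pderiv j φ) :=
  hφ.fderiv_apply ℝ _

theorem integral_pderiv_smul_planeWave {φ : Pos d → ℝ} (hφ : ContDiff ℝ ∞ φ)
    (hφc : HasCompactSupport φ) (j : Fin d) :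
    ∫ x, pderiv j φ x • planeWave x₀ ζ c x =
      -∫ x, φ x • planeWave x₀ ζ ((Complex.I * ζ j) • c) x := by
  have hint {ψ : Pos d → ℝ} (hψ : Continuous ψ) (hψc : HasCompactSupport ψ) (c : Fin N → ℂ) :
      Integrable fun x => ψ x • planeWave x₀ ζ c x :=
    (hψ.smul (continuous_planeWave x₀ ζ c)).integrable_of_hasCompactSupport hψc.smul_right
  have h := integral_bilinear_hasLineDerivAt_right_eq_neg_left_of_integrable (μ := volume)
    (f := φ) (f' := pderiv j φ) (g := planeWave x₀ ζ c)
    (g' := planeWave x₀ ζ ((Complex.I * ζ j) • c)) (v := EuclideanSpace.single j 1)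
    (B := ContinuousLinearMap.lsmul ℝ ℝ)
    (hint (contDiff_pderiv hφ j).continuous (hasCompactSupport_pderiv hφc j) c)
    (hint hφ.continuous hφc _) (hint hφ.continuous hφc c)
    (fun x _ => ((hφ.differentiable (by simp)) x).hasFDerivAt.hasLineDerivAt _)
    (fun x _ => hasLineDerivAt_planeWave x₀ ζ c j x)
  simp only [ContinuousLinearMap.lsmul_apply] at h
  rw [h, neg_neg]

theorem iterate_pderiv {φ : Pos d → ℝ} (hφ : ContDiff ℝ ∞ φ) (hφc : HasCompactSupport φ)
    (j : Fin d) (n : ℕ) (c : Fin N → ℂ) :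
    ContDiff ℝ ∞ ((pderiv j)^[n] φ) ∧ HasCompactSupport ((pderiv j)^[n] φ) ∧
      ∫ x, (pderiv j)^[n] φ x • planeWave x₀ ζ c x =
        (-1 : ℝ) ^ n • ∫ x, φ x • planeWave x₀ ζ ((Complex.I * ζ j) ^ n • c) x := by
  induction n generalizing φ with
  | zero => simp [hφ, hφc]
  | succ n ih =>
    obtain ⟨h1, h2, h3⟩ := ih (contDiff_pderiv hφ j) (hasCompactSupport_pderiv hφc j)
    rw [Function.iterate_succ_apply]
    refine ⟨h1, h2, ?_⟩
    rw [h3, integral_pderiv_smul_planeWave x₀ ζ _ hφ hφc, smul_smul, pow_succ, pow_succ', smul_neg]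
    simp [neg_smul]

/-- Induction along the fold that defines `multiDeriv`, for all amplitudes at once, because each
integration by parts changes the amplitude. The scalar factors commute, so their order does not
matter. -/
theorem foldr_pderiv {φ : Pos d → ℝ} (hφ : ContDiff ℝ ∞ φ) (hφc : HasCompactSupport φ)
    (β : Fin d → ℕ) (l : List (Fin d)) (c : Fin N → ℂ) :
    ContDiff ℝ ∞ (l.foldr (fun j f => (pderiv j)^[β j] f) φ) ∧
      HasCompactSupport (l.foldr (fun j f => (pderiv j)^[β j] f) φ) ∧
      ∫ x, l.foldr (fun j f => (pderiv j)^[β j] f) φ x • planeWave x₀ ζ c x =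
        (-1 : ℝ) ^ (l.map β).sum •
          ∫ x, φ x • planeWave x₀ ζ ((l.map fun j => (Complex.I * ζ j) ^ β j).prod • c) x := by
  induction l generalizing c with
  | nil => simp [hφ, hφc]
  | cons j l ih =>
    have ih' := ih ((Complex.I * ζ j) ^ β j • c)
    obtain ⟨h1, h2, h3⟩ := iterate_pderiv x₀ ζ ih'.1 ih'.2.1 j (β j) c
    refine ⟨h1, h2, ?_⟩
    rw [List.foldr_cons, h3, ih'.2.2, List.map_cons, List.sum_cons, List.map_cons, List.prod_cons,
      smul_smul, smul_smul, pow_add, mul_comm (List.prod _)]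

theorem tsupport_multiDeriv_subset (β : Fin d → ℕ) (φ : Pos d → ℝ) :
    tsupport (multiDeriv β φ) ⊆ tsupport φ := by
  have h1 (j : Fin d) (φ : Pos d → ℝ) : tsupport (pderiv j φ) ⊆ tsupport φ :=
    tsupport_fderiv_apply_subset ℝ _
  have h2 (j : Fin d) (n : ℕ) (φ : Pos d → ℝ) : tsupport ((pderiv j)^[n] φ) ⊆ tsupport φ := by
    induction n generalizing φ with
    | zero => exact subset_rfl
    | succ n ih => exact (ih _).trans (h1 j φ)
  rw [multiDeriv]
  induction List.finRange d with
  | nil => exact subset_rfl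
  | cons j l ih => exact (h2 _ _ _).trans ih

theorem memLp_planeWave {B : Set (Pos d)} (hB' : volume B ≠ ⊤) :
    MemLp (planeWave x₀ ζ c) 2 (volume.restrict B) := by
  have : IsFiniteMeasure (volume.restrict B) := isFiniteMeasure_restrict.2 hB'
  exact MemLp.of_bound (continuous_planeWave x₀ ζ c).aestronglyMeasurable _
    (ae_of_all _ (norm_planeWave_le x₀ ζ c))

theorem isWeakDeriv_planeWave {B : Set (Pos d)} (hB' : volume B ≠ ⊤) (β : Fin d → ℕ) :
    IsWeakDeriv B β (planeWave x₀ ζ c)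
      (planeWave x₀ ζ ((∏ j, (Complex.I * ζ j) ^ β j) • c)) := by
  refine ⟨memLp_planeWave _ _ _ hB', fun φ hφ hφc hφB => ?_⟩
  have h0 {ψ : Pos d → ℝ} (hψ : tsupport ψ ⊆ B) (c : Fin N → ℂ) :
      ∫ x in B, ψ x • planeWave x₀ ζ c x = ∫ x, ψ x • planeWave x₀ ζ c x := by
    refine setIntegral_eq_integral_of_forall_compl_eq_zero fun x hx => ?_
    rw [image_eq_zero_of_notMem_tsupport fun h => hx (hψ h), zero_smul]
  rw [h0 ((tsupport_multiDeriv_subset β φ).trans hφB), h0 hφB, Fin.sum_univ_def, Fin.prod_univ_def]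
  exact (foldr_pderiv x₀ ζ hφ hφc β (List.finRange d) c).2.2

theorem memSobolev_planeWave {B : Set (Pos d)} (hB' : volume B ≠ ⊤) (m : ℕ) :
    MemSobolev m B (planeWave x₀ ζ c) :=
  ⟨memLp_planeWave _ _ _ hB', fun β _ => ⟨_, isWeakDeriv_planeWave x₀ ζ c hB' β⟩⟩

theorem l2Norm_planeWave_le {B : Set (Pos d)} (hB' : volume B ≠ ⊤) :
    l2Norm B (planeWave x₀ ζ c) ≤
      (volume B ^ (1 / 2 : ℝ)).toReal * (Real.sqrt N * ‖c‖) := by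
  have h := eLpNorm_le_of_ae_bound (μ := volume.restrict B) (p := 2)
    (ae_of_all _ (norm_planeWave_le x₀ ζ c))
  have h0 : 0 ≤ Real.sqrt N * ‖c‖ := by positivity
  rw [← ENNReal.toReal_ofReal h0, ← ENNReal.toReal_mul, l2Norm]
  refine ENNReal.toReal_mono (ENNReal.mul_ne_top (ENNReal.rpow_ne_top_of_nonneg (by norm_num) hB')
    ENNReal.ofReal_ne_top) (h.trans_eq ?_)
  simp

/-- The Sobolev norms of plane waves grow like a power of the frequency. -/
theorem exists_sobolevNorm_planeWave_le (N : ℕ) {B : Set (Pos d)} (hB : IsOpen B)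
    (hB' : volume B ≠ ⊤) (m : ℕ) : ∃ K > 0, ∀ (ζ : Fin d → ℝ) (c : Fin N → ℂ) (Z : ℝ), 1 ≤ Z →
      (∀ j, |ζ j| ≤ Z) → sobolevNorm m B (planeWave x₀ ζ c) ≤ K * (‖c‖ * Z ^ m) := by
  set K := Real.sqrt (∑ k ∈ Finset.range (m + 1),
    ((Finset.piAntidiag (Finset.univ : Finset (Fin d)) k).card : ℝ)) *
      ((volume B ^ (1 / 2 : ℝ)).toReal * Real.sqrt N) with hK
  have hK0 : 0 ≤ K := mul_nonneg (Real.sqrt_nonneg _)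
    (mul_nonneg ENNReal.toReal_nonneg (Real.sqrt_nonneg _))
  refine ⟨K + 1, by linarith, fun ζ c Z hZ hζ => ?_⟩
  have h1 := sobolevNorm_le (B := B) (h := planeWave x₀ ζ c) (m := m)
    (M := (volume B ^ (1 / 2 : ℝ)).toReal * (Real.sqrt N * (‖c‖ * Z ^ m))) fun β hβ => by
      rw [(isWeakDeriv_planeWave x₀ ζ c hB' β).l2Norm_weakDeriv hB hB']
      refine (l2Norm_planeWave_le x₀ ζ _ hB').trans ?_
      have h2 : ‖(∏ j, (Complex.I * ζ j) ^ β j) • c‖ ≤ ‖c‖ * Z ^ m := by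
        rw [norm_smul, mul_comm, norm_prod]
        refine mul_le_mul_of_nonneg_left ?_ (norm_nonneg c)
        calc ∏ j, ‖(Complex.I * ζ j) ^ β j‖ ≤ ∏ j, Z ^ β j := by
              refine Finset.prod_le_prod (fun _ _ => norm_nonneg _) fun j _ => ?_
              rw [norm_pow, norm_mul, Complex.norm_I, one_mul, Complex.norm_real]
              exact pow_le_pow_left₀ (norm_nonneg _) (hζ j) _
          _ = Z ^ ∑ j, β j := Finset.prod_pow_eq_pow_sum _ _ _
          _ ≤ Z ^ m := pow_le_pow_right₀ hZ hβ
      gcongr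
  have h3 : 0 ≤ ‖c‖ * Z ^ m := by positivity
  calc _ ≤ _ := h1
    _ = K * (‖c‖ * Z ^ m) := by rw [hK]; ring
    _ ≤ _ := by nlinarith

/-- The phase vanishes at `x₀`, so the `k`-th component there is `Re (c k) ≠ 0`. A continuous
function vanishing almost everywhere on an open set would vanish at `x₀`. -/
theorem sobolevNorm_planeWave_pos {B : Set (Pos d)} (hB : IsOpen B)
    (hB' : volume B ≠ ⊤) (hx : x₀ ∈ B) (m : ℕ) {k : Fin N} (hk : (c k).re ≠ 0) :
    0 < sobolevNorm m B (planeWave x₀ ζ c) := by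
  refine lt_of_lt_of_le ?_ (l2Norm_le_sobolevNorm hB hB' m (memLp_planeWave x₀ ζ c hB'))
  refine ENNReal.toReal_pos (fun h => hk ?_) (memLp_planeWave x₀ ζ c hB').2.ne
  rw [eLpNorm_eq_zero_iff (continuous_planeWave x₀ ζ c).aestronglyMeasurable two_ne_zero] at h
  have h1 := Measure.eqOn_open_of_ae_eq h hB (continuous_planeWave x₀ ζ c).continuousOn
    continuousOn_const hx
  have h2 := congrArg (fun v : Val N => v k) h1
  simpa [planeWave] using h2

end PlaneWaves

/-! ### Exact solutions close to plane waves -/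

section ExactWaves

open Wiener

variable {d N : ℕ} {D : Symbol d N} {x₀ : Pos d}
  {fa : Fin d → Fin N → Fin N → (Coord d N → ℝ) → ℝ} {fb : Fin N → (Coord d N → ℝ) → ℝ}
  {a : NNReal} {R : ENNReal}

theorem Scale.planeWave_eq (s : Scale D) (η : ℝ) (w : Fin N → ℂ) :
    (fun x => WithLp.toLp 2 fun k =>
      2 * η * (Complex.exp (s.angle (x - x₀) * Complex.I) * w k).re) =
    planeWave x₀ (fun j => s.S / s.T * D.ξ j) (fun k => ((2 * η : ℝ) : ℂ) * w k) := by
  funext x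
  ext k
  simp only [planeWave, Scale.angle, PiLp.sub_apply]
  rw [mul_left_comm, Complex.re_ofReal_mul, Finset.mul_sum]
  simp only [mul_assoc]

/-- Exact solutions close to the plane wave solutions of the constant coefficient system. -/
theorem Symbol.exists_wave (hf : D.Represents fa fb a R) (ha : 0 < a) {lam : ℂ} {w : Fin N → ℂ}
    (hw : ∀ k, ∑ l, (D.A₀ k l : ℂ) * w l = lam * w k)
    {A : Fin d → ℝ × Pos d × Val N → Matrix (Fin N) (Fin N) ℝ}
    {F : ℝ × Pos d × Val N → Val N} {U : Set (ℝ × Pos d × Val N)}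
    (hA : ∀ j k l y, fa j k l y = A j (fromCoord x₀ y) k l)
    (hF : ∀ k y, fb k y = F (fromCoord x₀ y) k)
    (hU : ∀ y : Coord d N → ℝ, ‖y‖ < a → fromCoord x₀ y ∈ U) (H : ℝ) :
    ∃ ν₁ C : ℝ, 0 < ν₁ ∧ 0 < C ∧ ∀ (s : Scale D) (ν η r δ κ : ℝ), ν ≤ ν₁ →
      s.S * (s.Γ - D.c * s.S)⁻¹ ≤ H → s.T ≤ ν → s.ρ ≤ ν → s.T / s.ρ ≤ ν → 0 ≤ η →
      -lam.im * s.S ≤ s.Γ → 4 * ((s.Γ - D.c * s.S) * (η * Real.exp s.Γ * ‖w‖)) ≤ ν →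
      0 < δ → κ < 1 → r ^ 2 ≤ δ * (κ * s.T) → 4 * r ≤ s.ρ → 0 < r →
      ∃ u, IsSolution A F U x₀ r δ (planeWave x₀ (fun j => s.S / s.T * D.ξ j)
          (fun k => ((2 * η : ℝ) : ℂ) * w k)) u ∧
        ∀ p ∈ lens x₀ r δ, ∀ k, |u p k - 2 * η * (Complex.exp
          ((s.angle (p.2 - x₀) + lam * (s.S * (p.1 / s.T))) * Complex.I) * w k).re| ≤
          Real.exp (s.Γ * (p.1 / s.T)) * (C * ν * ((s.Γ - D.c * s.S) * (η * ‖w‖))) := by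
  obtain ⟨ν₀, C, hν₀, hC, hsol⟩ := D.exists_solution
    (fun j k l => bot_le.trans_lt (hf.radiusBound.coef j k l))
    (fun k => bot_le.trans_lt (hf.radiusBound.source k)) H
  have hcard : 0 < (Fintype.card (Coord d N) : ℝ) + 1 := by positivity
  have ha' : 0 < (a : ℝ) := by exact_mod_cast ha
  -- The second bound keeps the coordinates strictly inside the ball of convergence; the factor in
  -- `C * 2` is that of `Scale.norm_mode_le`.
  refine ⟨min ν₀ (a / (Fintype.card (Coord d N) + 1) / 2), C * 2, lt_min hν₀ (by positivity),
    by positivity, fun s ν η r δ κ hν hH hT hρ hTρ hη hlam hG₀ hδ hκ hrκ hrρ hr => ?_⟩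
  have hmode := s.norm_mode_le η (lam := lam) (r := w) hη hlam
  obtain ⟨G, h1, h2, h3, h4⟩ := hsol s ν (s.mode η lam w) (hν.trans (min_le_left _ _)) hH hT hρ hTρ
    (by linarith)
  have hG : ‖s.coords G‖ < a / (Fintype.card (Coord d N) + 1) := by
    refine (s.norm_coords_le hT hρ (by linarith)).trans_lt ((hν.trans (min_le_right _ _)).trans_lt ?_)
    exact half_lt_self (by positivity)
  refine ⟨s.field x₀ G, ?_, fun p hp k => ?_⟩
  · rw [← s.planeWave_eq]
    exact s.isSolution_field hf hG hw h1
      (s.conjAlg_eq hf.radiusBound hG (s.conjAlg_mode η lam w) h1 h2 h4) hA hF hU hδ hκ hrκ hrρ hr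
  · obtain ⟨q, -, hq1, hsub⟩ := s.exists_closure_lens_subset_domain (x₀ := x₀) hδ hκ hrκ hrρ hr
    refine (s.norm_field_sub_le hf hG hw h1 hq1 (hsub (subset_closure hp)) hp.1 k).trans ?_
    have hν0 : 0 < ν := s.T_pos.trans_le hT
    -- The decay of the exponentials cancels the `exp Γ` of the modes, so the error grows exactly
    -- like `exp (Γ τ)`.
    have h5 : Real.exp (s.Γ * (p.1 / s.T - 1)) * Real.exp s.Γ = Real.exp (s.Γ * (p.1 / s.T)) := by
      rw [← Real.exp_add]
      congr 1
      ring
    calc _ ≤ Real.exp (s.Γ * (p.1 / s.T - 1)) *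
          (C * ν * (2 * ((s.Γ - D.c * s.S) * (η * Real.exp s.Γ * ‖w‖)))) := by
          gcongr
          exact h3.trans (by gcongr)
      _ = (Real.exp (s.Γ * (p.1 / s.T - 1)) * Real.exp s.Γ) *
          (C * 2 * ν * ((s.Γ - D.c * s.S) * (η * ‖w‖))) := by ring
      _ = _ := by rw [h5]

end ExactWaves

/-! ### `L²` norms on lenses -/

section LowerBound

theorem le_l2Norm {X : Type*} [MeasureSpace X] {N : ℕ} {S B : Set X} {u : X → Val N} {b : ℝ}
    (hu : MemLp u 2 (volume.restrict S)) (hB : MeasurableSet B) (hBS : B ⊆ S) (hb : 0 ≤ b)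
    (h : ∀ p ∈ B, b ≤ ‖u p‖) : b * Real.sqrt (volume B).toReal ≤ l2Norm S u := by
  have h1 : eLpNorm (fun _ : X => b) 2 (volume.restrict B) ≤ eLpNorm u 2 (volume.restrict S) := by
    refine le_trans (eLpNorm_mono_ae ?_) (eLpNorm_mono_measure u (Measure.restrict_mono hBS le_rfl))
    filter_upwards [ae_restrict_mem hB] with p hp
    rw [Real.norm_of_nonneg hb]
    exact h p hp
  have h2 := ENNReal.toReal_mono hu.2.ne h1
  rw [eLpNorm_const' _ two_ne_zero ENNReal.ofNat_ne_top, ENNReal.toReal_mul,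
    ← ENNReal.toReal_rpow, Measure.restrict_apply_univ] at h2
  rw [Real.sqrt_eq_rpow]
  simpa [l2Norm, Real.norm_of_nonneg hb] using h2

theorem l2Norm_le {X : Type*} [MeasureSpace X] {N : ℕ} {S : Set X} {u : X → Val N} {b : ℝ}
    (hS : MeasurableSet S) (hS' : volume S ≠ ⊤) (hb : 0 ≤ b) (h : ∀ p ∈ S, ‖u p‖ ≤ b) :
    l2Norm S u ≤ b * Real.sqrt (volume S).toReal := by
  have h1 := eLpNorm_le_of_ae_bound (μ := volume.restrict S) (p := 2) (f := u) (C := b) (by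
    filter_upwards [ae_restrict_mem hS] with p hp using h p hp)
  rw [Measure.restrict_apply_univ] at h1
  rw [l2Norm, Real.sqrt_eq_rpow, ENNReal.toReal_rpow, ← ENNReal.toReal_ofReal hb,
    ← ENNReal.toReal_mul, mul_comm]
  refine ENNReal.toReal_mono (ENNReal.mul_ne_top (ENNReal.rpow_ne_top_of_nonneg (by norm_num) hS')
    ENNReal.ofReal_ne_top) (h1.trans_eq ?_)
  simp

variable {d N : ℕ} {x₀ : Pos d} {r δ : ℝ}

theorem measurableSet_lens (x₀ : Pos d) (r δ : ℝ) : MeasurableSet (lens x₀ r δ) :=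
  (isClosed_le continuous_const continuous_fst).measurableSet.inter
    (isOpen_lt (continuous_lens x₀ δ) continuous_const).measurableSet

theorem closure_lens_subset_prod (hr : 0 ≤ r) (hδ : 0 < δ) :
    closure (lens x₀ r δ) ⊆ Set.Icc 0 (r ^ 2 / δ) ×ˢ Metric.closedBall x₀ r := by
  intro p hp
  obtain ⟨h0, h1⟩ := closure_lens_subset x₀ r δ hp
  refine ⟨⟨h0, ?_⟩, ?_⟩
  · rw [le_div_iff₀ hδ]
    nlinarith [sq_nonneg ‖p.2 - x₀‖]
  · rw [mem_closedBall_iff_norm]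
    refine (abs_le_of_sq_le_sq' ?_ hr).2
    nlinarith [mul_nonneg hδ.le h0]

theorem isCompact_closure_lens (hr : 0 ≤ r) (hδ : 0 < δ) : IsCompact (closure (lens x₀ r δ)) :=
  (isCompact_Icc.prod (isCompact_closedBall x₀ r)).of_isClosed_subset isClosed_closure
    (closure_lens_subset_prod hr hδ)

theorem volume_lens_ne_top (hr : 0 ≤ r) (hδ : 0 < δ) : volume (lens x₀ r δ) ≠ ⊤ :=
  ((measure_mono subset_closure).trans_lt (isCompact_closure_lens hr hδ).measure_lt_top).ne

theorem memLp_lens {u : ℝ × Pos d → Val N} (hr : 0 ≤ r) (hδ : 0 < δ)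
    (hu : ContinuousOn u (closure (lens x₀ r δ))) : MemLp u 2 (volume.restrict (lens x₀ r δ)) := by
  obtain ⟨C, hC⟩ := (isCompact_closure_lens hr hδ).exists_bound_of_continuousOn hu
  have : IsFiniteMeasure (volume.restrict (lens x₀ r δ)) :=
    isFiniteMeasure_restrict.2 (volume_lens_ne_top hr hδ)
  refine MemLp.of_bound ((hu.mono subset_closure).aestronglyMeasurable (measurableSet_lens _ _ _)) C
    ?_
  filter_upwards [ae_restrict_mem (measurableSet_lens x₀ r δ)] with p hp
  exact hC p (subset_closure hp)

end LowerBound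

/-! ### High frequency asymptotics -/

section Asymptotics

theorem eventually_mul_pow_mul_exp_le (C : ℝ) (n : ℕ) {p e : ℝ} (hp : 0 < p) (he : 0 < e) :
    ∀ᶠ L : ℝ in atTop, C * (L ^ n * Real.exp (-p * L)) ≤ e := by
  have h := (tendsto_rpow_mul_exp_neg_mul_atTop_nhds_zero n p hp).const_mul C
  rw [mul_zero] at h
  filter_upwards [h.eventually_le_const he] with L hL
  rwa [Real.rpow_natCast] at hL

theorem re_exp_mul_I (x s : ℝ) (lam : ℂ) :
    (Complex.exp ((x + lam * s) * Complex.I)).re =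
      Real.exp (-lam.im * s) * Real.cos (x + lam.re * s) := by
  simp [Complex.exp_re]

variable {d N : ℕ} {D : Symbol d N} {x₀ : Pos d}
  {fa : Fin d → Fin N → Fin N → (Coord d N → ℝ) → ℝ} {fb : Fin N → (Coord d N → ℝ) → ℝ}
  {a : NNReal} {R : ENNReal}

theorem abs_sum_mul_le (ξ : Fin d → ℝ) (z : Pos d) :
    |∑ j, ξ j * z j| ≤ (∑ j, |ξ j|) * ‖z‖ := by
  rw [Finset.sum_mul]
  refine (Finset.abs_sum_le_sum_abs _ _).trans (Finset.sum_le_sum fun j _ => ?_)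
  rw [abs_mul]
  exact mul_le_mul_of_nonneg_left (PiLp.norm_apply_le z j) (abs_nonneg _)

theorem volume_box (y : Pos d) {t c e : ℝ} (hc : 0 < c) (he : 0 < e) :
    (volume (Set.Icc (e * t) (e * (t + c)) ×ˢ Metric.ball y (c * e))).toReal =
      c ^ (d + 1) * (volume (Metric.ball (0 : Pos d) 1)).toReal * e ^ (d + 1) := by
  have h0 : 0 ≤ e * c := by positivity
  have h1 : 0 ≤ (c * e) ^ d := by positivity
  have h2 : e * (t + c) - e * t = e * c := by ring
  have h3 : (volume : Measure (ℝ × Pos d)) = (volume : Measure ℝ).prod volume := rfl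
  rw [h3, Measure.prod_prod, Real.volume_Icc, Measure.addHaar_ball_of_pos _ _ (by positivity), h2,
    ENNReal.toReal_mul, ENNReal.toReal_mul, ENNReal.toReal_ofReal h0, finrank_euclideanSpace_fin,
    ENNReal.toReal_ofReal h1]
  ring

/-- Here `α` stands for the real part of the eigenvalue and `t` for the fast time. The centre is a
point where the phase vanishes at time `t₀`, and `c` is so small that the phase varies by at most
one over the box. -/
theorem abs_phase_le {ξ : Fin d → ℝ} {α e E c t₀ t : ℝ} {x : Pos d} (hξ : 0 < ∑ j, ξ j ^ 2)
    (hE : 0 < E) (hEe : E * e = 1) (hc : c * (1 + ∑ j, |ξ j| + |α|) = 1) (hc0 : 0 < c)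
    (hx : ‖x - (x₀ - (α * t₀ * e / ∑ j, ξ j ^ 2) • WithLp.toLp 2 ξ)‖ ≤ c * e)
    (ht : |t - t₀| ≤ c) : |E * ∑ j, ξ j * (x - x₀) j + α * t| ≤ 1 := by
  set X := ∑ j, ξ j ^ 2 with hX
  set y : Pos d := x₀ - (α * t₀ * e / X) • WithLp.toLp 2 ξ with hy
  have h1 : ∑ j, ξ j * (x - x₀) j = ∑ j, ξ j * (x - y) j - α * t₀ * e / X * X := by
    rw [hX, Finset.mul_sum, ← Finset.sum_sub_distrib]
    refine Finset.sum_congr rfl fun j _ => ?_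
    simp only [hy, PiLp.sub_apply, PiLp.smul_apply, smul_eq_mul]
    ring
  have h2 : E * ∑ j, ξ j * (x - x₀) j + α * t = E * ∑ j, ξ j * (x - y) j + α * (t - t₀) := by
    rw [h1, div_mul_cancel₀ _ hξ.ne']
    linear_combination (-α * t₀) * hEe
  have h3 : |E * ∑ j, ξ j * (x - y) j| ≤ (∑ j, |ξ j|) * c := by
    rw [abs_mul, abs_of_pos hE]
    calc E * |∑ j, ξ j * (x - y) j| ≤ E * ((∑ j, |ξ j|) * (c * e)) := by
          gcongr
          exact (abs_sum_mul_le _ _).trans (by gcongr)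
      _ = (E * e) * ((∑ j, |ξ j|) * c) := by ring
      _ = _ := by rw [hEe, one_mul]
  have h4 : |α * (t - t₀)| ≤ |α| * c := by
    rw [abs_mul]
    gcongr
  rw [h2]
  refine (abs_add_le _ _).trans ((add_le_add h3 h4).trans ?_)
  linarith

/-- The real part of the eigenvalue makes the crest drift by a distance of order `e L`. This is
negligible against the radius of the lens, of order `√(e L)`. -/
theorem norm_sub_le_of_near {ξ : Fin d → ℝ} {α e c b L : ℝ} {x : Pos d} (hξ : 0 < ∑ j, ξ j ^ 2)
    (he : 0 < e) (hb : 0 < b) (hL : 1 ≤ L) (hc : 0 < c)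
    (hx : ‖x - (x₀ - (α * (b * L) * e / ∑ j, ξ j ^ 2) • WithLp.toLp 2 ξ)‖ ≤ c * e) :
    ‖x - x₀‖ ≤ (|α| * b / (∑ j, ξ j ^ 2) * ‖(WithLp.toLp 2 ξ : Pos d)‖ + c) * (e * L) := by
  set X := ∑ j, ξ j ^ 2 with hX
  set v : Pos d := WithLp.toLp 2 ξ with hv
  have h1 : x - x₀ = (x - (x₀ - (α * (b * L) * e / X) • v)) - (α * (b * L) * e / X) • v := by
    abel
  have h2 : ‖(α * (b * L) * e / X) • v‖ = |α| * (b * L) * e / X * ‖v‖ := by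
    rw [norm_smul, Real.norm_eq_abs, abs_div, abs_mul, abs_mul, abs_of_pos hξ, abs_of_pos he,
      abs_of_pos (mul_pos hb (one_pos.trans_le hL))]
  have h3 : c * e ≤ c * (e * L) := by
    gcongr
    exact le_mul_of_one_le_right he.le hL
  rw [h1]
  refine (norm_sub_le _ _).trans ?_
  rw [h2]
  refine (add_le_add (hx.trans h3) le_rfl).trans_eq ?_
  ring

/-- A phase of modulus at most one has cosine at least `1/2`, so the main term is at least `η exp (γ
s)`, and the error takes at most half of it. -/
theorem le_of_abs_sub_le {η γ s t φ v e : ℝ} (hη : 0 < η) (hγ : 0 < γ) (hst : s ≤ t)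
    (hφ : |φ| ≤ 1) (hv : |v - 2 * η * (Real.exp (γ * t) * Real.cos φ)| ≤ e)
    (he : e ≤ η * Real.exp (γ * s) * (1 / 2)) : η * Real.exp (γ * s) / 2 ≤ v := by
  have hcos : 1 / 2 ≤ Real.cos φ := by
    refine le_trans ?_ Real.one_sub_sq_div_two_le_cos
    have := abs_le.1 hφ
    nlinarith
  have h1 : Real.exp (γ * s) ≤ Real.exp (γ * t) := Real.exp_le_exp.2 (by gcongr)
  have h2 : Real.exp (γ * s) * (1 / 2) ≤ Real.exp (γ * t) * Real.cos φ :=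
    mul_le_mul h1 hcos (by norm_num) (Real.exp_pos _).le
  have h3 := mul_le_mul_of_nonneg_left h2 hη.le
  have h4 := (abs_le.1 hv).1
  linarith

/-- The error grows at the rate `γ'` instead of `γ`. Over the fast time `b L` this costs only `exp
(L / 8)`, to be set against the gain `exp (-L / 2)` in the size of the error. -/
theorem exp_mul_le_of_le {γ γ' b c t L : ℝ} (hγ : 0 < γ') (hL : 0 < L)
    (hb : (γ' - γ) * b ≤ 1 / 8) (ht : t ≤ b * L + c) :
    Real.exp (γ' * t) ≤
      Real.exp (γ * (b * L)) * (Real.exp (1 / 8 * L) * Real.exp (γ' * c)) := by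
  rw [← Real.exp_add, ← Real.exp_add]
  refine Real.exp_le_exp.2 ?_
  have h1 := mul_le_mul_of_nonneg_left ht hγ.le
  have h2 := mul_le_mul_of_nonneg_right hb hL.le
  linarith

/-- Exact solutions close to the plane wave solutions, with an error that is small in comparison
with them for times up to a large multiple of their wave length. -/
theorem Symbol.exists_close_wave (hf : D.Represents fa fb a R) (ha : 0 < a) {lam : ℂ}
    {w : Fin N → ℂ} (hw : ∀ k, ∑ l, (D.A₀ k l : ℂ) * w l = lam * w k)
    {A : Fin d → ℝ × Pos d × Val N → Matrix (Fin N) (Fin N) ℝ}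
    {F : ℝ × Pos d × Val N → Val N} {U : Set (ℝ × Pos d × Val N)}
    (hA : ∀ j k l y, fa j k l y = A j (fromCoord x₀ y) k l)
    (hF : ∀ k y, fb k y = F (fromCoord x₀ y) k)
    (hU : ∀ y : Coord d N → ℝ, ‖y‖ < a → fromCoord x₀ y ∈ U)
    {γ γ' b₁ b₂ M δ : ℝ} (hlam : lam.im = -γ) (hγ : 0 < γ) (hγc : γ < D.c) (hcγ' : D.c < γ')
    (hb₂ : 0 < b₂) (hb₂₁ : b₂ < b₁) (hM : γ' * b₁ ≤ M - 1) (hδ : 0 < δ) :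
    ∃ C > 0, ∀ᶠ L : ℝ in atTop, ∃ u,
      IsSolution A F U x₀ (Real.sqrt (δ * (b₂ * (Real.exp (-L) * L)))) δ
        (planeWave x₀ (fun j => Real.exp L * D.ξ j)
          (fun k => ((2 * Real.exp (-M * L) : ℝ) : ℂ) * w k)) u ∧
      ∀ p ∈ lens x₀ (Real.sqrt (δ * (b₂ * (Real.exp (-L) * L)))) δ, ∀ k,
        |u p k - 2 * Real.exp (-M * L) * (Complex.exp (((Real.exp L *
          ∑ j, D.ξ j * (p.2 - x₀) j : ℝ) + lam * (Real.exp L * p.1 : ℝ)) * Complex.I) * w k).re| ≤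
          Real.exp (γ' * (Real.exp L * p.1)) *
            (C * (L ^ 2 * Real.exp (-(1 / 2) * L)) * Real.exp (-M * L)) := by
  have hb₁ : 0 < b₁ := hb₂.trans hb₂₁
  have hγ'0 : 0 < γ' := hγ.trans (hγc.trans hcγ')
  have hg : 0 < γ' - D.c := sub_pos.2 hcγ'
  obtain ⟨ν₁, C, hν₁, hC, hwave⟩ := D.exists_wave hf ha hw hA hF hU (γ' - D.c)⁻¹
  clear hA hF hU hf hw
  set σ := Real.sqrt (δ * b₂) with hσ
  have hσ0 : 0 < σ := Real.sqrt_pos.2 (mul_pos hδ hb₂)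
  have hσ2 : σ ^ 2 = δ * b₂ := Real.sq_sqrt (mul_pos hδ hb₂).le
  set W := ‖w‖ with hW
  have hW0 : 0 ≤ W := norm_nonneg w
  -- One summand for each smallness condition of `Symbol.exists_wave`: on `T`, on `ρ`, on `T / ρ`
  -- and on the amplitude.
  set K := b₁ + 4 * σ + b₁ / (4 * σ) + 4 * ((γ' - D.c) * b₁ * W) with hK
  have hq1 : 0 < b₁ / (4 * σ) := by positivity
  have hq2 : 0 ≤ 4 * ((γ' - D.c) * b₁ * W) := by positivity
  have hK0 : 0 < K := by positivity
  have hK1 : b₁ ≤ K := by linarith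
  have hK2 : 4 * σ ≤ K := by linarith
  have hK3 : b₁ / (4 * σ) ≤ K := by linarith
  have hK4 : 4 * ((γ' - D.c) * b₁ * W) ≤ K := by linarith
  refine ⟨C * K * ((γ' - D.c) * b₁ * W) + 1, by positivity, ?_⟩
  filter_upwards [eventually_ge_atTop 1, eventually_ge_atTop (1 / ((γ' - D.c) * b₁)),
    eventually_mul_pow_mul_exp_le K 1 (p := 1 / 2) (by norm_num) hν₁] with L hL1 hL2 hL3
  have hL0 : 0 < L := one_pos.trans_le hL1
  set r := Real.sqrt (δ * (b₂ * (Real.exp (-L) * L))) with hr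
  have hr0 : 0 < r := Real.sqrt_pos.2 (by positivity)
  have hr2 : r ^ 2 = δ * (b₂ * (Real.exp (-L) * L)) := Real.sq_sqrt (by positivity)
  obtain ⟨g, hg'⟩ : ∃ g, g = Real.exp (-(1 / 2) * L) := ⟨_, rfl⟩
  have hg0 : 0 < g := hg' ▸ Real.exp_pos _
  have hgg : Real.exp (-L) = g * g := by
    rw [hg', ← Real.exp_add]
    congr 1
    ring
  have hg1 : g ≤ 1 := by
    rw [hg']
    exact Real.exp_le_one_iff.2 (by linarith)
  obtain ⟨q, hq⟩ : ∃ q, q = Real.sqrt L := ⟨_, rfl⟩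
  have hq0 : 0 < q := hq ▸ Real.sqrt_pos.2 hL0
  have hqq : q * q = L := by rw [hq, Real.mul_self_sqrt hL0.le]
  have hqL : q ≤ L := by
    rw [hq]
    exact Real.sqrt_le_iff.2 ⟨hL0.le, by rw [sq]; exact le_mul_of_one_le_left hL0.le hL1⟩
  have hsq : r = σ * (g * q) := by
    refine (Real.sqrt_eq_iff_eq_sq (by positivity) (by positivity)).2 ?_
    rw [mul_pow, hσ2, hgg, ← hqq]
    ring
  have hgap : 1 ≤ (γ' - D.c) * b₁ * L := by
    rw [div_le_iff₀ (by positivity)] at hL2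
    linarith
  -- The quotient `S / T` is the frequency `exp L`, the fast time runs up to `b₁ L`, and `Γ / S =
  -- γ'` exceeds `c`. The small parameter will be `ν = K L exp (-L / 2)`; its exponent is dictated
  -- by `ρ` and `T / ρ`, both of order `√L exp (-L / 2)`.
  let s : Scale D :=
    { S := b₁ * L
      Γ := γ' * (b₁ * L)
      T := Real.exp (-L) * (b₁ * L)
      ρ := 4 * r
      S_pos := by positivity
      T_pos := by positivity
      ρ_pos := by positivity
      gap := by linarith }
  have hsS : s.S = b₁ * L := rfl
  have hsΓ : s.Γ = γ' * (b₁ * L) := rfl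
  have hsT : s.T = Real.exp (-L) * (b₁ * L) := rfl
  have hsρ : s.ρ = 4 * r := rfl
  have hsgap : s.Γ - D.c * s.S = (γ' - D.c) * b₁ * L := by
    rw [hsΓ, hsS]
    ring
  have hST : s.S / s.T = Real.exp L := by
    rw [hsS, hsT, Real.exp_neg]
    field_simp
  have hang (z : Pos d) : s.angle z = Real.exp L * ∑ j, D.ξ j * z j := by
    rw [Scale.angle, hST]
  clear_value s
  rw [pow_one, ← hg'] at hL3
  -- The height of the lens, `b₂ L exp (-L)`, is the fraction `κ = b₂ / b₁` of `T`.
  obtain ⟨u, hu, herr⟩ := hwave s (K * (L * g)) (Real.exp (-M * L)) r δ (b₂ / b₁) hL3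
    (by
      rw [hsgap, hsS]
      refine le_of_eq ?_
      field_simp)
    (by
      rw [hsT, hgg]
      calc g * g * (b₁ * L) = b₁ * (L * (g * g)) := by ring
        _ ≤ b₁ * (L * (g * 1)) := by gcongr
        _ ≤ K * (L * g) := by rw [mul_one]; gcongr)
    (by
      rw [hsρ, hsq]
      calc 4 * (σ * (g * q)) = 4 * σ * (q * g) := by ring
        _ ≤ K * (L * g) := by gcongr)
    (by
      rw [hsT, hsρ, hsq, hgg]
      have h9 : b₁ / (4 * σ) * (4 * σ) = b₁ := div_mul_cancel₀ _ (by positivity)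
      calc g * g * (b₁ * L) / (4 * (σ * (g * q))) = b₁ / (4 * σ) * (q * g) := by
            rw [div_eq_iff (by positivity)]
            linear_combination (-(g ^ 2 * b₁)) * hqq - (g ^ 2 * q ^ 2) * h9
        _ ≤ K * (L * g) := by gcongr)
    (Real.exp_pos _).le
    (by
      rw [hlam, hsS, hsΓ, neg_neg]
      exact mul_le_mul_of_nonneg_right (hγc.trans hcγ').le (by positivity))
    (by
      have h1 : Real.exp (-M * L) * Real.exp s.Γ ≤ g := by
        rw [← Real.exp_add, hsΓ, hg']
        refine Real.exp_le_exp.2 ?_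
        have := mul_le_mul_of_nonneg_right hM hL0.le
        linarith
      rw [hsgap]
      calc 4 * ((γ' - D.c) * b₁ * L * (Real.exp (-M * L) * Real.exp s.Γ * W))
          = 4 * ((γ' - D.c) * b₁ * W) * (L * (Real.exp (-M * L) * Real.exp s.Γ)) := by ring
        _ ≤ K * (L * g) := by gcongr)
    hδ ((div_lt_one hb₁).2 hb₂₁)
    (by
      rw [hr2, hsT]
      refine le_of_eq ?_
      field_simp)
    hsρ.ge hr0
  rw [hST] at hu
  refine ⟨u, hu, fun p hp k => ?_⟩
  have h1 := herr p hp k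
  have htS : s.S * (p.1 / s.T) = Real.exp L * p.1 := by
    rw [← hST]
    ring
  have htS' : (s.S * (p.1 / s.T) : ℂ) = (Real.exp L * p.1 : ℝ) := by
    rw [← htS]
    push_cast
    rfl
  have htΓ : s.Γ * (p.1 / s.T) = γ' * (Real.exp L * p.1) := by
    rw [← htS, hsΓ, hsS]
    ring
  rw [hang, htS', htΓ, hsgap] at h1
  refine h1.trans (mul_le_mul_of_nonneg_left ?_ (Real.exp_pos _).le)
  rw [← hg']
  calc C * (K * (L * g)) * ((γ' - D.c) * b₁ * L * (Real.exp (-M * L) * W))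
      = C * K * ((γ' - D.c) * b₁ * W) * (L ^ 2 * g) * Real.exp (-M * L) := by ring
    _ ≤ _ := by
      gcongr
      linarith

/-- Exact solutions that are large in comparison with their data. -/
theorem Symbol.exists_large_wave (hf : D.Represents fa fb a R) (ha : 0 < a) {lam : ℂ}
    {w : Fin N → ℂ} (hw : ∀ k, ∑ l, (D.A₀ k l : ℂ) * w l = lam * w k) {k₀ : Fin N}
    (hk₀ : w k₀ = 1) {A : Fin d → ℝ × Pos d × Val N → Matrix (Fin N) (Fin N) ℝ}
    {F : ℝ × Pos d × Val N → Val N} {U : Set (ℝ × Pos d × Val N)}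
    (hA : ∀ j k l y, fa j k l y = A j (fromCoord x₀ y) k l)
    (hF : ∀ k y, fb k y = F (fromCoord x₀ y) k)
    (hU : ∀ y : Coord d N → ℝ, ‖y‖ < a → fromCoord x₀ y ∈ U)
    {γ γ' b₀ b₁ b₂ M δ : ℝ} (hlam : lam.im = -γ) (hγ : 0 < γ) (hγc : γ < D.c) (hcγ' : D.c < γ')
    (hb₀ : 0 < b₀) (hb₀₂ : b₀ < b₂) (hb₂₁ : b₂ < b₁) (hγ'b₀ : (γ' - γ) * b₀ ≤ 1 / 8)
    (hM : γ' * b₁ ≤ M - 1) (hξ : 0 < ∑ j, D.ξ j ^ 2) (hδ : 0 < δ) :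
    ∃ c₀ > 0, ∀ᶠ L : ℝ in atTop, ∃ u,
      IsSolution A F U x₀ (Real.sqrt (δ * (b₂ * (Real.exp (-L) * L)))) δ
        (planeWave x₀ (fun j => Real.exp L * D.ξ j)
          (fun k => ((2 * Real.exp (-M * L) : ℝ) : ℂ) * w k)) u ∧
      c₀ * Real.exp ((γ * b₀ - M - (d + 1) / 2) * L) ≤
        l2Norm (lens x₀ (Real.sqrt (δ * (b₂ * (Real.exp (-L) * L)))) δ) u := by
  have hb₂ : 0 < b₂ := hb₀.trans hb₀₂
  have hγ'0 : 0 < γ' := hγ.trans (hγc.trans hcγ')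
  obtain ⟨C, hC, hwave⟩ := D.exists_close_wave hf ha hw hA hF hU hlam hγ hγc hcγ' hb₂ hb₂₁ hM hδ
  clear hA hF hU hf hw hM
  set Ξ := ∑ j, |D.ξ j| with hΞ
  have hΞ0 : 0 ≤ Ξ := Finset.sum_nonneg fun j _ => abs_nonneg _
  have hden : 0 < 1 + Ξ + |lam.re| := by positivity
  obtain ⟨c₁, hc₁⟩ : ∃ c₁, c₁ = 1 / (1 + Ξ + |lam.re|) := ⟨_, rfl⟩
  have hc₁0 : 0 < c₁ := by rw [hc₁]; positivity
  have hc₁1 : c₁ * (1 + Ξ + |lam.re|) = 1 := by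
    rw [hc₁]
    field_simp
  obtain ⟨K₂, hK₂⟩ : ∃ K₂, K₂ = |lam.re| * b₀ / (∑ j, D.ξ j ^ 2) *
    ‖(WithLp.toLp 2 D.ξ : Pos d)‖ + c₁ := ⟨_, rfl⟩
  obtain ⟨V, hV⟩ : ∃ V, V = (volume (Metric.ball (0 : Pos d) 1)).toReal := ⟨_, rfl⟩
  have hV0 : 0 < V := by
    rw [hV]
    exact ENNReal.toReal_pos (Metric.measure_ball_pos _ _ one_pos).ne' measure_ball_lt_top.ne
  refine ⟨1 / 2 * Real.sqrt (c₁ ^ (d + 1) * V), by positivity, ?_⟩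
  filter_upwards [hwave, eventually_ge_atTop 1,
    eventually_mul_pow_mul_exp_le (Real.exp (γ' * c₁) * C) 2
      (p := 3 / 8) (e := 1 / 2) (by norm_num) (by norm_num),
    eventually_mul_pow_mul_exp_le (K₂ ^ 2) 2 (p := 1) one_pos one_pos,
    eventually_gt_atTop ((1 + δ * c₁) / (δ * (b₂ - b₀)))] with L hLw hL1 hL4 hL5 hL6
  clear hwave
  obtain ⟨u, hu, herr⟩ := hLw
  refine ⟨u, hu, ?_⟩
  have hL0 : 0 < L := one_pos.trans_le hL1
  set r := Real.sqrt (δ * (b₂ * (Real.exp (-L) * L))) with hr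
  have hr0 : 0 < r := Real.sqrt_pos.2 (by positivity)
  have hr2 : r ^ 2 = δ * (b₂ * (Real.exp (-L) * L)) := Real.sq_sqrt (by positivity)
  clear_value r
  obtain ⟨E, hE⟩ : ∃ E, E = Real.exp L := ⟨_, rfl⟩
  obtain ⟨e, he⟩ : ∃ e, e = Real.exp (-L) := ⟨_, rfl⟩
  have he0 : 0 < e := he ▸ Real.exp_pos _
  have hE0 : 0 < E := hE ▸ Real.exp_pos _
  have heL : E * e = 1 := by rw [he, hE, ← Real.exp_add, add_neg_cancel, Real.exp_zero]
  rw [← he] at hr2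
  rw [← hE] at herr
  -- Position of the crest at the fast time `b₀ L`.
  set y : Pos d := x₀ - (lam.re * (b₀ * L) * e / ∑ j, D.ξ j ^ 2) • WithLp.toLp 2 D.ξ with hy
  set B := Set.Icc (e * (b₀ * L)) (e * (b₀ * L + c₁)) ×ˢ Metric.ball y (c₁ * e) with hB
  -- For large `L` the squared distance to `x₀` is at most `e`, being of order `e² L²`. The lens has
  -- room for it at these times because `δ (b₂ - b₀) L > 1 + δ c₁`.
  have hbox : B ⊆ lens x₀ r δ := by
    rintro p ⟨⟨hp0, hp1⟩, hp2⟩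
    refine ⟨le_trans (by positivity) hp0, ?_⟩
    rw [mem_ball_iff_norm] at hp2
    have h1 := norm_sub_le_of_near hξ he0 hb₀ hL1 hc₁0 hp2.le
    rw [← hK₂] at h1
    have h4 : ‖p.2 - x₀‖ ^ 2 ≤ e := by
      calc ‖p.2 - x₀‖ ^ 2 ≤ (K₂ * (e * L)) ^ 2 := pow_le_pow_left₀ (norm_nonneg _) h1 2
        _ = K₂ ^ 2 * (L ^ 2 * Real.exp (-1 * L)) * e := by
          rw [neg_one_mul, ← he]
          ring
        _ ≤ 1 * e := mul_le_mul_of_nonneg_right hL5 he0.le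
        _ = e := one_mul e
    rw [hr2]
    rw [div_lt_iff₀ (mul_pos hδ (sub_pos.2 hb₀₂))] at hL6
    have h5 : δ * p.1 ≤ δ * (e * (b₀ * L + c₁)) := mul_le_mul_of_nonneg_left hp1 hδ.le
    have h6 := mul_lt_mul_of_pos_left hL6 he0
    linarith
  have hlow : ∀ p ∈ B, Real.exp (-M * L) * Real.exp (γ * (b₀ * L)) / 2 ≤ ‖u p‖ := by
    intro p hp
    have herr' := herr p (hbox hp) k₀
    obtain ⟨⟨hp0, hp1⟩, hp2⟩ := hp
    rw [mem_ball_iff_norm] at hp2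
    obtain ⟨t, ht⟩ : ∃ t, t = E * p.1 := ⟨_, rfl⟩
    have ht0 : b₀ * L ≤ t := by
      rw [ht]
      refine le_trans (le_of_eq ?_) (mul_le_mul_of_nonneg_left hp0 hE0.le)
      rw [← mul_assoc, heL, one_mul]
    have ht1 : t ≤ b₀ * L + c₁ := by
      rw [ht]
      refine (mul_le_mul_of_nonneg_left hp1 hE0.le).trans_eq ?_
      rw [← mul_assoc, heL, one_mul]
    have hphase := abs_phase_le (x₀ := x₀) (t := t) hξ hE0 heL hc₁1 hc₁0 hp2.le
      (abs_le.2 ⟨by linarith, by linarith⟩)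
    rw [← ht, hk₀, mul_one, re_exp_mul_I, hlam, neg_neg] at herr'
    refine (le_of_abs_sub_le (Real.exp_pos _) hγ ht0 hphase herr' ?_).trans
      ((le_abs_self _).trans (PiLp.norm_apply_le (u p) k₀))
    have h2 : Real.exp (1 / 8 * L) * Real.exp (-(1 / 2) * L) = Real.exp (-(3 / 8) * L) := by
      rw [← Real.exp_add]
      congr 1
      ring
    calc _ ≤ Real.exp (γ * (b₀ * L)) * (Real.exp (1 / 8 * L) * Real.exp (γ' * c₁)) *
          (C * (L ^ 2 * Real.exp (-(1 / 2) * L)) * Real.exp (-M * L)) :=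
          mul_le_mul_of_nonneg_right (exp_mul_le_of_le hγ'0 hL0 hγ'b₀ ht1) (by positivity)
      _ = Real.exp (-M * L) * Real.exp (γ * (b₀ * L)) *
          (Real.exp (γ' * c₁) * C * (L ^ 2 * (Real.exp (1 / 8 * L) *
            Real.exp (-(1 / 2) * L)))) := by ring
      _ ≤ _ := by
          rw [h2]
          exact mul_le_mul_of_nonneg_left hL4 (by positivity)
  have hres := le_l2Norm (memLp_lens hr0.le hδ hu.contDiffOn.continuousOn)
    (measurableSet_Icc.prod Metric.isOpen_ball.measurableSet) hbox (by positivity) hlow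
  refine le_trans (le_of_eq ?_) hres
  rw [volume_box y hc₁0 he0, ← hV, Real.sqrt_mul (by positivity) (e ^ (d + 1))]
  have h6 : Real.sqrt (e ^ (d + 1)) = Real.exp (-((d + 1) / 2) * L) := by
    rw [Real.sqrt_eq_iff_eq_sq (by positivity) (by positivity), he, ← Real.exp_nat_mul,
      ← Real.exp_nat_mul]
    congr 1
    push_cast
    ring
  have h7 : Real.exp ((γ * b₀ - M - (d + 1) / 2) * L) =
      Real.exp (-M * L) * Real.exp (γ * (b₀ * L)) * Real.exp (-((d + 1) / 2) * L) := by
    rw [← Real.exp_add, ← Real.exp_add]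
    congr 1
    ring
  rw [h6, h7]
  ring

end Asymptotics

/-! ### Spectral data and power series of the coefficients -/

section Symbols

open ComplexConjugate

variable {d N : ℕ}

/-- An eigenvalue with the smallest imaginary part. -/
theorem exists_extremal_eigenvalue (M : Matrix (Fin N) (Fin N) ℝ)
    (hM : ∃ μ : ℂ, Module.End.HasEigenvalue
      (Matrix.toLin' (M.map (fun a : ℝ => (a : ℂ)))) μ ∧ μ.im ≠ 0) :
    ∃ (lam : ℂ) (w : Fin N → ℂ) (k₀ : Fin N), lam.im < 0 ∧ w k₀ = 1 ∧
      (∀ k, ∑ l, (M k l : ℂ) * w l = lam * w k) ∧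
      ∀ μ, Module.End.HasEigenvalue (Matrix.toLin' (M.map (fun a : ℝ => (a : ℂ)))) μ →
        |μ.im| ≤ -lam.im := by
  set T := Matrix.toLin' (M.map (fun a : ℝ => (a : ℂ))) with hT
  obtain ⟨μ₁, hμ₁, hμ₁0⟩ := hM
  have hfin : {μ | Module.End.HasEigenvalue T μ}.Finite := Module.End.finite_hasEigenvalue T
  obtain ⟨μ, hμ, hmax⟩ := hfin.exists_maximalFor (fun μ => |μ.im|) _ ⟨μ₁, hμ₁⟩
  have hmax' (ν : ℂ) (hν : Module.End.HasEigenvalue T ν) : |ν.im| ≤ |μ.im| := by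
    rcases le_total |ν.im| |μ.im| with h | h
    · exact h
    · exact hmax hν h
  have hμ0 : 0 < |μ.im| := (abs_pos.2 hμ₁0).trans_le (hmax' _ hμ₁)
  obtain ⟨v, hv⟩ := hμ.exists_hasEigenvector
  have hv1 (k : Fin N) : ∑ l, (M k l : ℂ) * v l = μ * v k := by
    have := congrFun hv.apply_eq_smul k
    simpa [hT, Matrix.mulVec, dotProduct] using this
  obtain ⟨k₀, hk₀⟩ : ∃ k, v k ≠ 0 := Function.ne_iff.1 hv.2
  have hv2 (k : Fin N) : ∑ l, (M k l : ℂ) * (v l / v k₀) = μ * (v k / v k₀) := by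
    simp only [← mul_div_assoc, ← Finset.sum_div, hv1]
  -- The matrix is real, so conjugation of an eigenvector corrects the sign of the imaginary part if
  -- necessary.
  rcases lt_or_gt_of_ne (abs_pos.1 hμ0) with h | h
  · exact ⟨μ, fun k => v k / v k₀, k₀, h, div_self hk₀, hv2, by rwa [← abs_of_neg h]⟩
  · refine ⟨conj μ, fun k => conj (v k / v k₀), k₀, by simpa using h,
      (congrArg conj (div_self hk₀)).trans (map_one _), fun k => ?_, by simpa [abs_of_pos h] using hmax'⟩
    rw [← map_mul, ← hv2, map_sum]
    simp

/-- The eigenvalues of `± i M` have real parts `∓ Im μ`. The one-sided bounds for the two signs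
combine into a bound for all real times. -/
theorem exists_norm_exp_mul_I_le (M : Matrix (Fin N) (Fin N) ℝ) {c : ℝ}
    (hc : ∀ μ, Module.End.HasEigenvalue (Matrix.toLin' (M.map (fun a : ℝ => (a : ℂ)))) μ →
      |μ.im| < c) :
    ∃ C : ℝ, ∀ s : ℝ, ‖NormedSpace.exp (s • (Complex.I • LinearMap.toContinuousLinearMap
      (Matrix.toLin' (M.map fun a : ℝ => (a : ℂ)))))‖ ≤ C * Real.exp (c * |s|) := by
  set T := Matrix.toLin' (M.map (fun a : ℝ => (a : ℂ))) with hT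
  set T' : (Fin N → ℂ) →L[ℂ] (Fin N → ℂ) := LinearMap.toContinuousLinearMap T with hT'
  have hmul {z : ℂ} (hz : z * z = -1) {μ : ℂ}
      (hμ : Module.End.HasEigenvalue ((z • T' : (Fin N → ℂ) →L[ℂ] (Fin N → ℂ)) :
        (Fin N → ℂ) →ₗ[ℂ] (Fin N → ℂ)) μ) : Module.End.HasEigenvalue T (-z * μ) := by
    obtain ⟨v, hv⟩ := hμ.exists_hasEigenvector
    refine Module.End.hasEigenvalue_of_hasEigenvector (x := v)
      ⟨Module.End.mem_eigenspace_iff.2 ?_, hv.2⟩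
    have h1 : z • T v = μ • v := hv.apply_eq_smul
    rw [mul_smul, ← h1, smul_smul, neg_mul, hz, neg_neg, one_smul]
  obtain ⟨C₁, hC₁, h₁⟩ := exists_norm_exp_smul_le (Complex.I • T') (c := c) fun μ hμ => by
    have h := hc _ (hmul (by simp) hμ)
    refine lt_of_le_of_lt ?_ h
    rw [abs_eq_max_neg]
    simp
  obtain ⟨C₂, hC₂, h₂⟩ := exists_norm_exp_smul_le ((-Complex.I) • T') (c := c) fun μ hμ => by
    have h := hc _ (hmul (by simp) hμ)
    refine lt_of_le_of_lt ?_ h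
    rw [abs_eq_max_neg]
    simp
  refine ⟨max C₁ C₂, fun s => ?_⟩
  rcases le_total 0 s with hs | hs
  · refine (h₁ s hs).trans ?_
    rw [abs_of_nonneg hs]
    gcongr
    exact le_max_left _ _
  · have h3 : s • (Complex.I • T') = (-s) • ((-Complex.I) • T') := by
      refine ContinuousLinearMap.ext fun v => funext fun k => ?_
      simp
    rw [h3, abs_of_nonpos hs]
    refine (h₂ (-s) (by linarith)).trans ?_
    gcongr
    exact le_max_right _ _

variable {x₀ : Pos d}

theorem fromCoord_zero (x₀ : Pos d) : fromCoord x₀ (0 : Coord d N → ℝ) = (0, x₀, 0) := by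
  refine Prod.ext rfl (Prod.ext ?_ ?_)
  · ext j
    simp [fromCoord]
  · ext k
    simp [fromCoord]

theorem analyticAt_fromCoord (x₀ : Pos d) (y : Coord d N → ℝ) :
    AnalyticAt ℝ (fromCoord x₀) y := by
  have h (n : ℕ) (e : Fin n → Coord d N) :
      AnalyticAt ℝ (fun y : Coord d N → ℝ => (WithLp.toLp 2 fun k => y (e k) : Val n)) y :=
    ((PiLp.continuousLinearEquiv 2 ℝ (fun _ : Fin n => ℝ)).symm.toContinuousLinearMap.comp
      (ContinuousLinearMap.pi (R := ℝ) (φ := fun _ : Fin n => ℝ) fun k =>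
        ContinuousLinearMap.proj (R := ℝ) (φ := fun _ : Coord d N => ℝ) (e k))).analyticAt y
  exact ((ContinuousLinearMap.proj (R := ℝ) (φ := fun _ : Coord d N => ℝ) (Sum.inl ())).analyticAt
    y).prod ((analyticAt_const.add (h d fun j => Sum.inr (Sum.inl j))).prod
      (h N fun k => Sum.inr (Sum.inr k)))

/-- The symbol of a system at a point where its coefficients are analytic. -/
theorem exists_symbol {U : Set (ℝ × Pos d × Val N)} (hU : IsOpen U) (hxU : (0, x₀, 0) ∈ U)
    {A : Fin d → ℝ × Pos d × Val N → Matrix (Fin N) (Fin N) ℝ} {F : ℝ × Pos d × Val N → Val N}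
    (hA : ∀ j i k, AnalyticOnNhd ℝ (fun p => A j p i k) U) (hF : AnalyticOnNhd ℝ F U)
    (hF0 : ∀ (t : ℝ) (x : Pos d), (t, x, 0) ∈ U → F (t, x, 0) = 0) (ξ : Fin d → ℝ) :
    ∃ a : NNReal, 0 < a ∧ (∀ y : Coord d N → ℝ, ‖y‖ < a → fromCoord x₀ y ∈ U) ∧
      ∀ c : ℝ, 0 ≤ c → (∀ μ, Module.End.HasEigenvalue (Matrix.toLin'
          ((∑ j, ξ j • A j (0, x₀, 0)).map (fun a : ℝ => (a : ℂ)))) μ → |μ.im| < c) →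
        ∃ (D : Symbol d N) (R : ENNReal), D.c = c ∧ D.ξ = ξ ∧
          D.A₀ = ∑ j, ξ j • A j (0, x₀, 0) ∧
          D.Represents (fun j k l y => A j (fromCoord x₀ y) k l)
            (fun k y => F (fromCoord x₀ y) k) a R := by
  have han (j k l) : AnalyticAt ℝ (fun y : Coord d N → ℝ => A j (fromCoord x₀ y) k l) 0 :=
    AnalyticAt.fun_comp (g := fun p => A j p k l) (by rw [fromCoord_zero]; exact hA j k l _ hxU)
      (analyticAt_fromCoord x₀ 0)
  have hbn (k) : AnalyticAt ℝ (fun y : Coord d N → ℝ => F (fromCoord x₀ y) k) 0 :=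
    AnalyticAt.fun_comp (g := fun p => F p k) (by
      rw [fromCoord_zero]
      exact ((EuclideanSpace.proj k : Val N →L[ℝ] ℝ).analyticAt _).comp (hF _ hxU))
      (analyticAt_fromCoord x₀ 0)
  choose pa hpa using han
  choose pb hpb using hbn
  have h1 : ∀ᶠ R in 𝓝[>] (0 : ENNReal), ∀ j k l, HasFPowerSeriesOnBall
      (fun y : Coord d N → ℝ => A j (fromCoord x₀ y) k l) (pa j k l) 0 R :=
    eventually_all.2 fun j => eventually_all.2 fun k => eventually_all.2 fun l =>
      (hpa j k l).eventually
  have h2 : ∀ᶠ R in 𝓝[>] (0 : ENNReal), ∀ k, HasFPowerSeriesOnBall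
      (fun y : Coord d N → ℝ => F (fromCoord x₀ y) k) (pb k) 0 R :=
    eventually_all.2 fun k => (hpb k).eventually
  obtain ⟨R, ⟨hR1, hR2⟩, hR0⟩ := ((h1.and h2).and self_mem_nhdsWithin).exists
  obtain ⟨a₁, ha₁0, ha₁R⟩ := ENNReal.lt_iff_exists_nnreal_btwn.1 (show (0 : ENNReal) < R from hR0)
  have hopen : fromCoord x₀ ⁻¹' U ∈ 𝓝 (0 : Coord d N → ℝ) :=
    (analyticAt_fromCoord x₀ 0).continuousAt.preimage_mem_nhds
      (hU.mem_nhds (by rw [fromCoord_zero]; exact hxU))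
  obtain ⟨a₂, ha₂0, ha₂⟩ := Metric.mem_nhds_iff.1 hopen
  have hmem (y : Coord d N → ℝ) (hy : ‖y‖ < (min a₁ a₂.toNNReal : NNReal)) :
      fromCoord x₀ y ∈ U := by
    refine ha₂ (mem_ball_zero_iff.2 (hy.trans_le ?_))
    rw [NNReal.coe_min, Real.coe_toNNReal _ ha₂0.le]
    exact min_le_right _ _
  refine ⟨min a₁ a₂.toNNReal, lt_min (by exact_mod_cast ha₁0) (Real.toNNReal_pos.2 ha₂0), hmem,
    fun c hc0 hc => ?_⟩
  obtain ⟨C, hC⟩ := exists_norm_exp_mul_I_le _ hc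
  refine ⟨⟨ξ, ∑ j, ξ j • A j (0, x₀, 0), c, C, hc0, hC, pa, pb⟩, R, rfl, rfl, rfl, ?_, hR1, hR2,
    fun k l => ?_, fun k y hy hy0 => ?_⟩
  · exact lt_of_le_of_lt (by exact_mod_cast min_le_left _ _) ha₁R
  · simp [fromCoord_zero, Matrix.sum_apply]
  · have h3 : fromCoord x₀ y = ((fromCoord x₀ y).1, (fromCoord x₀ y).2.1, 0) := by
      refine Prod.ext rfl (Prod.ext rfl ?_)
      ext k'
      exact hy0 k'
    have h4 := hmem y hy
    rw [h3] at h4 ⊢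
    rw [hF0 _ _ h4]
    rfl

end Symbols

/-! ### Choice of the parameters, and instability -/

section Instability

/-- Beating the power `α` of the datum needs `γ b₀` to exceed `(1 - α) M` by a fixed amount, while
smallness of the wave needs `γ' b₁ ≤ M - 1`. Both are possible once `α M` is large, with `γ b₀ = (1
- α/2) M` and `γ' b₁ = (1 - α/4) M`. -/
theorem exists_growth_parameters (d m : ℕ) {γ α : ℝ} (hγ : 0 < γ) (hα : 0 < α) (hα1 : α ≤ 1) :
    ∃ γ' c b₀ b₁ b₂ M : ℝ, γ < c ∧ c < γ' ∧ 0 < b₀ ∧ b₀ < b₂ ∧ b₂ < b₁ ∧ (γ' - γ) * b₀ ≤ 1 / 8 ∧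
      γ' * b₁ ≤ M - 1 ∧ m < M ∧ γ * b₀ - M - (d + 1) / 2 = 2 - α * (M - m) := by
  -- Obtained by solving the last identity of the statement for `M` when `γ b₀ = (1 - α/2) M`.
  obtain ⟨M, hM⟩ : ∃ M : ℝ, M = (d + 5) / α + 2 * m := ⟨_, rfl⟩
  have hαM : α * M = d + 5 + 2 * (α * m) := by rw [hM]; field_simp
  have hd : (0 : ℝ) ≤ d := d.cast_nonneg
  have hm : (0 : ℝ) ≤ m := m.cast_nonneg
  have hαm : 0 ≤ α * m := mul_nonneg hα.le hm
  have hmM : (m : ℝ) < M := by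
    rw [hM]
    have : 0 < ((d : ℝ) + 5) / α := by positivity
    linarith
  have hM0 : 0 < M := hm.trans_lt hmM
  -- With `γ' = γ (1 + θ)` this gives `(γ' - γ) b₀ = θ γ b₀ ≤ θ M = 1/8`.
  obtain ⟨θ, hθ⟩ : ∃ θ : ℝ, θ = 1 / (8 * M) := ⟨_, rfl⟩
  have hθ0 : 0 < θ := by rw [hθ]; positivity
  have hθM : θ * M = 1 / 8 := by rw [hθ]; field_simp
  obtain ⟨γ', hγ'⟩ : ∃ γ' : ℝ, γ' = γ * (1 + θ) := ⟨_, rfl⟩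
  have hγθ : 0 < γ * θ := mul_pos hγ hθ0
  have hγ'0 : 0 < γ' := by rw [hγ']; positivity
  obtain ⟨b₀, hb₀⟩ : ∃ b₀ : ℝ, b₀ = (1 - α / 2) * M / γ := ⟨_, rfl⟩
  obtain ⟨b₁, hb₁⟩ : ∃ b₁ : ℝ, b₁ = (1 - α / 4) * M / γ' := ⟨_, rfl⟩
  have h0 : γ * b₀ = (1 - α / 2) * M := by rw [hb₀]; field_simp
  have h1 : γ' * b₁ = (1 - α / 4) * M := by rw [hb₁]; field_simp
  have hb₀0 : 0 < b₀ := by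
    rw [hb₀]
    exact div_pos (mul_pos (by linarith) hM0) hγ
  have h2 : γ' * b₀ = (1 - α / 2) * M + (1 - α / 2) / 8 := by
    rw [hγ', show γ * (1 + θ) * b₀ = γ * b₀ * (1 + θ) by ring, h0]
    linear_combination (1 - α / 2) * hθM
  have h01 : b₀ < b₁ := by
    refine lt_of_mul_lt_mul_left ?_ hγ'0.le
    rw [h1, h2]
    linarith
  refine ⟨γ', γ * (1 + θ / 2), b₀, b₁, (b₀ + b₁) / 2, M, by linarith, by rw [hγ']; linarith,
    hb₀0, by linarith, by linarith, ?_, by linarith, hmM, ?_⟩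
  · linarith [sub_mul γ' γ b₀]
  · linarith

theorem tendsto_exp_neg_mul_id :
    Tendsto (fun L : ℝ => Real.exp (-L) * L) atTop (𝓝 0) := by
  simpa [mul_comm] using Real.tendsto_pow_mul_exp_neg_atTop_nhds_zero 1

variable {d N : ℕ} {x₀ : Pos d} {U : Set (ℝ × Pos d × Val N)}
  {A : Fin d → ℝ × Pos d × Val N → Matrix (Fin N) (Fin N) ℝ} {F : ℝ × Pos d × Val N → Val N}

/-- Solutions growing from oscillating data, at the frequency `exp L`. -/
theorem exists_growing_solutions (hU : IsOpen U) (hxU : (0, x₀, 0) ∈ U)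
    (hA : ∀ j i k, AnalyticOnNhd ℝ (fun p => A j p i k) U) (hF : AnalyticOnNhd ℝ F U)
    (hF0 : ∀ (t : ℝ) (x : Pos d), (t, x, 0) ∈ U → F (t, x, 0) = 0)
    (hell : ∃ (ξ : Fin d → ℝ) (μ : ℂ), Module.End.HasEigenvalue
      (Matrix.toLin' ((∑ j, ξ j • A j (0, x₀, 0)).map (fun a : ℝ => (a : ℂ)))) μ ∧ μ.im ≠ 0)
    (m : ℕ) {α r₀ δ : ℝ} (hα : 0 < α) (hα1 : α ≤ 1) (hr₀ : 0 < r₀) (hδ : 0 < δ) :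
    ∃ (r : ℝ → ℝ) (h : ℝ → Pos d → Val N) (p c₀ K : ℝ), 0 < p ∧ 0 < c₀ ∧ 0 < K ∧
      Tendsto r atTop (𝓝 0) ∧ ∀ᶠ L in atTop, ∃ u, 0 < r L ∧
        MemSobolev m (Metric.ball x₀ r₀) (h L) ∧ 0 < sobolevNorm m (Metric.ball x₀ r₀) (h L) ∧
        sobolevNorm m (Metric.ball x₀ r₀) (h L) ≤ K * Real.exp (-p * L) ∧
        IsSolution A F U x₀ (r L) δ (h L) u ∧
        c₀ * Real.exp ((2 - α * p) * L) ≤ l2Norm (lens x₀ (r L) δ) u := by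
  obtain ⟨ξ, hξ⟩ := hell
  obtain ⟨lam, w, k₀, hlam, hk₀, hw, hmax⟩ := exists_extremal_eigenvalue _ hξ
  obtain ⟨γ', c, b₀, b₁, b₂, M, hγc, hcγ', hb₀, hb₀₂, hb₂₁, hb₀8, hb₁M, hmM, hexp⟩ :=
    exists_growth_parameters d m (neg_pos.2 hlam) hα hα1
  obtain ⟨a, ha, haU, hD⟩ := exists_symbol hU hxU hA hF hF0 ξ
  obtain ⟨D, R, hDc, hDξ, hDA, hf⟩ := hD c ((neg_pos.2 hlam).trans hγc).le
    fun μ hμ => (hmax μ hμ).trans_lt hγc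
  -- For `ξ = 0` the matrix would vanish and its only eigenvalue would be real.
  have hξ0 : 0 < ∑ j, D.ξ j ^ 2 := by
    refine (Finset.sum_nonneg fun j _ => sq_nonneg _).lt_of_ne fun h0 => ?_
    have hz (j) : ξ j = 0 := by
      rw [← hDξ]
      exact pow_eq_zero_iff two_ne_zero |>.1
        ((Finset.sum_eq_zero_iff_of_nonneg fun j _ => sq_nonneg _).1 h0.symm j (Finset.mem_univ j))
    have h1 := hw k₀
    simp only [hz, zero_smul, Finset.sum_const_zero, Matrix.zero_apply, Complex.ofReal_zero,
      zero_mul, hk₀, mul_one] at h1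
    rw [← h1] at hlam
    simp at hlam
  obtain ⟨c₀, hc₀, hL⟩ := Symbol.exists_large_wave hf ha (by rw [hDA]; exact hw) hk₀
    (fun _ _ _ _ => rfl) (fun _ _ => rfl) haU (γ := -lam.im) (neg_neg _).symm (neg_pos.2 hlam)
    (hDc ▸ hγc) (hDc ▸ hcγ') hb₀ hb₀₂ hb₂₁ hb₀8 hb₁M hξ0 hδ
  have hB : IsOpen (Metric.ball x₀ r₀) := Metric.isOpen_ball
  have hB' : volume (Metric.ball x₀ r₀) ≠ ⊤ := measure_ball_lt_top.ne
  obtain ⟨K, hK, hKle⟩ := exists_sobolevNorm_planeWave_le x₀ N hB hB' m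
  have hw0 : 0 < ‖w‖ := norm_pos_iff.2 fun h => by simp [h] at hk₀
  have hX : 0 < 1 + ∑ j, |D.ξ j| := by positivity
  refine ⟨fun L => Real.sqrt (δ * (b₂ * (Real.exp (-L) * L))), fun L => planeWave x₀
    (fun j => Real.exp L * D.ξ j) (fun k => ((2 * Real.exp (-M * L) : ℝ) : ℂ) * w k), M - m, c₀,
    K * (2 * ‖w‖ * (1 + ∑ j, |D.ξ j|) ^ m), by linarith, hc₀, by positivity, ?_, ?_⟩
  · simpa using ((tendsto_exp_neg_mul_id.const_mul b₂).const_mul δ).sqrt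
  filter_upwards [hL, eventually_ge_atTop 1] with L ⟨u, hu, hul⟩ hL1
  have hE : 0 < 2 * Real.exp (-M * L) := by positivity
  have hb₂ : 0 < b₂ := hb₀.trans hb₀₂
  refine ⟨u, Real.sqrt_pos.2 (by positivity), memSobolev_planeWave _ _ _ hB' m,
    sobolevNorm_planeWave_pos _ _ _ hB hB' (Metric.mem_ball_self hr₀) m (k := k₀) ?_, ?_, hu, ?_⟩
  · rw [hk₀, mul_one, Complex.ofReal_re]
    exact hE.ne'
  · refine (hKle _ _ (Real.exp L * (1 + ∑ j, |D.ξ j|)) ?_ fun j => ?_).trans ?_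
    · exact one_le_mul_of_one_le_of_one_le (Real.one_le_exp (by linarith))
        (le_add_of_nonneg_right (by positivity))
    · rw [abs_mul, Real.abs_exp]
      gcongr
      have := Finset.single_le_sum (f := fun j => |D.ξ j|) (fun j _ => abs_nonneg _)
        (Finset.mem_univ j)
      linarith
    · have h1 : (fun k => ((2 * Real.exp (-M * L) : ℝ) : ℂ) * w k) =
          ((2 * Real.exp (-M * L) : ℝ) : ℂ) • w := rfl
      rw [h1, norm_smul, Complex.norm_real, Real.norm_of_nonneg hE.le, mul_pow, ← Real.exp_nat_mul]
      have h2 : Real.exp (-(M - m) * L) = Real.exp (-M * L) * Real.exp (m * L) := by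
        rw [← Real.exp_add]
        ring_nf
      rw [h2]
      exact le_of_eq (by ring)
  · rwa [← hexp]

theorem isSolution_zero {r δ : ℝ} (hF0 : ∀ (t : ℝ) (x : Pos d), (t, x, 0) ∈ U → F (t, x, 0) = 0)
    (hr : ∀ p ∈ lens x₀ r δ, (p.1, p.2, 0) ∈ U) : IsSolution A F U x₀ r δ 0 0 where
  contDiffOn := contDiffOn_const
  mem_domain := hr
  equation p hp i := by
    have h1 : fderivWithin ℝ (0 : ℝ × Pos d → Val N) (closure (lens x₀ r δ)) p = 0 := by
      rw [fderivWithin_zero]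
      rfl
    simp only [h1, Pi.zero_apply, hF0 _ _ (hr p hp)]
    simp
  initial := by simp

/-- Small lenses lie in the domain of the coefficients. -/
theorem eventually_lens_mem (hU : IsOpen U) (hxU : (0, x₀, 0) ∈ U) {δ : ℝ} (hδ : 0 < δ) :
    ∀ᶠ r in 𝓝 (0 : ℝ), ∀ p ∈ lens x₀ r δ, (p.1, p.2, 0) ∈ U := by
  have h1 : (fun p : ℝ × Pos d => (p.1, p.2, (0 : Val N))) ⁻¹' U ∈ 𝓝 ((0 : ℝ), x₀) :=
    (by fun_prop : Continuous fun p : ℝ × Pos d => (p.1, p.2, (0 : Val N))).continuousAt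
      |>.preimage_mem_nhds (hU.mem_nhds hxU)
  obtain ⟨e, he, heU⟩ := Metric.mem_nhds_iff.1 h1
  have h2 : ∀ᶠ r in 𝓝 (0 : ℝ), r ^ 2 / δ < e :=
    (by fun_prop : Continuous fun r : ℝ => r ^ 2 / δ).continuousAt.eventually_lt_const
      (by simpa using he)
  have h3 : ∀ᶠ r in 𝓝 (0 : ℝ), |r| < e :=
    continuous_abs.continuousAt.eventually_lt_const (by simpa using he)
  filter_upwards [h2, h3] with r hr1 hr2 p hp
  refine heU ?_
  rw [Metric.mem_ball, Prod.dist_eq, max_lt_iff, dist_zero_right, Real.norm_of_nonneg hp.1,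
    dist_eq_norm]
  have hp2 := hp.2
  constructor
  · refine lt_of_le_of_lt ((le_div_iff₀ hδ).2 ?_) hr1
    nlinarith [sq_nonneg ‖p.2 - x₀‖]
  · refine lt_of_le_of_lt ?_ hr2
    refine abs_le_of_sq_le_sq' ?_ (abs_nonneg r) |>.2
    rw [sq_abs]
    nlinarith [mul_nonneg hδ.le hp.1]

theorem tendsto_neg_log : Tendsto (fun ε : ℝ => -Real.log ε) (𝓝[>] 0) atTop :=
  tendsto_neg_atBot_atTop.comp Real.tendsto_log_nhdsGT_zero

/-- Reparametrisation by `ε = exp (-L)`. The power `α` of the bound on the datum cancels `exp (-α p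
L)`, so the quotient is at least a constant times `exp (2 L)`. -/
theorem exists_hadamard_instability (hU : IsOpen U) (hxU : (0, x₀, 0) ∈ U)
    (hA : ∀ j i k, AnalyticOnNhd ℝ (fun p => A j p i k) U) (hF : AnalyticOnNhd ℝ F U)
    (hF0 : ∀ (t : ℝ) (x : Pos d), (t, x, 0) ∈ U → F (t, x, 0) = 0)
    (hell : ∃ (ξ : Fin d → ℝ) (μ : ℂ), Module.End.HasEigenvalue
      (Matrix.toLin' ((∑ j, ξ j • A j (0, x₀, 0)).map (fun a : ℝ => (a : ℂ)))) μ ∧ μ.im ≠ 0)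
    (m : ℕ) {α r₀ δ : ℝ} (hα : 0 < α) (hα1 : α ≤ 1) (hr₀ : 0 < r₀) (hδ : 0 < δ) :
    ∃ (ε₀ : ℝ) (r : ℝ → ℝ) (h : ℝ → Pos d → Val N) (u : ℝ → ℝ × Pos d → Val N), 0 < ε₀ ∧
      (∀ ε : ℝ, 0 < ε → ε < ε₀ → 0 < r ε ∧ r ε ≤ r₀ ∧ MemSobolev m (Metric.ball x₀ r₀) (h ε) ∧
        0 < sobolevNorm m (Metric.ball x₀ r₀) (h ε) ∧
        IsSolution A F U x₀ (r ε) δ (h ε) (u ε)) ∧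
      Tendsto r (𝓝[>] 0) (𝓝 0) ∧
      Tendsto (fun ε => sobolevNorm m (Metric.ball x₀ r₀) (h ε)) (𝓝[>] 0) (𝓝 0) ∧
      Tendsto (fun ε => l2Norm (lens x₀ (r ε) δ) (u ε) /
        sobolevNorm m (Metric.ball x₀ r₀) (h ε) ^ α) (𝓝[>] 0) atTop := by
  obtain ⟨r, h, p, c₀, K, hp, hc₀, hK, hr, hL⟩ :=
    exists_growing_solutions hU hxU hA hF hF0 hell m hα hα1 hr₀ hδ
  obtain ⟨u, hu⟩ := hL.choice
  obtain ⟨L₀, hL₀⟩ := eventually_atTop.1 (hu.and (hr.eventually_le_const hr₀))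
  refine ⟨Real.exp (-L₀), fun ε => r (-Real.log ε), fun ε => h (-Real.log ε),
    fun ε => u (-Real.log ε), Real.exp_pos _, fun ε hε hε₀ => ?_, hr.comp tendsto_neg_log, ?_, ?_⟩
  · have h1 : L₀ ≤ -Real.log ε := by
      rw [le_neg, ← Real.log_exp (-L₀)]
      exact Real.log_le_log hε hε₀.le
    obtain ⟨⟨h2, h3, h4, -, h5, -⟩, h6⟩ := hL₀ _ h1
    exact ⟨h2, h6, h3, h4, h5⟩
  · refine Tendsto.comp (g := fun L => sobolevNorm m (Metric.ball x₀ r₀) (h L)) ?_ tendsto_neg_log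
    refine squeeze_zero' (g := fun L => K * Real.exp (-p * L))
      (Eventually.of_forall fun L => Real.sqrt_nonneg _) (hu.mono fun L hL => hL.2.2.2.1) ?_
    have := (Real.tendsto_exp_atBot.comp (tendsto_id.const_mul_atTop_of_neg
      (neg_lt_zero.2 hp))).const_mul K
    simpa using this
  · refine Tendsto.comp (g := fun L => l2Norm (lens x₀ (r L) δ) (u L) /
      sobolevNorm m (Metric.ball x₀ r₀) (h L) ^ α) ?_ tendsto_neg_log
    have h1 : Tendsto (fun L : ℝ => c₀ / K ^ α * Real.exp (2 * L)) atTop atTop :=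
      (Real.tendsto_exp_atTop.comp (tendsto_id.const_mul_atTop two_pos)).const_mul_atTop
        (by positivity)
    refine tendsto_atTop_mono' _ (hu.mono fun L hL => ?_) h1
    obtain ⟨-, -, h2, h3, -, h4⟩ := hL
    rw [le_div_iff₀ (Real.rpow_pos_of_pos h2 α)]
    refine le_trans ?_ h4
    calc _ ≤ c₀ / K ^ α * Real.exp (2 * L) * (K * Real.exp (-p * L)) ^ α := by gcongr
      _ = _ := by
        rw [Real.mul_rpow hK.le (Real.exp_pos _).le, ← Real.exp_mul, sub_mul, sub_eq_add_neg,
          Real.exp_add, show -p * L * α = -(α * p * L) by ring]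
        have : K ^ α ≠ 0 := (Real.rpow_pos_of_pos hK α).ne'
        field_simp

/-- Zero is the solution with zero datum, since the source vanishes at `u = 0`. Comparison with it
would bound the supremum of `u ε` by the power `α` of its datum; on lenses of bounded volume this
bounds the `L²` norm as well, against the divergence of the quotient. -/
theorem not_holderWellPosed (hU : IsOpen U) (hxU : (0, x₀, 0) ∈ U)
    (hF0 : ∀ (t : ℝ) (x : Pos d), (t, x, 0) ∈ U → F (t, x, 0) = 0) {m : ℕ}
    (H : ∀ α r₀ δ : ℝ, 0 < α → α ≤ 1 → 0 < r₀ → 0 < δ →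
      ∃ (ε₀ : ℝ) (r : ℝ → ℝ) (h : ℝ → Pos d → Val N) (u : ℝ → ℝ × Pos d → Val N), 0 < ε₀ ∧
        (∀ ε : ℝ, 0 < ε → ε < ε₀ → 0 < r ε ∧ r ε ≤ r₀ ∧ MemSobolev m (Metric.ball x₀ r₀) (h ε) ∧
          0 < sobolevNorm m (Metric.ball x₀ r₀) (h ε) ∧
          IsSolution A F U x₀ (r ε) δ (h ε) (u ε)) ∧
        Tendsto r (𝓝[>] 0) (𝓝 0) ∧
        Tendsto (fun ε => sobolevNorm m (Metric.ball x₀ r₀) (h ε)) (𝓝[>] 0) (𝓝 0) ∧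
        Tendsto (fun ε => l2Norm (lens x₀ (r ε) δ) (u ε) /
          sobolevNorm m (Metric.ball x₀ r₀) (h ε) ^ α) (𝓝[>] 0) atTop) :
    ¬ HolderWellPosed A F U x₀ m := by
  rintro ⟨r₀, r₁, δ, c, C, α, hr₁, hr₁₀, hδ, hc, hα, hα1, -, hW⟩
  have hr₀ : 0 < r₀ := hr₁.trans hr₁₀
  obtain ⟨ε₀, r, h, u, hε₀, hsol, hr, hh, hu⟩ := H α r₀ δ hα hα1 hr₀ hδ
  have h0 : sobolevNorm m (Metric.ball x₀ r₀) (0 : Pos d → Val N) = 0 :=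
    sobolevNorm_zero Metric.isOpen_ball measure_ball_lt_top.ne m
  obtain ⟨ε, hε⟩ := ((hr.eventually (eventually_lens_mem hU hxU hδ)).and
    ((hr.eventually_lt_const hr₁).and ((hh.eventually_le_const hc).and
    ((hu.eventually_gt_atTop (|C| * Real.sqrt (volume (lens x₀ r₀ δ)).toReal)).and
    (Ioo_mem_nhdsGT hε₀))))).exists
  obtain ⟨hε1, hε2, hε3, hε4, hε5⟩ := hε
  obtain ⟨hs1, hs2, hs3, hs4, hs5⟩ := hsol ε hε5.1 hε5.2
  have hα0 := Real.rpow_pos_of_pos hs4 α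
  have hle : ∀ p ∈ lens x₀ (r ε) δ,
      ‖u ε p‖ ≤ |C| * sobolevNorm m (Metric.ball x₀ r₀) (h ε) ^ α := fun p hp => by
    have := hW (h ε) 0 hs3 hε3 (memSobolev_zero m _) (h0.le.trans hc.le) (r ε) hs1 hε2 (u ε) 0 hs5
      (isSolution_zero hF0 hε1) p hp
    rw [sub_zero, Pi.zero_apply, sub_zero] at this
    exact this.trans (mul_le_mul_of_nonneg_right (le_abs_self C) hα0.le)
  have hfin := volume_lens_ne_top (x₀ := x₀) hr₀.le hδ
  have hsub : lens x₀ (r ε) δ ⊆ lens x₀ r₀ δ := fun p hp =>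
    ⟨hp.1, hp.2.trans_le (pow_le_pow_left₀ hs1.le hs2 2)⟩
  have h1 := l2Norm_le (measurableSet_lens x₀ (r ε) δ) (volume_lens_ne_top hs1.le hδ)
    (mul_nonneg (abs_nonneg C) hα0.le) hle
  have h2 : Real.sqrt (volume (lens x₀ (r ε) δ)).toReal ≤ Real.sqrt (volume (lens x₀ r₀ δ)).toReal :=
    Real.sqrt_le_sqrt (ENNReal.toReal_mono hfin (measure_mono hsub))
  rw [lt_div_iff₀ hα0] at hε4
  have h3 := mul_le_mul_of_nonneg_left h2 (mul_nonneg (abs_nonneg C) hα0.le)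
  linarith

end Instability

end HadamardInstability

theorem theorem3p2 {d N : ℕ} (x₀ : HadamardInstability.Pos d)
    (U : Set (ℝ × HadamardInstability.Pos d × HadamardInstability.Val N)) (hU : IsOpen U)
    (hxU : (0, x₀, 0) ∈ U)
    (A : Fin d → ℝ × HadamardInstability.Pos d × HadamardInstability.Val N →
      Matrix (Fin N) (Fin N) ℝ)
    (F : ℝ × HadamardInstability.Pos d × HadamardInstability.Val N → HadamardInstability.Val N)
    (hA : ∀ j i k, AnalyticOnNhd ℝ (fun p => A j p i k) U)
    (hF : AnalyticOnNhd ℝ F U)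
    (hF0 : ∀ (t : ℝ) (x : HadamardInstability.Pos d), (t, x, 0) ∈ U → F (t, x, 0) = 0)
    (hell : ∃ (ξ : Fin d → ℝ) (μ : ℂ),
      Module.End.HasEigenvalue
        (Matrix.toLin' ((∑ j, ξ j • A j (0, x₀, 0)).map (fun a : ℝ => (a : ℂ)))) μ ∧ μ.im ≠ 0)
    (m : ℕ) :
    (∀ α r₀ δ : ℝ, 0 < α → α ≤ 1 → 0 < r₀ → 0 < δ →
      ∃ (ε₀ : ℝ) (r : ℝ → ℝ) (h : ℝ → HadamardInstability.Pos d → HadamardInstability.Val N)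
        (u : ℝ → ℝ × HadamardInstability.Pos d → HadamardInstability.Val N),
        0 < ε₀ ∧
        (∀ ε : ℝ, 0 < ε → ε < ε₀ →
          0 < r ε ∧ r ε ≤ r₀ ∧
          HadamardInstability.MemSobolev m (Metric.ball x₀ r₀) (h ε) ∧
          0 < HadamardInstability.sobolevNorm m (Metric.ball x₀ r₀) (h ε) ∧
          HadamardInstability.IsSolution A F U x₀ (r ε) δ (h ε) (u ε)) ∧
        Tendsto r (𝓝[>] 0) (𝓝 0) ∧
        Tendsto (fun ε => HadamardInstability.sobolevNorm m (Metric.ball x₀ r₀) (h ε))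
          (𝓝[>] 0) (𝓝 0) ∧
        Tendsto (fun ε => HadamardInstability.l2Norm (HadamardInstability.lens x₀ (r ε) δ) (u ε) /
          HadamardInstability.sobolevNorm m (Metric.ball x₀ r₀) (h ε) ^ α) (𝓝[>] 0) atTop) ∧
    ¬ HadamardInstability.HolderWellPosed A F U x₀ m := by
  have H := fun α r₀ δ : ℝ => fun (hα : 0 < α) (hα1 : α ≤ 1) (hr₀ : 0 < r₀) (hδ : 0 < δ) =>
    HadamardInstability.exists_hadamard_instability hU hxU hA hF hF0 hell m hα hα1 hr₀ hδ
  exact ⟨H, HadamardInstability.not_holderWellPosed hU hxU hF0 H⟩
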